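/- Let $K$ be an algebraically closed field and let $n\ge 1$, $k\ge 1$, $t\ge 0$ be integers. For a $(t+kn)\times t$ matrix $M$ of linear forms in $K[x_0,\dots,x_n]$ let $V_M$ be the cokernel of the induced map of sheaves on $\mathbb{P}^n_K$ $$\mathcal{O}_{\mathbb{P}^n}(-1)^{t}\xrightarrow{\ M\ }\mathcal{O}_{\mathbb{P}^n}^{\,t+kn}.$$ A vector bundle $E$ on $\mathbb{P}^n$ has *natural cohomology* if for every $a\in\mathbb{Z}$ at most one of the cohomology groups $H^i(\mathbb{P}^n,E(a))$, $i\ge 0$, is nonzero. Then for a general $M$ (that is, for all $M$ in some nonempty Zariski open subset of the affine space of all such matrices) the map $M$ is injective and $V_M$ is a vector bundle of rank $kn$, i.e. $V_M$ is a Steiner bundle of rank $kn$, $$0\to\mathcal{O}_{\mathbb{P}^n}(-1)^{t}\xrightarrow{\ M\ }\mathcal{O}_{\mathbb{P}^n}^{\,t+kn}\to V_M\to 0,$$ and both $V_M$ and its dual $V_M^*$ have natural cohomology. In particular, the general Steiner bundle on $\mathbb{P}^n$ whose rank is a multiple of $n$ has natural cohomology. -/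

import Mathlib

open CategoryTheory Limits AlgebraicGeometry TopologicalSpace Opposite

universe u

namespace Steiner

section Twist

variable {A σ : Type u} [CommRing A] [SetLike σ A] [AddSubgroupClass σ A]
  (𝒜 : ℕ → σ) [GradedRing 𝒜]

/-- The (ungraded) localization of `A` at the homogeneous prime `x`. -/
abbrev LocAt (x : ProjectiveSpectrum 𝒜) : Type u :=
  Localization x.asHomogeneousIdeal.toIdeal.primeCompl

/-- A function on `U` that is a fixed fraction `a / b` of homogeneous elements of `A` with
`deg a - deg b = d`, the denominator vanishing nowhere on `U`. -/
def IsTwistFraction (d : ℤ) {U : Opens (ProjectiveSpectrum 𝒜)} (f : ∀ x : U, LocAt 𝒜 x.1) : Prop :=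
  ∃ (i j : ℕ) (a b : A), a ∈ 𝒜 i ∧ b ∈ 𝒜 j ∧ (i : ℤ) = j + d ∧
    ∀ x : U, ∃ hb : b ∈ x.1.asHomogeneousIdeal.toIdeal.primeCompl,
      f x = Localization.mk a ⟨b, hb⟩

/-- The sections of `𝒪(d)` over `U`: the functions that are locally fractions of degree `d`. -/
def IsTwistSection (d : ℤ) {U : Opens (ProjectiveSpectrum 𝒜)} (f : ∀ x : U, LocAt 𝒜 x.1) : Prop :=
  ∀ x : U, ∃ (V : Opens (ProjectiveSpectrum 𝒜)) (_ : x.1 ∈ V) (h : V ≤ U),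
    IsTwistFraction 𝒜 d (fun y : V ↦ f ⟨y.1, h y.2⟩)

variable {𝒜}

lemma IsTwistSection.res {d : ℤ} {U V : Opens (ProjectiveSpectrum 𝒜)} (h : V ≤ U)
    {f : ∀ x : U, LocAt 𝒜 x.1} (hf : IsTwistSection 𝒜 d f) :
    IsTwistSection 𝒜 d (fun y : V ↦ f ⟨y.1, h y.2⟩) := by
  intro x
  obtain ⟨W, hxW, hWU, i, j, a, b, ha, hb, hij, hf⟩ := hf ⟨x.1, h x.2⟩
  exact ⟨W ⊓ V, ⟨hxW, x.2⟩, inf_le_right, i, j, a, b, ha, hb, hij,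
    fun y ↦ hf ⟨y.1, y.2.1⟩⟩

lemma IsTwistSection.zero (d : ℤ) (U : Opens (ProjectiveSpectrum 𝒜)) :
    IsTwistSection 𝒜 d (0 : ∀ x : U, LocAt 𝒜 x.1) := by
  intro x
  obtain ⟨j, b, hb, hbx, hjd⟩ : ∃ (j : ℕ) (b : A), b ∈ 𝒜 j ∧ b ∉ x.1.asHomogeneousIdeal.toIdeal ∧
      0 ≤ (j : ℤ) + d := by
    obtain ⟨m, f, hf, hm, hx⟩ : ∃ (m : ℕ) (f : A), f ∈ 𝒜 m ∧ 0 < m ∧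
        f ∉ x.1.asHomogeneousIdeal.toIdeal := by
      classical
      by_contra! H
      refine x.1.not_irrelevant_le fun z hz ↦ ?_
      rw [← DirectSum.sum_support_decompose 𝒜 z]
      refine x.1.asHomogeneousIdeal.toIdeal.sum_mem fun k hk ↦ ?_
      rcases Nat.eq_zero_or_pos k with rfl | hk0
      · have : (DirectSum.decompose 𝒜 z 0 : A) = 0 := hz
        simp [this]
      · exact H k _ (SetLike.coe_mem _) hk0
    refine ⟨d.natAbs * m, f ^ d.natAbs, ?_, ?_, ?_⟩
    · simpa using SetLike.pow_mem_graded d.natAbs hf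
    · exact fun h ↦ hx (x.1.isPrime.mem_of_pow_mem _ h)
    · push_cast
      have : |d| * 1 ≤ |d| * (m : ℤ) := by gcongr; exact_mod_cast hm
      have := neg_abs_le d
      linarith
  refine ⟨ProjectiveSpectrum.basicOpen 𝒜 b ⊓ U, ⟨hbx, x.2⟩, inf_le_right,
    ((j : ℤ) + d).toNat, j, 0, b, zero_mem _, hb, Int.toNat_of_nonneg hjd, fun y ↦ ⟨y.2.1, ?_⟩⟩
  exact (Localization.mk_zero _).symm

lemma IsTwistSection.add {d : ℤ} {U : Opens (ProjectiveSpectrum 𝒜)}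
    {f g : ∀ x : U, LocAt 𝒜 x.1} (hf : IsTwistSection 𝒜 d f) (hg : IsTwistSection 𝒜 d g) :
    IsTwistSection 𝒜 d (f + g) := by
  intro x
  obtain ⟨V, hxV, hVU, i, j, a, b, ha, hb, hij, hf⟩ := hf x
  obtain ⟨W, hxW, hWU, i', j', a', b', ha', hb', hij', hg⟩ := hg x
  refine ⟨V ⊓ W, ⟨hxV, hxW⟩, inf_le_left.trans hVU, i + j', j + j', b * a' + b' * a, b * b',
    ?_, SetLike.mul_mem_graded hb hb', by push_cast; linarith, fun y ↦ ?_⟩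
  · have h1 : b * a' ∈ 𝒜 (i + j') := by
      have : i + j' = j + i' := by omega
      rw [this]; exact SetLike.mul_mem_graded hb ha'
    have h2 : b' * a ∈ 𝒜 (i + j') := by
      rw [add_comm]; exact SetLike.mul_mem_graded hb' ha
    exact add_mem h1 h2
  · obtain ⟨h1, e1⟩ := hf ⟨y.1, y.2.1⟩
    obtain ⟨h2, e2⟩ := hg ⟨y.1, y.2.2⟩
    refine ⟨mul_mem h1 h2, ?_⟩
    simp only [Pi.add_apply] at *
    rw [e1, e2, Localization.add_mk]
    rfl

lemma IsTwistSection.neg {d : ℤ} {U : Opens (ProjectiveSpectrum 𝒜)}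
    {f : ∀ x : U, LocAt 𝒜 x.1} (hf : IsTwistSection 𝒜 d f) : IsTwistSection 𝒜 d (-f) := by
  intro x
  obtain ⟨V, hxV, hVU, i, j, a, b, ha, hb, hij, hf⟩ := hf x
  refine ⟨V, hxV, hVU, i, j, -a, b, neg_mem ha, hb, hij, fun y ↦ ?_⟩
  obtain ⟨h1, e1⟩ := hf y
  refine ⟨h1, ?_⟩
  simp only [Pi.neg_apply] at *
  rw [e1, Localization.neg_mk]

lemma IsTwistSection.mul {d e : ℤ} {U : Opens (ProjectiveSpectrum 𝒜)}
    {f g : ∀ x : U, LocAt 𝒜 x.1} (hf : IsTwistSection 𝒜 d f) (hg : IsTwistSection 𝒜 e g) :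
    IsTwistSection 𝒜 (d + e) (f * g) := by
  intro x
  obtain ⟨V, hxV, hVU, i, j, a, b, ha, hb, hij, hf⟩ := hf x
  obtain ⟨W, hxW, hWU, i', j', a', b', ha', hb', hij', hg⟩ := hg x
  refine ⟨V ⊓ W, ⟨hxV, hxW⟩, inf_le_left.trans hVU, i + i', j + j', a * a', b * b',
    SetLike.mul_mem_graded ha ha', SetLike.mul_mem_graded hb hb', by push_cast; linarith,
    fun y ↦ ?_⟩
  obtain ⟨h1, e1⟩ := hf ⟨y.1, y.2.1⟩
  obtain ⟨h2, e2⟩ := hg ⟨y.1, y.2.2⟩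
  refine ⟨mul_mem h1 h2, ?_⟩
  simp only [Pi.mul_apply] at *
  rw [e1, e2, Localization.mk_mul]
  rfl

/-- A regular function, viewed as a function with values in the ungraded localizations, is locally a
fraction of degree `0`. -/
lemma isTwistSection_structureSheaf {U : Opens (ProjectiveSpectrum 𝒜)}
    (s : (ProjectiveSpectrum.Proj.structureSheaf 𝒜).obj.obj (op U)) :
    IsTwistSection 𝒜 0 (fun x : U ↦ (s.1 x).val) := by
  intro x
  obtain ⟨V, hxV, i, j, a, b, hb, hs⟩ := s.2 x
  refine ⟨V, hxV, i.le, j, j, a, b, a.2, b.2, by simp, fun y ↦ ⟨hb y, ?_⟩⟩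
  exact (congrArg HomogeneousLocalization.val (hs y)).trans (HomogeneousLocalization.val_mk _)

lemma isTwistSection_const {m : ℕ} {ℓ : A} (hℓ : ℓ ∈ 𝒜 m) (U : Opens (ProjectiveSpectrum 𝒜)) :
    IsTwistSection 𝒜 m (fun x : U ↦ algebraMap A (LocAt 𝒜 x.1) ℓ) := fun x ↦
  ⟨U, x.2, le_rfl, m, 0, ℓ, 1, hℓ, SetLike.GradedOne.one_mem, by simp, fun y ↦
    ⟨one_mem _, (Localization.mk_one_eq_algebraMap _).symm⟩⟩

variable (𝒜)

/-- The group of sections of `𝒪(d)` over `U`. -/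
def twistSections (d : ℤ) (U : Opens (ProjectiveSpectrum 𝒜)) :
    AddSubgroup (∀ x : U, LocAt 𝒜 x.1) where
  carrier := {f | IsTwistSection 𝒜 d f}
  zero_mem' := .zero d U
  add_mem' := .add
  neg_mem' := .neg

noncomputable instance twistModule (d : ℤ) (U : Opens (ProjectiveSpectrum 𝒜)) :
    Module Γ(Proj 𝒜, U) (twistSections 𝒜 d U) where
  smul s f := ⟨fun x ↦ (s.1 x).val * f.1 x, by
    have := (isTwistSection_structureSheaf s).mul f.2
    rwa [zero_add] at this⟩
  one_smul f := Subtype.ext <| funext fun x ↦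
    (congrArg (· * f.1 x) (HomogeneousLocalization.val_one)).trans (one_mul (f.1 x))
  mul_smul r s f := Subtype.ext <| funext fun x ↦
    (congrArg (· * f.1 x) (HomogeneousLocalization.val_mul (r.1 x) (s.1 x))).trans
      (mul_assoc _ _ _)
  smul_zero s := Subtype.ext <| funext fun x ↦ mul_zero _
  smul_add s f g := Subtype.ext <| funext fun x ↦ mul_add _ _ _
  add_smul r s f := Subtype.ext <| funext fun x ↦
    (congrArg (· * f.1 x) (HomogeneousLocalization.val_add (r.1 x) (s.1 x))).trans
      (add_mul _ _ _)
  zero_smul f := Subtype.ext <| funext fun x ↦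
    (congrArg (· * f.1 x) (HomogeneousLocalization.val_zero)).trans (zero_mul (f.1 x))

/-- The sections of `𝒪(d)`, as a presheaf of abelian groups. -/
def twistPresheafAb (d : ℤ) : TopCat.Presheaf Ab.{u} (Proj 𝒜) where
  obj U := AddCommGrpCat.of (twistSections 𝒜 d U.unop)
  map {U V} i := AddCommGrpCat.ofHom
    { toFun := fun f ↦ ⟨fun x ↦ f.1 ⟨x.1, i.unop.le x.2⟩, f.2.res i.unop.le⟩
      map_zero' := rfl
      map_add' := fun _ _ ↦ rfl }

lemma twistPresheafAb_isSheaf (d : ℤ) : (twistPresheafAb 𝒜 d).IsSheaf := by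
  refine (TopCat.Presheaf.isSheaf_iff_isSheaf_comp (forget AddCommGrpCat) _).2 ?_
  let P : TopCat.LocalPredicate (X := TopCat.of (ProjectiveSpectrum 𝒜)) (LocAt 𝒜) :=
    { pred := fun {U} f ↦ IsTwistSection 𝒜 d (U := U) f
      res := fun i f hf ↦ IsTwistSection.res i.le hf
      locality := fun {U} f hf x ↦ by
        obtain ⟨V, hxV, i, h⟩ := hf x
        obtain ⟨W, hxW, hWV, hW⟩ := h ⟨x.1, hxV⟩
        exact ⟨W, hxW, hWV.trans i.le, hW⟩ }
  exact (TopCat.subsheafToTypes P).2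

/-- The presheaf of modules `𝒪(d)`. -/
noncomputable def twistPresheaf (d : ℤ) : (Proj 𝒜).PresheafOfModules :=
  letI (U : (Proj 𝒜).Opensᵒᵖ) :
      Module ((Proj 𝒜).ringCatSheaf.obj.obj U) ((twistPresheafAb 𝒜 d).obj U) :=
    twistModule 𝒜 d U.unop
  .ofPresheaf (twistPresheafAb 𝒜 d) fun _ _ _ _ _ ↦ rfl

/-- The twisting sheaf of Serre, `𝒪(d)` on `Proj 𝒜`: its sections over `U` are the functions
`x ↦ s x ∈ A_x` that are locally fractions of homogeneous elements of degree difference `d`. -/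
noncomputable def twistingSheaf (d : ℤ) : (Proj 𝒜).Modules where
  val := twistPresheaf 𝒜 d
  isSheaf := twistPresheafAb_isSheaf 𝒜 d

variable {𝒜}

/-- Multiplication by a homogeneous element `ℓ` of degree `m`, as a map `𝒪(d) ⟶ 𝒪(e)` with
`e = d + m`. -/
noncomputable def twistMul {m : ℕ} (ℓ : 𝒜 m) {d e : ℤ} (h : e = d + m) :
    twistingSheaf 𝒜 d ⟶ twistingSheaf 𝒜 e where
  val := PresheafOfModules.homMk
    { app := fun U ↦ AddCommGrpCat.ofHom
        { toFun := fun f : twistSections 𝒜 d U.unop ↦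
            (⟨fun x ↦ algebraMap A (LocAt 𝒜 x.1) ℓ * f.1 x, by
              have := (isTwistSection_const ℓ.2 U.unop).mul f.2
              rwa [add_comm, ← h] at this⟩ : twistSections 𝒜 e U.unop)
          map_zero' := Subtype.ext <| funext fun x ↦ mul_zero _
          map_add' := fun f g ↦ Subtype.ext <| funext fun x ↦ mul_add _ _ _ }
      naturality := fun _ _ _ ↦ rfl }
    fun U r f ↦ Subtype.ext <| funext fun x ↦ mul_left_comm _ _ _

end Twist

section Modules

variable {X : Scheme.{u}}

/-- The sections over `U` of the sheaf `ℋom(F, G)`: the morphisms `F|_U ⟶ G|_U`, that is, the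
families of `𝒪(W)`-linear maps `F(W) → G(W)`, `W ⊆ U` open, compatible with restriction. -/
def homSections (F G : X.Modules) (U : X.Opens) :
    AddSubgroup (∀ W : {W : X.Opens // W ≤ U}, Γ(F, W.1) →ₗ[Γ(X, W.1)] Γ(G, W.1)) where
  carrier := {φ | ∀ (W W' : {W : X.Opens // W ≤ U}) (h : W'.1 ≤ W.1) (s : Γ(F, W.1)),
    G.presheaf.map (homOfLE h).op (φ W s) = φ W' (F.presheaf.map (homOfLE h).op s)}
  zero_mem' _ _ _ _ := map_zero _
  add_mem' {φ ψ} hφ hψ W W' h s := by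
    have h1 := hφ W W' h s
    have h2 := hψ W W' h s
    simp only [Pi.add_apply, LinearMap.add_apply, map_add, h1, h2]
  neg_mem' {φ} hφ W W' h s := by
    have h1 := hφ W W' h s
    simp only [Pi.neg_apply, LinearMap.neg_apply, map_neg, h1]

noncomputable instance homModule (F G : X.Modules) (U : X.Opens) :
    Module Γ(X, U) (homSections F G U) where
  smul r φ := ⟨fun W ↦ X.presheaf.map (homOfLE W.2).op r • φ.1 W, by
    intro W W' h s
    have h1 := φ.2 W W' h s
    simp only [LinearMap.smul_apply, Scheme.Modules.map_smul, h1]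
    congr 1
    rw [← CommRingCat.comp_apply, ← Functor.map_comp]
    rfl⟩
  one_smul φ := Subtype.ext <| funext fun W ↦
    (congrArg (· • φ.1 W) (map_one _)).trans (one_smul _ _)
  mul_smul r s φ := Subtype.ext <| funext fun W ↦
    (congrArg (· • φ.1 W) (map_mul _ r s)).trans (mul_smul _ _ _)
  smul_zero r := Subtype.ext <| funext fun W ↦ smul_zero _
  smul_add r φ ψ := Subtype.ext <| funext fun W ↦ smul_add _ _ _
  add_smul r s φ := Subtype.ext <| funext fun W ↦
    (congrArg (· • φ.1 W) (map_add _ r s)).trans (add_smul _ _ _)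
  zero_smul φ := Subtype.ext <| funext fun W ↦
    (congrArg (· • φ.1 W) (map_zero _)).trans (zero_smul _ _)

/-- The presheaf of abelian groups underlying `ℋom(F, G)`. -/
noncomputable def homPresheafAb (F G : X.Modules) : TopCat.Presheaf Ab.{u} X where
  obj U := AddCommGrpCat.of (homSections F G U.unop)
  map {U V} i := AddCommGrpCat.ofHom
    { toFun := fun φ ↦ ⟨fun W ↦ φ.1 ⟨W.1, W.2.trans i.unop.le⟩, fun W W' h s ↦
        φ.2 ⟨W.1, W.2.trans i.unop.le⟩ ⟨W'.1, W'.2.trans i.unop.le⟩ h s⟩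
      map_zero' := rfl
      map_add' := fun _ _ ↦ rfl }

lemma ring_map_map_apply {U V W : X.Opensᵒᵖ} (f : U ⟶ V) (g : V ⟶ W) (r : X.presheaf.obj U) :
    X.presheaf.map (f ≫ g) r = X.presheaf.map g (X.presheaf.map f r) := by
  rw [Functor.map_comp, CommRingCat.comp_apply]

lemma map_map_apply (F : X.Modules) {U V W : X.Opens} (h : V ≤ U) (h' : W ≤ V) (s : Γ(F, U)) :
    F.presheaf.map (homOfLE h').op (F.presheaf.map (homOfLE h).op s) =
      F.presheaf.map (homOfLE (h'.trans h)).op s := by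
  rw [← AddCommGrpCat.comp_apply, ← Functor.map_comp]
  rfl

lemma eq_of_cover (G : X.Modules) {ι : Type u} (U : ι → X.Opens) {W : X.Opens} (hW : W ≤ iSup U)
    (g g' : Γ(G, W))
    (h : ∀ i, G.presheaf.map (homOfLE (inf_le_right : U i ⊓ W ≤ W)).op g =
      G.presheaf.map (homOfLE (inf_le_right : U i ⊓ W ≤ W)).op g') : g = g' := by
  refine TopCat.Sheaf.eq_of_locally_eq' ⟨G.presheaf, G.isSheaf⟩ (fun i ↦ U i ⊓ W) W
    (fun i ↦ homOfLE inf_le_right) ?_ g g' h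
  rw [← iSup_inf_eq]
  exact le_inf hW le_rfl

lemma homPresheafAb_isSheaf (F G : X.Modules) : (homPresheafAb F G).IsSheaf := by
  refine (TopCat.Presheaf.isSheaf_iff_isSheaf_comp (forget AddCommGrpCat) _).2 ?_
  refine TopCat.Presheaf.isSheaf_of_isSheafUniqueGluing_types _ ?_
  intro ι U (sf : ∀ i, homSections F G (U i)) hsf
  have compat (i j : ι) (W : X.Opens) (hi : W ≤ U i) (hj : W ≤ U j) :
      (sf i).1 ⟨W, hi⟩ = (sf j).1 ⟨W, hj⟩ :=
    congrFun (congrArg Subtype.val (hsf i j)) ⟨W, le_inf hi hj⟩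
  have key (W : {W : X.Opens // W ≤ iSup U}) (s : Γ(F, W.1)) : ∃ g : Γ(G, W.1), ∀ i,
      G.presheaf.map (homOfLE (inf_le_right : U i ⊓ W.1 ≤ W.1)).op g =
        (sf i).1 ⟨U i ⊓ W.1, inf_le_left⟩
          (F.presheaf.map (homOfLE (inf_le_right : U i ⊓ W.1 ≤ W.1)).op s) := by
    obtain ⟨g, hg, -⟩ := TopCat.Sheaf.existsUnique_gluing' ⟨G.presheaf, G.isSheaf⟩
      (fun i ↦ U i ⊓ W.1) W.1 (fun i ↦ homOfLE inf_le_right)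
      (by rw [← iSup_inf_eq]; exact le_inf W.2 le_rfl)
      (fun i ↦ (sf i).1 ⟨U i ⊓ W.1, inf_le_left⟩
          (F.presheaf.map (homOfLE (inf_le_right : U i ⊓ W.1 ≤ W.1)).op s))
      (by
        intro i j
        refine ((sf i).2 ⟨U i ⊓ W.1, inf_le_left⟩ ⟨(U i ⊓ W.1) ⊓ (U j ⊓ W.1),
          inf_le_left.trans inf_le_left⟩ inf_le_left _).trans ?_
        refine Eq.trans ?_ ((sf j).2 ⟨U j ⊓ W.1, inf_le_left⟩ ⟨(U i ⊓ W.1) ⊓ (U j ⊓ W.1),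
          inf_le_right.trans inf_le_left⟩ inf_le_right _).symm
        rw [map_map_apply, map_map_apply,
          compat i j _ (inf_le_left.trans inf_le_left) (inf_le_right.trans inf_le_left)])
    exact ⟨g, hg⟩
  choose Φ hΦ using key
  have sep (W : {W : X.Opens // W ≤ iSup U}) := eq_of_cover G U W.2
  let φ : homSections F G (iSup U) := ⟨fun W ↦
    { toFun := Φ W
      map_add' := fun s t ↦ sep W _ _ fun i ↦ by simp only [map_add, hΦ]
      map_smul' := fun r s ↦ sep W _ _ fun i ↦ by
        simp only [Scheme.Modules.map_smul, hΦ, map_smul, RingHom.id_apply] }, by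
    intro W W' h s
    refine sep W' _ _ fun i ↦ ?_
    change _ = G.presheaf.map _ (Φ W' _)
    rw [hΦ, map_map_apply, map_map_apply]
    change G.presheaf.map _ (Φ W s) = _
    rw [← map_map_apply G (inf_le_right : U i ⊓ W.1 ≤ W.1) (inf_le_inf_left (U i) h), hΦ]
    refine ((sf i).2 ⟨U i ⊓ W.1, inf_le_left⟩ ⟨U i ⊓ W'.1, inf_le_left⟩
      (inf_le_inf_left (U i) h) _).trans ?_
    rw [map_map_apply]⟩
  refine ⟨φ, fun i ↦ Subtype.ext <| funext fun W ↦ LinearMap.ext fun s ↦ ?_,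
    fun (ψ : homSections F G (iSup U)) hψ ↦ Subtype.ext <| funext fun W ↦ LinearMap.ext fun s ↦ ?_⟩
  · have hW : W.1 ≤ iSup U := W.2.trans (le_iSup U i)
    refine sep ⟨W.1, hW⟩ (Φ ⟨W.1, hW⟩ s) ((sf i).1 W s) fun j ↦ ?_
    rw [hΦ, compat j i _ inf_le_left (inf_le_right.trans W.2)]
    exact ((sf i).2 W ⟨U j ⊓ W.1, inf_le_right.trans W.2⟩ inf_le_right s).symm
  · refine sep W (ψ.1 W s) (Φ W s) fun i ↦ ?_
    rw [hΦ]
    refine (ψ.2 W ⟨U i ⊓ W.1, inf_le_right.trans W.2⟩ inf_le_right s).trans ?_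
    exact congrArg (fun α ↦ α (F.presheaf.map (homOfLE (inf_le_right : U i ⊓ W.1 ≤ W.1)).op s))
      (congrFun (congrArg Subtype.val (hψ i)) ⟨U i ⊓ W.1, inf_le_left⟩)

/-- The presheaf of modules underlying `ℋom(F, G)`. -/
noncomputable def homPresheaf (F G : X.Modules) : X.PresheafOfModules :=
  letI (U : X.Opensᵒᵖ) : Module (X.ringCatSheaf.obj.obj U) ((homPresheafAb F G).obj U) :=
    homModule F G U.unop
  .ofPresheaf (homPresheafAb F G) fun U V f r m ↦ Subtype.ext <| funext fun W ↦ by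
    refine congrArg (· • m.1 ⟨W.1, W.2.trans f.unop.le⟩)
      (?_ : X.presheaf.map (homOfLE (W.2.trans f.unop.le)).op r =
        X.presheaf.map (homOfLE W.2).op (X.presheaf.map f r))
    exact ring_map_map_apply f (homOfLE W.2).op r

/-- The sheaf `ℋom(F, G)` of morphisms between two `𝒪_X`-modules. -/
noncomputable def sheafHom (F G : X.Modules) : X.Modules where
  val := homPresheaf F G
  isSheaf := homPresheafAb_isSheaf F G

/-- The dual `F^* = ℋom(F, 𝒪_X)`. -/
noncomputable def dual (F : X.Modules) : X.Modules :=
  sheafHom F (SheafOfModules.unit X.ringCatSheaf)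

/-- The tensor product of two `𝒪_X`-modules: the sheaf associated with
`U ↦ F(U) ⊗_{𝒪(U)} G(U)`. -/
noncomputable def tensor (F G : X.Modules) : X.Modules :=
  (PresheafOfModules.sheafification (𝟙 X.ringCatSheaf.obj)).obj
    (PresheafOfModules.Monoidal.tensorObj (R := X.presheaf) F.val G.val)

/-- The sheaf cohomology `H^i(X, F)`. -/
abbrev coh (F : X.Modules) (i : ℕ) : Type u :=
  Sheaf.H ((SheafOfModules.toSheaf X.ringCatSheaf).obj F) i

/-- `F` is locally isomorphic to `𝒪_X^r`: a vector bundle of rank `r`. -/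
def IsVectorBundle (F : X.Modules) (r : ℕ) : Prop :=
  ∀ x : X, ∃ U : X.Opens, x ∈ U ∧
    Nonempty (F.restrict U.ι ≅
      SheafOfModules.free (R := U.toScheme.ringCatSheaf) (ULift.{u} (Fin r)))

/-- A vector bundle `F` has natural cohomology (with respect to the family of line bundles `L a`)
if every twist `F ⊗ L a` has at most one nonzero cohomology group. -/
def HasNaturalCoh (L : ℤ → X.Modules) (F : X.Modules) : Prop :=
  ∀ (a : ℤ) (i j : ℕ), Nontrivial (coh (tensor F (L a)) i) →
    Nontrivial (coh (tensor F (L a)) j) → i = j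

end Modules

section ProjectiveSpace

variable (K : Type u) [Field K] (n : ℕ)

attribute [local instance] MvPolynomial.gradedAlgebra Abelian.hasFiniteBiproducts

/-- Projective space `ℙⁿ = Proj K[x₀, …, xₙ]`. -/
noncomputable def projSpace : Scheme.{u} := Proj (MvPolynomial.homogeneousSubmodule (Fin (n + 1)) K)

/-- The line bundle `𝒪(d)` on `ℙⁿ`. -/
noncomputable def lineBundle (d : ℤ) : (projSpace K n).Modules :=
  twistingSheaf (MvPolynomial.homogeneousSubmodule (Fin (n + 1)) K) d

variable {K n}

/-- The linear form `∑ cₖ xₖ`. -/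
noncomputable def linearForm (c : Fin (n + 1) → K) :
    MvPolynomial.homogeneousSubmodule (Fin (n + 1)) K 1 :=
  ⟨∑ k, MvPolynomial.C (c k) * MvPolynomial.X k, MvPolynomial.IsHomogeneous.sum _ _ _ fun k _ ↦ by
    simpa using (MvPolynomial.isHomogeneous_C _ (c k)).mul (MvPolynomial.isHomogeneous_X K k)⟩

/-- The map `𝒪(-1)^t ⟶ 𝒪^s` given by an `s × t` matrix of linear forms, the `(i, j)` entry being the
form `∑ₖ M (i, j, k) xₖ`. -/
noncomputable def steinerMap {s t : ℕ} (M : Fin s × Fin t × Fin (n + 1) → K) :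
    (⨁ fun _ : Fin t ↦ lineBundle K n (-1)) ⟶ (⨁ fun _ : Fin s ↦ lineBundle K n 0) :=
  biproduct.matrix fun j i ↦ twistMul (linearForm fun k ↦ M (i, j, k)) (by simp)

/-- The cokernel `V` of the map `𝒪(-1)^t ⟶ 𝒪^s` given by a matrix of linear forms. -/
noncomputable def steinerCoker {s t : ℕ} (M : Fin s × Fin t × Fin (n + 1) → K) :
    (projSpace K n).Modules :=
  cokernel (steinerMap M)

/-- The matrix `M` of linear forms presents a Steiner bundle of rank `r`: the sequence
`0 ⟶ 𝒪(-1)^t ⟶ 𝒪^(t+r) ⟶ V ⟶ 0` is exact and `V` is a vector bundle of rank `r`. -/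
def IsSteinerPresentation {t r : ℕ} (M : Fin (t + r) × Fin t × Fin (n + 1) → K) : Prop :=
  Mono (steinerMap M) ∧ IsVectorBundle (steinerCoker M) r

end ProjectiveSpace

/-- `P` holds for a general point of the affine space `K^ι`: it holds on some nonempty Zariski open
subset (which may be taken to be the complement of the zero set of a nonzero polynomial). -/
def ForGeneral {K : Type u} [Field K] {ι : Type} (P : (ι → K) → Prop) : Prop :=
  ∃ F : MvPolynomial ι K, F ≠ 0 ∧ ∀ M : ι → K, MvPolynomial.eval M F ≠ 0 → P M

end Steiner

/-! Write S = K[x_0, …, x_n] and s = t + kn, and let B be the s × t matrix of linear forms.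
Everything is read off from the transposed maps Bᵀ : S_d^s → S_{d+1}^t. The inequality s·C(n+d, n) ≤
t·C(n+d+1, n) between the dimensions amounts to k(d+1) ≤ t. This is where the rank kn enters: one
inequality, linear in d, decides whether injectivity or surjectivity is to be expected.

For general B the expectation holds in every degree (`exists_polynomial_maximal_rank`). Each
condition is open in a fixed degree; injectivity passes to lower degrees and surjectivity to higher
ones, so two degrees suffice. It remains to exhibit one example: the block Hankel matrix with x_a in
row j + ka of column j. It is treated by induction on (n, d), reducing modulo x_0 and then dividing
by x_0 (`hankel_injective`, `hankel_surjective`).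

If Bᵀ is surjective in some degree, a power of each variable times each basis vector lies in its
image, so the maximal minors of B have no common zero (`TransSurjective.exists_minor`). Hence B has
left inverses locally, the cokernel V is locally free of rank kn, and two sequences are exact for
all d: 0 → 𝒪(d)^t → 𝒪(d+1)^s → V(d+1) → 0 and 0 → V^*(d) → 𝒪(d)^s → 𝒪(d+1)^t → 0
(`presentationComplex_shortExact`, `dualComplex_shortExact`).

The line bundle 𝒪(d) has cohomology only in degrees 0 and n: H⁰ is S_d, and Hⁿ is dual to S_{-d-n-1}
under the residue pairing. On H⁰ the second sequence is Bᵀ itself; on Hⁿ the first is dual to Bᵀ.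
Maximal rank kills the kernel or the cokernel, so only one cohomology group survives. On Hⁿ the
second sequence is dual to B acting on polynomials, which is injective, so there the map is onto.
The remaining terms vanish for degree reasons.

The cohomology of 𝒪(d) is obtained from H^p(U, F) = Ext^p(ℤ_U, F). Affine vanishing needs only
coverings by two basic open sets (`ext_freeOpen_eq_zero`), and the Mayer-Vietoris sequence adds the
coordinate open sets one at a time (`CechClass.nonempty`, `exists_top_class`). -/

namespace Steiner
-- Cohomology of open sets as Ext groups out of the sheaves ℤ_U.
section FreeSheaf

open Abelian

variable {X : TopCat.{u}}

/-- Sheaves of abelian groups on a topological space. -/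
abbrev AbSheaf (X : TopCat.{u}) := CategoryTheory.Sheaf (Opens.grothendieckTopology X) AddCommGrpCat.{u}

/-- The abelian sheaf `ℤ_U` that represents the sections over `U`. -/
noncomputable def freeOpen (U : Opens X) : AbSheaf X :=
  (presheafToSheaf (Opens.grothendieckTopology X) AddCommGrpCat.{u}).obj
    (yoneda.obj U ⋙ AddCommGrpCat.free)

/-- The morphism `ℤ_U ⟶ ℤ_V` for `U ≤ V`. -/
noncomputable def freeOpenMap {U V : Opens X} (h : U ≤ V) : freeOpen U ⟶ freeOpen V :=
  (presheafToSheaf (Opens.grothendieckTopology X) AddCommGrpCat.{u}).map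
    (Functor.whiskerRight (yoneda.map (homOfLE h)) _)

lemma freeOpenMap_comp {U V W : Opens X} (h : U ≤ V) (h' : V ≤ W) :
    freeOpenMap h ≫ freeOpenMap h' = freeOpenMap (h.trans h') :=
  ((presheafToSheaf (Opens.grothendieckTopology X) AddCommGrpCat.{u}).map_comp _ _).symm.trans
    (congrArg _ (by rw [← Functor.whiskerRight_comp, ← Functor.map_comp]; rfl))

/-- Restriction of sections of a presheaf of abelian groups. -/
abbrev res (F : AbSheaf X) {U V : Opens X} (h : U ≤ V) :
    F.obj.obj (op V) →+ F.obj.obj (op U) := (F.obj.map (homOfLE h).op).hom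

lemma res_res (F : AbSheaf X) {U V W : Opens X} (h : U ≤ V) (h' : V ≤ W)
    (s : F.obj.obj (op W)) : res F h (res F h' s) = res F (h.trans h') s := by
  change (F.obj.map _ ≫ F.obj.map _) s = _
  rw [← Functor.map_comp]
  rfl

/-- The morphisms `ℤ_U ⟶ F` are the sections of `F` over `U`. -/
noncomputable def homFreeOpenEquiv (U : Opens X) (F : AbSheaf X) :
    (freeOpen U ⟶ F) ≃ F.obj.obj (op U) :=
  ((sheafificationAdjunction (Opens.grothendieckTopology X) AddCommGrpCat.{u}).homEquiv _ _).trans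
    (((AddCommGrpCat.adj.whiskerRight (Opens X)ᵒᵖ).homEquiv _ _).trans yonedaEquiv)

/-- The tautological section of `ℤ_U` over `U`. -/
noncomputable def freeOpenOne (U : Opens X) : (freeOpen U).obj.obj (op U) :=
  homFreeOpenEquiv U _ (𝟙 _)

lemma homFreeOpenEquiv_comp {U : Opens X} {F G : AbSheaf X}
    (f : freeOpen U ⟶ F) (g : F ⟶ G) :
    homFreeOpenEquiv U G (f ≫ g) = g.hom.app _ (homFreeOpenEquiv U F f) := by
  have h1 := (sheafificationAdjunction (Opens.grothendieckTopology X)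
    AddCommGrpCat.{u}).homEquiv_naturality_right f g
  have h2 := (AddCommGrpCat.adj.whiskerRight (Opens X)ᵒᵖ).homEquiv_naturality_right
    ((sheafificationAdjunction (Opens.grothendieckTopology X) AddCommGrpCat.{u}).homEquiv _ _ f)
    g.hom
  refine (congrArg (fun z ↦ yonedaEquiv
    ((AddCommGrpCat.adj.whiskerRight (Opens X)ᵒᵖ).homEquiv _ _ z)) h1).trans ?_
  exact congrArg yonedaEquiv h2

lemma homFreeOpenEquiv_apply {U : Opens X} {F : AbSheaf X}
    (f : freeOpen U ⟶ F) : homFreeOpenEquiv U F f = f.hom.app _ (freeOpenOne U) := by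
  rw [freeOpenOne, ← homFreeOpenEquiv_comp, Category.id_comp]

lemma homFreeOpenEquiv_map {U V : Opens X} (h : U ≤ V) {F : AbSheaf X} (f : freeOpen V ⟶ F) :
    homFreeOpenEquiv U F (freeOpenMap h ≫ f) = res F h (homFreeOpenEquiv V F f) := by
  have h1 := (sheafificationAdjunction (Opens.grothendieckTopology X)
    AddCommGrpCat.{u}).homEquiv_naturality_left
      (Functor.whiskerRight (yoneda.map (homOfLE h)) AddCommGrpCat.free) f
  have h2 := (AddCommGrpCat.adj.whiskerRight (Opens X)ᵒᵖ).homEquiv_naturality_left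
    (yoneda.map (homOfLE h))
    ((sheafificationAdjunction (Opens.grothendieckTopology X) AddCommGrpCat.{u}).homEquiv _ _ f)
  refine (congrArg (fun z ↦ yonedaEquiv
    ((AddCommGrpCat.adj.whiskerRight (Opens X)ᵒᵖ).homEquiv _ _ z)) h1).trans ?_
  refine (congrArg yonedaEquiv h2).trans ?_
  exact (yonedaEquiv_naturality _ _).symm

/-- `H⁰(U, F) = F(U)`. -/
noncomputable def extZeroEquiv (U : Opens X) (F : AbSheaf X) :
    Ext (freeOpen U) F 0 ≃+ F.obj.obj (op U) :=
  { Ext.addEquiv₀.toEquiv.trans (homFreeOpenEquiv U F) with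
    map_add' := fun x y ↦ by
      refine (congrArg (homFreeOpenEquiv U F) (map_add Ext.addEquiv₀ x y)).trans ?_
      change _ = homFreeOpenEquiv U F (Ext.addEquiv₀ x) + homFreeOpenEquiv U F (Ext.addEquiv₀ y)
      rw [homFreeOpenEquiv_apply, homFreeOpenEquiv_apply, homFreeOpenEquiv_apply]
      rfl }

lemma extZeroEquiv_mk₀ {U : Opens X} {F : AbSheaf X} (f : freeOpen U ⟶ F) :
    extZeroEquiv U F (Ext.mk₀ f) = homFreeOpenEquiv U F f := by
  refine congrArg (homFreeOpenEquiv U F) ?_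
  exact Ext.addEquiv₀.symm.injective (by simp)

lemma extZeroEquiv_comp {U : Opens X} {F G : AbSheaf X}
    (x : Ext (freeOpen U) F 0) (g : F ⟶ G) :
    extZeroEquiv U G (x.comp (Ext.mk₀ g) (add_zero 0)) = g.hom.app _ (extZeroEquiv U F x) := by
  obtain ⟨f, rfl⟩ := (Ext.mk₀_bijective _ _).surjective x
  rw [Ext.mk₀_comp_mk₀, extZeroEquiv_mk₀, extZeroEquiv_mk₀, homFreeOpenEquiv_comp]

lemma extZeroEquiv_res {U V : Opens X} (h : U ≤ V) {F : AbSheaf X}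
    (x : Ext (freeOpen V) F 0) :
    extZeroEquiv U F ((Ext.mk₀ (freeOpenMap h)).comp x (zero_add 0)) =
      res F h (extZeroEquiv V F x) := by
  obtain ⟨f, rfl⟩ := (Ext.mk₀_bijective _ _).surjective x
  rw [Ext.mk₀_comp_mk₀, extZeroEquiv_mk₀, extZeroEquiv_mk₀, homFreeOpenEquiv_map]

/-- The sheaf `ℤ_X` is the constant sheaf `ℤ`. -/
noncomputable def freeOpenTopIso :
    freeOpen (⊤ : Opens X) ≅ (constantSheaf (Opens.grothendieckTopology X) AddCommGrpCat.{u}).obj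
      (AddCommGrpCat.of (ULift ℤ)) :=
  (presheafToSheaf (Opens.grothendieckTopology X) AddCommGrpCat.{u}).mapIso
    (NatIso.ofComponents (fun U ↦
      -- Every open set has exactly one morphism to ⊤, so the free presheaf is already constant with
      -- value ℤ. This links the Ext groups used here to `Sheaf.H`, which is defined from the
      -- constant sheaf.
      haveI : Unique ((yoneda.obj (⊤ : Opens X)).obj U) :=
        { default := homOfLE le_top, uniq := fun _ ↦ rfl }
      ((FreeAbelianGroup.uniqueEquiv ((yoneda.obj (⊤ : Opens X)).obj U)).trans
        AddEquiv.ulift.symm).toAddCommGrpIso) (fun {U V} f ↦ by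
        ext (x : FreeAbelianGroup _)
        induction x using FreeAbelianGroup.induction_on with
        | zero => exact (map_zero _).trans (map_zero _).symm
        | of x =>
          refine congrArg ULift.up ((congrArg _ (FreeAbelianGroup.map_of_apply _)).trans ?_)
          simp [FreeAbelianGroup.uniqueEquiv]
        | neg x h => exact (map_neg _ _).trans ((congrArg _ h).trans (map_neg _ _).symm)
        | add x y h h' =>
          exact (map_add _ _ _).trans ((congrArg₂ _ h h').trans (map_add _ _ _).symm)))

end FreeSheaf
-- Gluing, local lifts, and flasqueness of injective sheaves.
section Gluing

variable {X : TopCat.{u}} (F : AbSheaf X)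

lemma exists_glue {ι : Type*} (U : ι → Opens X) {W : Opens X} (hU : ∀ i, U i ≤ W)
    (hW : W ≤ iSup U) (s : ∀ i, F.obj.obj (op (U i)))
    (h : ∀ i j, res F (inf_le_left : U i ⊓ U j ≤ _) (s i) = res F inf_le_right (s j)) :
    ∃ c, ∀ i, res F (hU i) c = s i :=
  (TopCat.Sheaf.existsUnique_gluing' (X := X) F U W (fun i ↦ homOfLE (hU i)) hW s h).exists

lemma eq_of_res_eq {ι : Type*} (U : ι → Opens X) {W : Opens X} (hU : ∀ i, U i ≤ W)
    (hW : W ≤ iSup U) (s t : F.obj.obj (op W)) (h : ∀ i, res F (hU i) s = res F (hU i) t) : s = t :=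
  TopCat.Sheaf.eq_of_locally_eq' (X := X) F U W (fun i ↦ homOfLE (hU i)) hW s t h

lemma exists_glue₂ {U V W : Opens X} (hU : U ≤ W) (hV : V ≤ W) (hW : W ≤ U ⊔ V)
    (a : F.obj.obj (op U)) (b : F.obj.obj (op V))
    (h : res F (inf_le_left : U ⊓ V ≤ _) a = res F inf_le_right b) :
    ∃ c, res F hU c = a ∧ res F hV c = b := by
  obtain ⟨c, hc⟩ := exists_glue F (fun i : Bool ↦ bif i then U else V) (W := W)
    (Bool.rec hV hU) (by rwa [iSup_bool_eq]) (Bool.rec b a) (by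
      rintro (_ | _) (_ | _)
      · rfl
      · have := congrArg (res F (le_of_eq (inf_comm V U))) h
        rw [res_res, res_res] at this
        exact this.symm
      · exact h
      · rfl)
  exact ⟨c, hc true, hc false⟩

lemma exists_local_lift {F G : AbSheaf X} (g : F ⟶ G) [Epi g] {U : Opens X}
    (s : G.obj.obj (op U)) {x : X} (hx : x ∈ U) :
    ∃ (V : Opens X) (h : V ≤ U) (t : F.obj.obj (op V)), x ∈ V ∧ g.hom.app (op V) t = res G h s := by
  have := (Sheaf.isLocallySurjective_iff_epi' AddCommGrpCat.{u} g).2 inferInstance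
  obtain ⟨V, f, ⟨t, ht⟩, hxV⟩ :=
    Presheaf.imageSieve_mem (Opens.grothendieckTopology X) g.hom s x hx
  exact ⟨V, f.le, t, hxV, ht⟩

lemma res_app {F G : AbSheaf X} (g : F ⟶ G) {U V : Opens X} (h : U ≤ V) (s : F.obj.obj (op V)) :
    res G h (g.hom.app _ s) = g.hom.app _ (res F h s) :=
  (ConcreteCategory.congr_hom (g.hom.naturality (homOfLE h).op) s).symm

/-- Both the free abelian group functor and sheafification preserve monomorphisms. -/
instance mono_freeOpenMap {U V : Opens X} (h : U ≤ V) : Mono (freeOpenMap h) := by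
  have : Mono (Functor.whiskerRight (yoneda.map (homOfLE h)) (AddCommGrpCat.free.{u})) := by
    infer_instance
  exact Functor.map_mono (presheafToSheaf (Opens.grothendieckTopology X) AddCommGrpCat.{u}) _

lemma exists_of_app_eq_zero {S : ShortComplex (AbSheaf X)} (hS : S.ShortExact) {U : Opens X}
    (s : S.X₂.obj.obj (op U)) (h : S.g.hom.app (op U) s = 0) :
    ∃ t, S.f.hom.app (op U) t = s :=
  TopCat.Sheaf.sections_exact_of_left_exact (X := X) hS.exact hS.mono_f s h

lemma app_app_eq_zero (S : ShortComplex (AbSheaf X)) {U : Opens X} (s : S.X₁.obj.obj (op U)) :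
    S.g.hom.app (op U) (S.f.hom.app (op U) s) = 0 :=
  ConcreteCategory.congr_hom (congrArg (fun φ ↦ φ.hom.app (op U)) S.zero) s

/-- Injective sheaves are flasque: a section over `U` is a map ℤ_U ⟶ I, and it extends along the
monomorphism ℤ_U ⟶ ℤ_V. -/
lemma exists_extend_of_injective {I : AbSheaf X} [Injective I] {U V : Opens X} (h : U ≤ V)
    (s : I.obj.obj (op U)) : ∃ t, res I h t = s := by
  obtain ⟨f, rfl⟩ := (homFreeOpenEquiv U I).surjective s
  refine ⟨homFreeOpenEquiv V I (Injective.factorThru f (freeOpenMap h)), ?_⟩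
  rw [← homFreeOpenEquiv_map, Injective.comp_factorThru]

end Gluing

/-! ### Vanishing of higher cohomology on affine open sets. -/

section AffineVanishing

open Abelian

variable {X : Scheme.{u}}

/-- The first Čech cohomology of `F` for the coverings of an affine open set `U` by two basic open
sets vanishes. -/
def HasTwoCoverLift (F : AbSheaf X.toTopCat) (U : X.Opens) : Prop :=
  ∀ f g : Γ(X, U), Ideal.span {f, g} = ⊤ →
    ∀ s : F.obj.obj (op (X.basicOpen f ⊓ X.basicOpen g)),
      ∃ (a : F.obj.obj (op (X.basicOpen f))) (b : F.obj.obj (op (X.basicOpen g))),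
        s = res F inf_le_left a + res F inf_le_right b

/-- The functions f such that `q` lifts over D(f) form an ideal. Closure under addition is what the
two-cover condition provides, since D(f) and D(f') cover D(f + f'). Local liftability shows that
this ideal is the unit ideal. The class `P` only has to consist of affine open sets and be stable
under passing to basic open sets. -/
lemma exists_lift_of_hasTwoCoverLift {P : X.Opens → Prop} (hP : ∀ U, P U → IsAffineOpen U)
    (hP' : ∀ (U) (f : Γ(X, U)), P U → P (X.basicOpen f))
    {S : ShortComplex (AbSheaf X.toTopCat)} (hS : S.ShortExact)
    (h : ∀ U, P U → HasTwoCoverLift S.X₁ U) {U : X.Opens} (hU : P U)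
    (q : S.X₃.obj.obj (op U)) : ∃ i, S.g.hom.app (op U) i = q := by
  have := hS.mono_f
  have := hS.epi_g
  let J : Ideal Γ(X, U) :=
    { carrier := {f | ∃ i, S.g.hom.app (op (X.basicOpen f)) i = res S.X₃ (X.basicOpen_le f) q}
      zero_mem' := ⟨0, eq_of_res_eq _ (fun i : Empty ↦ i.elim) (fun i ↦ i.elim) (by simp) _ _
        (fun i ↦ i.elim)⟩
      smul_mem' := by
        rintro a f ⟨i, hi⟩
        have hle : X.basicOpen (a • f) ≤ X.basicOpen f := by
          rw [smul_eq_mul, X.basicOpen_mul]; exact inf_le_right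
        refine ⟨res _ hle i, ?_⟩
        rw [← res_app, hi, res_res]
      add_mem' := by
        rintro f f' ⟨i, hi⟩ ⟨i', hi'⟩
        set W := X.basicOpen (f + f') with hWdef
        have hWU : W ≤ U := X.basicOpen_le _
        let r : Γ(X, U) →+* Γ(X, W) := (X.presheaf.map (homOfLE hWU).op).hom
        have hr (a : Γ(X, U)) : X.basicOpen (r a) = W ⊓ X.basicOpen a := X.basicOpen_res _ _
        have hunit : IsUnit (r (f + f')) := X.toRingedSpace.isUnit_res_basicOpen (f + f')
        have hspan : Ideal.span {r f, r f'} = ⊤ := by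
          refine Ideal.eq_top_of_isUnit_mem _ ?_ hunit
          rw [map_add]
          exact add_mem (Ideal.subset_span (by simp)) (Ideal.subset_span (by simp))
        have hle : X.basicOpen (r f) ≤ X.basicOpen f := by rw [hr]; exact inf_le_right
        have hle' : X.basicOpen (r f') ≤ X.basicOpen f' := by rw [hr]; exact inf_le_right
        obtain ⟨j, hj⟩ : ∃ j, S.g.hom.app _ j = res _ (hle.trans (X.basicOpen_le _)) q :=
          ⟨res _ hle i, by rw [← res_app, hi, res_res]⟩
        obtain ⟨j', hj'⟩ : ∃ j, S.g.hom.app _ j = res _ (hle'.trans (X.basicOpen_le _)) q :=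
          ⟨res _ hle' i', by rw [← res_app, hi', res_res]⟩
        have hcov : W ≤ X.basicOpen (r f) ⊔ X.basicOpen (r f') := by
          have := ((hP _ (hP' _ (f + f') hU)).iSup_basicOpen_eq_self_iff (s := {r f, r f'})).2
            hspan
          refine this.ge.trans (iSup_le ?_)
          rintro ⟨x, rfl | rfl⟩
          exacts [le_sup_left, le_sup_right]
        -- On the overlap the two lifts differ by a section of the kernel sheaf. Splitting it into
        -- two pieces allows both lifts to be corrected until they glue.
        obtain ⟨e, he⟩ := exists_of_app_eq_zero hS
          (U := X.basicOpen (r f) ⊓ X.basicOpen (r f')) (res S.X₂ inf_le_left j - res S.X₂ inf_le_right j') (by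
            rw [map_sub, ← res_app, ← res_app, hj, hj', res_res, res_res, sub_self])
        obtain ⟨a, b, rfl⟩ := h W (hP' _ _ hU) (r f) (r f') hspan e
        obtain ⟨c, hc, hc'⟩ := exists_glue₂ S.X₂ (X.basicOpen_le (r f)) (X.basicOpen_le (r f'))
          hcov
          (j - S.f.hom.app _ a) (j' + S.f.hom.app _ b) (by
            rw [map_sub, map_add, res_app, res_app, sub_eq_iff_eq_add, add_assoc, add_comm,
              ← sub_eq_iff_eq_add]
            refine he.symm.trans ?_
            rw [map_add, add_comm])
        refine ⟨c, ?_⟩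
        refine eq_of_res_eq S.X₃ (fun i : Bool ↦ bif i then X.basicOpen (r f) else
          X.basicOpen (r f')) (Bool.rec (X.basicOpen_le _) (X.basicOpen_le _))
          (hcov.trans_eq (iSup_bool_eq (f := fun i : Bool ↦ bif i then X.basicOpen (r f) else
            X.basicOpen (r f'))).symm) _ _ (Bool.rec ?_ ?_)
        · change res S.X₃ (X.basicOpen_le (r f')) _ = res S.X₃ (X.basicOpen_le (r f')) _
          rw [res_app, hc', map_add, hj', app_app_eq_zero, add_zero, res_res]
        · change res S.X₃ (X.basicOpen_le (r f)) _ = res S.X₃ (X.basicOpen_le (r f)) _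
          rw [res_app, hc, map_sub, hj, app_app_eq_zero, sub_zero, res_res] }
  -- An epimorphism of sheaves lifts sections locally, so the sets D(f) with f in J cover `U`.
  have hJ : J = ⊤ := by
    rw [← Ideal.span_eq J, ← (hP U hU).iSup_basicOpen_eq_self_iff]
    refine le_antisymm (iSup_le fun f ↦ X.basicOpen_le _) fun x hx ↦ ?_
    obtain ⟨V, hVU, t, hxV, ht⟩ := exists_local_lift S.g q hx
    obtain ⟨f, hfV, hxf⟩ := (hP U hU).exists_basicOpen_le ⟨x, hxV⟩ hx
    refine Opens.mem_iSup.2 ⟨⟨f, res _ hfV t, ?_⟩, hxf⟩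
    rw [← res_app, ht, res_res]
  obtain ⟨i, hi⟩ : (1 : Γ(X, U)) ∈ J := hJ ▸ Submodule.mem_top
  have h1 : U ≤ X.basicOpen (1 : Γ(X, U)) := (X.basicOpen_of_isUnit isUnit_one).ge
  refine ⟨res _ h1 i, ?_⟩
  rw [← res_app, hi, res_res]
  exact congrArg (fun φ ↦ φ q) (congrArg AddCommGrpCat.Hom.hom (S.X₃.obj.map_id _))

/-- Vanishing of the cohomology of affine open sets. -/
theorem ext_freeOpen_eq_zero {P : X.Opens → Prop} (hP : ∀ U, P U → IsAffineOpen U)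
    (hP' : ∀ (U) (f : Γ(X, U)), P U → P (X.basicOpen f)) (p : ℕ) :
    ∀ (F : AbSheaf X.toTopCat), (∀ U, P U → HasTwoCoverLift F U) → ∀ {U : X.Opens}, P U →
      ∀ x : Ext (freeOpen (X := X.toTopCat) U) F (p + 1), x = 0 := by
  induction p with
  | zero =>
    intro F hF U hU x
    let S : ShortComplex (AbSheaf X.toTopCat) :=
      ShortComplex.mk (Injective.ι F) (cokernel.π (Injective.ι F)) (cokernel.condition _)
    have hS : S.ShortExact := { exact := ShortComplex.exact_cokernel _ }
    -- Dimension shifting: `x` is the connecting image of a section of the quotient, and that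
    -- section lifts to the injective sheaf.
    obtain ⟨y, rfl⟩ := Ext.covariant_sequence_exact₁ _ hS x (Ext.eq_zero_of_injective _)
      (zero_add 1)
    obtain ⟨i, hi⟩ := exists_lift_of_hasTwoCoverLift hP hP' hS hF hU (extZeroEquiv U S.X₃ y)
    obtain ⟨i, rfl⟩ := (extZeroEquiv U S.X₂).surjective i
    rw [← extZeroEquiv_comp] at hi
    obtain rfl := (extZeroEquiv U S.X₃).injective hi
    rw [Ext.comp_assoc (a₂₃ := 1) _ _ _ (by lia) (by lia) (by lia), hS.comp_extClass, Ext.comp_zero]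
  | succ p ih =>
    intro F hF U hU x
    let S : ShortComplex (AbSheaf X.toTopCat) :=
      ShortComplex.mk (Injective.ι F) (cokernel.π (Injective.ι F)) (cokernel.condition _)
    have hS : S.ShortExact := { exact := ShortComplex.exact_cokernel _ }
    obtain ⟨y, rfl⟩ := Ext.covariant_sequence_exact₁ _ hS x (Ext.eq_zero_of_injective _) rfl
    rw [ih S.X₃ ?_ hU y, Ext.zero_comp]
    -- The quotient inherits the two-cover condition: a section over the overlap D(fg) lifts to the
    -- injective sheaf, and by flasqueness the lift extends to D(f). No contribution from D(g) is
    -- needed.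
    intro V hV f g _ s
    have hfg : X.basicOpen (f * g) = X.basicOpen f ⊓ X.basicOpen g := X.basicOpen_mul f g
    obtain ⟨i, rfl⟩ := exists_lift_of_hasTwoCoverLift hP hP' hS hF (hfg ▸ hP' _ (f * g) hV) s
    obtain ⟨j, rfl⟩ := exists_extend_of_injective (I := Injective.under F)
      (inf_le_left : X.basicOpen f ⊓ X.basicOpen g ≤ _) i
    exact ⟨S.g.hom.app _ j, 0, by rw [map_zero, add_zero, res_app]⟩

end AffineVanishing
-- The Mayer-Vietoris sequence as an extension class.
section MayerVietoris

open Abelian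

variable {X : TopCat.{u}}

/-- Restriction in cohomology. -/
noncomputable abbrev extRes {F : AbSheaf X} {U V : Opens X} (h : U ≤ V) {p : ℕ}
    (x : Ext (freeOpen V) F p) : Ext (freeOpen U) F p :=
  (Ext.mk₀ (freeOpenMap h)).comp x (zero_add p)

lemma freeOpenMap_refl (U : Opens X) : freeOpenMap (le_refl U) = 𝟙 _ :=
  (congrArg ((presheafToSheaf (Opens.grothendieckTopology X) AddCommGrpCat.{u}).map)
    ((congrArg (fun f ↦ Functor.whiskerRight f AddCommGrpCat.free) (yoneda.map_id U)).trans
      (Functor.whiskerRight_id' _))).trans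
    ((presheafToSheaf (Opens.grothendieckTopology X) AddCommGrpCat.{u}).map_id _)

lemma extRes_refl {F : AbSheaf X} {U : Opens X} {p : ℕ} (x : Ext (freeOpen U) F p) :
    extRes le_rfl x = x := by
  rw [extRes, freeOpenMap_refl, Ext.mk₀_id_comp]

lemma extRes_extRes {F : AbSheaf X} {U V W : Opens X} (h : U ≤ V) (h' : V ≤ W) {p : ℕ}
    (x : Ext (freeOpen W) F p) : extRes h (extRes h' x) = extRes (h.trans h') x := by
  rw [extRes, extRes, extRes, ← freeOpenMap_comp h h', ← Ext.mk₀_comp_mk₀]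
  exact (Ext.comp_assoc _ _ _ _ _ (by lia)).symm

lemma extRes_comp {F G : AbSheaf X} {U V : Opens X} (h : U ≤ V) {p q r : ℕ}
    (x : Ext (freeOpen V) F p) (y : Ext F G q) (hpq : p + q = r) :
    extRes h (x.comp y hpq) = (extRes h x).comp y hpq :=
  (Ext.comp_assoc _ _ _ _ _ (by lia)).symm

variable {A U V B A' U' V' B' : Opens X}

/-- The Mayer-Vietoris square of `B = U ⊔ V` with `A = U ⊓ V`. -/
noncomputable def mvSquare (hA : A = U ⊓ V) (hB : B = U ⊔ V) :
    (Opens.grothendieckTopology X).MayerVietorisSquare :=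
  Opens.mayerVietorisSquare'
    { X₁ := A
      X₂ := U
      X₃ := V
      X₄ := B
      f₁₂ := homOfLE (hA.trans_le inf_le_left)
      f₁₃ := homOfLE (hA.trans_le inf_le_right)
      f₂₄ := homOfLE (le_sup_left.trans_eq hB.symm)
      f₃₄ := homOfLE (le_sup_right.trans_eq hB.symm)
      fac := Subsingleton.elim _ _ } hB hA

/-- The Mayer-Vietoris sequence `ℤ_A ⟶ ℤ_U ⊞ ℤ_V ⟶ ℤ_B`. -/
noncomputable abbrev mvComplex (hA : A = U ⊓ V) (hB : B = U ⊔ V) : ShortComplex (AbSheaf X) where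
  X₁ := freeOpen A
  X₂ := freeOpen U ⊞ freeOpen V
  X₃ := freeOpen B
  f := biprod.lift (freeOpenMap (hA.trans_le inf_le_left)) (-freeOpenMap (hA.trans_le inf_le_right))
  g := biprod.desc (freeOpenMap (le_sup_left.trans_eq hB.symm))
    (freeOpenMap (le_sup_right.trans_eq hB.symm))
  zero := (mvSquare hA hB).shortComplex.zero

lemma mvComplex_shortExact (hA : A = U ⊓ V) (hB : B = U ⊔ V) : (mvComplex hA hB).ShortExact :=
  (mvSquare hA hB).shortComplex_shortExact

/-- The class in `Ext¹(ℤ_B, ℤ_A)` of the Mayer-Vietoris sequence. -/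
noncomputable def mvClass (hA : A = U ⊓ V) (hB : B = U ⊔ V) : Ext (freeOpen B) (freeOpen A) 1 :=
  (mvComplex_shortExact hA hB).extClass

/-- Exactness of the Mayer-Vietoris sequence at H^q(U ∪ V); composition with `mvClass` is the
connecting map. -/
lemma exists_mvClass_comp (hA : A = U ⊓ V) (hB : B = U ⊔ V) {F : AbSheaf X} {p q : ℕ}
    (hpq : 1 + p = q) (x : Ext (freeOpen B) F q)
    (hU : extRes (le_sup_left.trans_eq hB.symm) x = 0)
    (hV : extRes (le_sup_right.trans_eq hB.symm) x = 0) :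
    ∃ y : Ext (freeOpen A) F p, (mvClass hA hB).comp y hpq = x := by
  refine Ext.contravariant_sequence_exact₃ (mvComplex_shortExact hA hB) F x ?_ hpq
  apply Ext.biprodAddEquiv.injective
  rw [map_zero]
  refine Prod.ext ?_ ?_
  · refine Eq.trans ?_ hU
    simp [extRes, Ext.biprodAddEquiv]
  · refine Eq.trans ?_ hV
    simp [extRes, Ext.biprodAddEquiv]

/-- Exactness of the Mayer-Vietoris sequence at H^p(U ∩ V). -/
lemma exists_of_mvClass_comp_eq_zero (hA : A = U ⊓ V) (hB : B = U ⊔ V) {F : AbSheaf X} {p q : ℕ}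
    (hpq : 1 + p = q) (y : Ext (freeOpen A) F p) (hy : (mvClass hA hB).comp y hpq = 0) :
    ∃ (a : Ext (freeOpen U) F p) (b : Ext (freeOpen V) F p),
      y = extRes (hA.trans_le inf_le_left) a + extRes (hA.trans_le inf_le_right) b := by
  obtain ⟨x, hx⟩ := Ext.contravariant_sequence_exact₁ (mvComplex_shortExact hA hB) F y hpq hy
  obtain ⟨⟨a, b⟩, rfl⟩ := Ext.biprodAddEquiv.symm.surjective x
  -- The sign cancels the one in the second component of `mvComplex`.
  refine ⟨a, -b, ?_⟩
  rw [← hx]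
  simp [extRes, Ext.biprodAddEquiv, Ext.mk₀_neg]

lemma mvClass_comp_extRes_left (hA : A = U ⊓ V) (hB : B = U ⊔ V) {F : AbSheaf X} {p q : ℕ}
    (hpq : 1 + p = q) (a : Ext (freeOpen U) F p) :
    (mvClass hA hB).comp (extRes (hA.trans_le inf_le_left) a) hpq = 0 := by
  have h := (mvComplex_shortExact hA hB).extClass_comp_assoc
    ((Ext.mk₀ biprod.fst).comp a (zero_add p)) (h := hpq)
  rw [Ext.mk₀_comp_mk₀_assoc, biprod.lift_fst] at h
  exact h

lemma mvClass_comp_extRes_right (hA : A = U ⊓ V) (hB : B = U ⊔ V) {F : AbSheaf X} {p q : ℕ}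
    (hpq : 1 + p = q) (a : Ext (freeOpen V) F p) :
    (mvClass hA hB).comp (extRes (hA.trans_le inf_le_right) a) hpq = 0 := by
  have h := (mvComplex_shortExact hA hB).extClass_comp_assoc
    ((Ext.mk₀ biprod.snd).comp a (zero_add p)) (h := hpq)
  rw [Ext.mk₀_comp_mk₀_assoc, biprod.lift_snd, Ext.mk₀_neg, Ext.neg_comp, Ext.comp_neg,
    neg_eq_zero] at h
  exact h

lemma mvClass_naturality (hA : A = U ⊓ V) (hB : B = U ⊔ V) (hA' : A' = U' ⊓ V')
    (hB' : B' = U' ⊔ V') (hAA : A' ≤ A) (hUU : U' ≤ U) (hVV : V' ≤ V) (hBB : B' ≤ B) :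
    (mvClass hA' hB').comp (Ext.mk₀ (freeOpenMap hAA)) (add_zero 1) =
      extRes hBB (mvClass hA hB) := by
  let φ : mvComplex hA' hB' ⟶ mvComplex hA hB :=
    { τ₁ := freeOpenMap hAA
      τ₂ := biprod.map (freeOpenMap hUU) (freeOpenMap hVV)
      τ₃ := freeOpenMap hBB
      comm₁₂ := biprod.hom_ext _ _ (by simp [freeOpenMap_comp]) (by simp [freeOpenMap_comp])
      comm₂₃ := biprod.hom_ext' _ _ (by simp [freeOpenMap_comp]) (by simp [freeOpenMap_comp]) }
  exact ShortComplex.ShortExact.extClass_naturality (mvComplex_shortExact hA' hB')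
    (mvComplex_shortExact hA hB) φ

end MayerVietoris
-- Čech cohomology by adding one open set at a time.
section Cech

open Abelian

variable {X : TopCat.{u}} {ι : Type} [DecidableEq ι]

/-- The union of the open sets `D (insert i J)`, `i ∈ s`. -/
def unionOpen (D : Finset ι → Opens X) (s J : Finset ι) : Opens X :=
  s.sup fun i ↦ D (insert i J)

/-- Data that compute the cohomology of `F` on unions of the open sets `D {i}`: the groups of
sections over the finite intersections `D I` are embedded into one group `A`, which carries
projections onto the subgroups of elements that are regular along the `i`-th open set. -/
structure CechDatum (F : AbSheaf X) (D : Finset ι → Opens X) (A : Type u) [AddCommGroup A] where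
  /-- the value of a section -/
  val : ∀ I, F.obj.obj (op (D I)) →+ A
  val_injective : ∀ I, Function.Injective (val I)
  val_res : ∀ {I J} (h : D J ≤ D I) (s), val J (res F h s) = val I s
  /-- the sections over `D I` -/
  sub : Finset ι → AddSubgroup A
  range_val : ∀ I, I.Nonempty → (val I).range = sub I
  -- A Hartogs property: it makes sections over a union of at least two of the sets extend.
  sub_inter : ∀ I J, sub I ⊓ sub J ≤ sub (I ∩ J)
  /-- the projection along `i` -/
  proj : ι → A →+ A
  -- The projection drops the poles along i. It is a retraction, used to compare coboundaries before
  -- and after i is adjoined to the index set.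
  proj_mem : ∀ i I a, a ∈ sub I → proj i a ∈ sub (I.erase i)
  proj_eq : ∀ i I a, i ∉ I → a ∈ sub I → proj i a = a
  acyclic : ∀ I, I.Nonempty → ∀ p (x : Ext (freeOpen (D I)) F (p + 1)), x = 0

/-- The coboundaries: sums of elements regular along some `i ∈ s`. -/
def CechDatum.coboundary {F : AbSheaf X} {D : Finset ι → Opens X} {A : Type u} [AddCommGroup A]
    (c : CechDatum F D A) (s J : Finset ι) : AddSubgroup A :=
  ⨆ i ∈ s, c.sub ((s ∪ J).erase i)

/-- A class `γ J ∈ Extᵐ(ℤ_W, ℤ_{D (s ∪ J)})`, `W` the union of the `D (insert i J)`, that computes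
the cohomology of `W`. -/
structure CechClass (D : Finset ι → Opens X) (s : Finset ι) (m : ℕ) where
  /-- the class -/
  γ : ∀ J, Ext (freeOpen (unionOpen D s J)) (freeOpen (D (s ∪ J))) m
  naturality : ∀ {J J'} (h : unionOpen D s J' ≤ unionOpen D s J) (h' : D (s ∪ J') ≤ D (s ∪ J)),
    J ⊆ J' → extRes h (γ J) = (γ J').comp (Ext.mk₀ (freeOpenMap h')) (add_zero m)
  -- In degree 0 the class is just the inclusion map; the cast is there because `m` is a variable.
  eq_mk₀ : ∀ (hm : 0 = m) (J) (h : unionOpen D s J ≤ D (s ∪ J)),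
    γ J = hm ▸ Ext.mk₀ (freeOpenMap h)
  eq_zero : ∀ {F : AbSheaf X} {A : Type u} [AddCommGroup A] (_ : CechDatum F D A) (J),
    Disjoint s J → ∀ p (x : Ext (freeOpen (unionOpen D s J)) F (p + 1)), p + 1 ≠ m → x = 0
  surjective : ∀ {F : AbSheaf X} {A : Type u} [AddCommGroup A] (_ : CechDatum F D A) (J),
    Disjoint s J → ∀ x : Ext (freeOpen (unionOpen D s J)) F m,
      ∃ a : Ext (freeOpen (D (s ∪ J))) F 0, x = (γ J).comp a (add_zero m)
  comp_eq_zero_iff : ∀ {F : AbSheaf X} {A : Type u} [AddCommGroup A] (c : CechDatum F D A) (J),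
    Disjoint s J → m ≠ 0 → ∀ a : Ext (freeOpen (D (s ∪ J))) F 0,
      (γ J).comp a (add_zero m) = 0 ↔ c.val _ (extZeroEquiv _ _ a) ∈ c.coboundary s J

variable {D : Finset ι → Opens X}

lemma unionOpen_cons (s J : Finset ι) (r : ι) (hr : r ∉ s) :
    unionOpen D (Finset.cons r s hr) J = unionOpen D s J ⊔ D (insert r J) := by
  rw [unionOpen, Finset.sup_cons, sup_comm]
  rfl

variable (hD : ∀ I J, D (I ∪ J) = D I ⊓ D J)

include hD

lemma antitone_of_union {I J : Finset ι} (h : I ⊆ J) : D J ≤ D I := by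
  rw [← Finset.union_eq_right.2 h, hD]
  exact inf_le_left

/-- By distributivity, meeting a union with one more open set gives a union of the same kind, with r
moved into J. This is why the auxiliary index set J is carried along the whole induction. -/
lemma unionOpen_insert_right (s J : Finset ι) (r : ι) :
    unionOpen D s (insert r J) = unionOpen D s J ⊓ D (insert r J) := by
  rw [unionOpen, unionOpen, Finset.sup_inf_distrib_right]
  refine Finset.sup_congr rfl fun i _ ↦ ?_
  rw [← hD]
  congr 1
  grind

/-- The case of one open set. -/
noncomputable def CechClass.singleton (i : ι) : CechClass D {i} 0 :=
  have h (J : Finset ι) : unionOpen D {i} J = D ({i} ∪ J) := Finset.sup_singleton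
  { γ := fun J ↦ Ext.mk₀ (freeOpenMap (h J).le)
    naturality := fun {J J'} h1 h2 _ ↦ by
      rw [extRes, Ext.mk₀_comp_mk₀, Ext.mk₀_comp_mk₀, freeOpenMap_comp, freeOpenMap_comp]
    eq_mk₀ := fun _ J _ ↦ rfl
    eq_zero := fun c J _ p x _ ↦ by
      have := c.acyclic ({i} ∪ J) (by simp) p (extRes (h J).ge x)
      rw [← extRes_refl x, ← extRes_extRes (h J).le (h J).ge, this, extRes, Ext.comp_zero]
    surjective := fun c J _ x ↦ ⟨extRes (h J).ge x, by
      change x = extRes (h J).le _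
      rw [extRes_extRes, extRes_refl]⟩
    comp_eq_zero_iff := fun _ _ _ h ↦ (h rfl).elim }

/-- Adding one open set, by the Mayer-Vietoris sequence. -/
noncomputable def CechClass.consγ {s : Finset ι} {m : ℕ} (c : CechClass D s m) {r : ι} (hr : r ∉ s)
    (J : Finset ι) :
    Ext (freeOpen (unionOpen D (Finset.cons r s hr) J)) (freeOpen (D (Finset.cons r s hr ∪ J)))
      (m + 1) :=
  ((mvClass (unionOpen_insert_right hD s J r) (unionOpen_cons s J r hr)).comp
    (c.γ (insert r J)) (add_comm 1 m)).comp
      (Ext.mk₀ (freeOpenMap (antitone_of_union hD (by grind)))) (add_zero _)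

lemma CechClass.consγ_comp {s : Finset ι} {m : ℕ} (c : CechClass D s m) {r : ι} (hr : r ∉ s)
    (J : Finset ι) {F : AbSheaf X} (a : Ext (freeOpen (D (Finset.cons r s hr ∪ J))) F 0)
    (h : D (s ∪ insert r J) ≤ D (Finset.cons r s hr ∪ J)) :
    (c.consγ hD hr J).comp a (add_zero _) =
      (mvClass (unionOpen_insert_right hD s J r) (unionOpen_cons s J r hr)).comp
        ((c.γ (insert r J)).comp (extRes h a) (add_zero m)) (add_comm 1 m) := by
  rw [consγ, Ext.comp_assoc _ _ _ (add_zero (m + 1)) (add_zero 0) (by lia),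
    Ext.comp_assoc _ _ _ (add_comm 1 m) (add_zero m) (by lia)]

lemma CechClass.consγ_naturality {s : Finset ι} {m : ℕ} (c : CechClass D s m) {r : ι} (hr : r ∉ s)
    {J J' : Finset ι}
    (h : unionOpen D (Finset.cons r s hr) J' ≤ unionOpen D (Finset.cons r s hr) J)
    (h' : D (Finset.cons r s hr ∪ J') ≤ D (Finset.cons r s hr ∪ J)) (hJ : J ⊆ J') :
    extRes h (c.consγ hD hr J) =
      (c.consγ hD hr J').comp (Ext.mk₀ (freeOpenMap h')) (add_zero _) := by
  have hU : unionOpen D s J' ≤ unionOpen D s J :=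
    Finset.sup_mono_fun fun i _ ↦ antitone_of_union hD (by grind)
  have hU' : unionOpen D s (insert r J') ≤ unionOpen D s (insert r J) :=
    Finset.sup_mono_fun fun i _ ↦ antitone_of_union hD (by grind)
  have hV : D (insert r J') ≤ D (insert r J) := antitone_of_union hD (by grind)
  have hW : D (s ∪ insert r J') ≤ D (s ∪ insert r J) := antitone_of_union hD (by grind)
  rw [c.consγ_comp hD hr J' _ (antitone_of_union hD (by grind)), consγ, extRes_comp, extRes_comp,
    ← mvClass_naturality (unionOpen_insert_right hD s J r) (unionOpen_cons s J r hr)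
      (unionOpen_insert_right hD s J' r) (unionOpen_cons s J' r hr) hU' hU hV h,
    Ext.comp_assoc _ _ _ (add_zero 1) (zero_add m) (by lia)]
  have := c.naturality hU' hW (by grind)
  rw [extRes] at this
  rw [this, Ext.comp_assoc _ _ _ (add_comm 1 m) (add_zero _) (by lia),
    Ext.comp_assoc _ _ _ (add_zero m) (add_zero _) (by lia), Ext.mk₀_comp_mk₀, extRes,
    Ext.mk₀_comp_mk₀, freeOpenMap_comp, freeOpenMap_comp]

section

variable {F : AbSheaf X} {A : Type u} [AddCommGroup A] (d : CechDatum F D A)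

omit hD in
lemma CechDatum.val_extRes {I J : Finset ι} (h : D J ≤ D I) (x : Ext (freeOpen (D I)) F 0) :
    d.val J (extZeroEquiv _ _ (extRes h x)) = d.val I (extZeroEquiv _ _ x) := by
  rw [extZeroEquiv_res, d.val_res]

omit hD in
lemma CechDatum.exists_ext {I : Finset ι} (hI : I.Nonempty) {a : A} (ha : a ∈ d.sub I) :
    ∃ x : Ext (freeOpen (D I)) F 0, d.val I (extZeroEquiv _ _ x) = a := by
  rw [← d.range_val I hI] at ha
  obtain ⟨s, rfl⟩ := ha
  exact ⟨(extZeroEquiv _ _).symm s, by simp⟩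

omit hD in
lemma CechDatum.val_mem {I : Finset ι} (hI : I.Nonempty) (x : Ext (freeOpen (D I)) F 0) :
    d.val I (extZeroEquiv _ _ x) ∈ d.sub I := by
  rw [← d.range_val I hI]
  exact ⟨_, rfl⟩

omit hD in
lemma CechDatum.ext_injective {I : Finset ι} {x y : Ext (freeOpen (D I)) F 0}
    (h : d.val I (extZeroEquiv _ _ x) = d.val I (extZeroEquiv _ _ y)) : x = y :=
  (extZeroEquiv _ _).injective (d.val_injective I h)

/-- Sections over the union of two or more `D (insert i J)` extend to `D J`. -/
lemma CechDatum.exists_extend (d : CechDatum F D A) {s J : Finset ι} (hs : s.Nontrivial) (hsJ : Disjoint s J)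
    (hJ : J.Nonempty) (h : unionOpen D s J ≤ D J) (y : Ext (freeOpen (unionOpen D s J)) F 0) :
    ∃ x, y = extRes h x := by
  obtain ⟨i, hi, j, hj, hij⟩ := hs
  have hle (i : ι) (hi : i ∈ s) : D (insert i J) ≤ unionOpen D s J :=
    Finset.le_sup (f := fun i ↦ D (insert i J)) hi
  -- Restriction does not change values in `A`, so both sides can be compared over the intersection
  -- of the two open sets.
  have key (i j : ι) (hi : i ∈ s) (hj : j ∈ s) :
      d.val _ (extZeroEquiv _ _ (extRes (hle i hi) y)) =
        d.val _ (extZeroEquiv _ _ (extRes (hle j hj) y)) := by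
    rw [← d.val_extRes (antitone_of_union hD (Finset.subset_insert j _) :
      D (insert j (insert i J)) ≤ D (insert i J)),
      ← d.val_extRes (antitone_of_union hD (by grind) :
      D (insert j (insert i J)) ≤ D (insert j J)), extRes_extRes, extRes_extRes]
  obtain ⟨x, hx⟩ := d.exists_ext hJ (a := d.val _ (extZeroEquiv _ _ (extRes (hle i hi) y))) (by
    have h1 := d.val_mem (Finset.insert_nonempty i J) (extRes (hle i hi) y)
    have h2 := d.val_mem (Finset.insert_nonempty j J) (extRes (hle j hj) y)
    rw [← key i j hi hj] at h2
    have := d.sub_inter _ _ ⟨h1, h2⟩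
    rwa [show insert i J ∩ insert j J = J by
      have := Finset.disjoint_left.1 hsJ hi
      have := Finset.disjoint_left.1 hsJ hj
      grind] at this)
  refine ⟨x, (extZeroEquiv _ _).injective ?_⟩
  refine eq_of_res_eq F (fun i : s ↦ D (insert i.1 J)) (fun i ↦ hle i.1 i.2)
    (Finset.sup_le fun i hi ↦ le_iSup (fun i : s ↦ D (insert i.1 J)) ⟨i, hi⟩) _ _ fun k ↦ ?_
  rw [← extZeroEquiv_res, ← extZeroEquiv_res]
  change extZeroEquiv _ _ (extRes _ y) = extZeroEquiv _ _ (extRes _ (extRes h x))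
  rw [extRes_extRes]
  apply d.val_injective
  rw [d.val_extRes, hx]
  exact key _ _ k.2 hi

end

omit hD in
lemma ext_comp_sub {F G H : AbSheaf X} {m p q : ℕ} (x : Ext F G m) (y z : Ext G H p)
    (h : m + p = q) : x.comp y h - x.comp z h = x.comp (y - z) h := by
  rw [sub_eq_add_neg, sub_eq_add_neg, Ext.comp_add, Ext.comp_neg]

omit hD in
lemma CechClass.γ_comp_of_zero {s : Finset ι} (c : CechClass D s 0) (J : Finset ι)
    (h : unionOpen D s J ≤ D (s ∪ J)) {F : AbSheaf X} (a : Ext (freeOpen (D (s ∪ J))) F 0) :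
    (c.γ J).comp a (add_zero 0) = extRes h a := by
  rw [c.eq_mk₀ rfl J h]

/-- By Mayer-Vietoris it is enough that `x` dies on the old union and on the new open set, and that
the resulting class on the overlap is killed by the connecting map. Acyclicity handles the new set
and induction handles the old union, except in degree m. There the vanishing on the overlap is
pushed back to the union by the projection along r. The overlap class itself vanishes in positive
degree; in degree 0 it extends to the new open set. -/
lemma CechClass.cons_eq_zero {s : Finset ι} {m : ℕ} (hs : s.card = m + 1) (c : CechClass D s m)
    {r : ι} (hr : r ∉ s) {F : AbSheaf X} {A : Type u} [AddCommGroup A] (d : CechDatum F D A)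
    (J : Finset ι) (hJ : Disjoint (Finset.cons r s hr) J) (p : ℕ)
    (x : Ext (freeOpen (unionOpen D (Finset.cons r s hr) J)) F (p + 1)) (hp : p + 1 ≠ m + 1) :
    x = 0 := by
  have hsJ : Disjoint s J := hJ.mono_left (by simp)
  have hrJ : r ∉ J := Finset.disjoint_left.1 hJ (by simp)
  have hsJ' : Disjoint s (insert r J) := by
    rw [Finset.disjoint_insert_right]; exact ⟨hr, hsJ⟩
  have hsne : s.Nonempty := Finset.card_pos.1 (by lia)
  have hA := unionOpen_insert_right hD s J r
  have hB := unionOpen_cons (D := D) s J r hr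
  have hV : extRes (le_sup_right.trans_eq hB.symm) x = 0 := d.acyclic _ (by simp) _ _
  have hU : extRes (le_sup_left.trans_eq hB.symm) x = 0 := by
    by_cases hpm : p + 1 = m
    · subst hpm
      obtain ⟨a, ha⟩ := c.surjective d J hsJ (extRes (le_sup_left.trans_eq hB.symm) x)
      rw [ha, c.comp_eq_zero_iff d J hsJ (by simp)]
      have h1 : D (s ∪ insert r J) ≤ D (s ∪ J) := antitone_of_union hD (by grind)
      have h0 : (c.γ (insert r J)).comp (extRes h1 a) (add_zero _) = 0 := by
        have h2 : extRes (hA.trans_le inf_le_left) (extRes (le_sup_left.trans_eq hB.symm) x) = 0 := by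
          rw [extRes_extRes, ← extRes_extRes (hA.trans_le inf_le_right)
            (le_sup_right.trans_eq hB.symm), hV, extRes, Ext.comp_zero]
        rw [ha, extRes_comp, c.naturality _ h1 (Finset.subset_insert _ _),
          Ext.comp_assoc _ _ _ (add_zero _) (add_zero _) (by lia)] at h2
        exact h2
      rw [c.comp_eq_zero_iff d _ hsJ' (by simp), d.val_extRes] at h0
      have hmem := d.val_mem (I := s ∪ J) (hsne.mono Finset.subset_union_left) a
      -- The value of `a` has no pole along r, so `proj r` fixes it, while it turns coboundaries for
      -- `insert r J` into coboundaries for `J`.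
      rw [← d.proj_eq r (s ∪ J) _ (by grind) hmem]
      have hle : d.coboundary s (insert r J) ≤ (d.coboundary s J).comap (d.proj r) := by
        refine iSup₂_le fun i hi y hy ↦ ?_
        have := d.proj_mem r _ _ hy
        refine (le_iSup₂_of_le (f := fun i (_ : i ∈ s) ↦ d.sub ((s ∪ J).erase i)) i hi le_rfl :) ?_
        rwa [show (s ∪ J).erase i = ((s ∪ insert r J).erase i).erase r by grind]
      exact hle h0
    · exact c.eq_zero d J hsJ p _ hpm
  obtain ⟨y, rfl⟩ := exists_mvClass_comp hA hB (add_comm 1 p) x hU hV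
  obtain _ | p := p
  -- Here p = 0, hence m ≠ 0 and `s` has at least two elements, so the extension property applies.
  · have hs' : s.Nontrivial := Finset.one_lt_card_iff_nontrivial.1 (by lia)
    obtain ⟨z, rfl⟩ := d.exists_extend hD hs' hsJ' (by simp) (hA.trans_le inf_le_right) y
    exact mvClass_comp_extRes_right hA hB _ z
  · rw [c.eq_zero d _ hsJ' p y (by lia), Ext.comp_zero]

/-- The connecting map kills exactly the sums of a class restricted from the old union and one
restricted from the new open set. The first kind contributes the elements regular along r. For m > 0
the second kind vanishes, and the coboundaries for `s` come from the inductive hypothesis. For m = 0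
the old union is a single set D(insert i J), and the second kind contributes the elements regular
along i. -/
lemma CechClass.cons_comp_eq_zero_iff {s : Finset ι} {m : ℕ} (hs : s.card = m + 1)
    (c : CechClass D s m)
    {r : ι} (hr : r ∉ s) {F : AbSheaf X} {A : Type u} [AddCommGroup A] (d : CechDatum F D A)
    (J : Finset ι) (hJ : Disjoint (Finset.cons r s hr) J)
    (a : Ext (freeOpen (D (Finset.cons r s hr ∪ J))) F 0) :
    (c.consγ hD hr J).comp a (add_zero _) = 0 ↔
      d.val _ (extZeroEquiv _ _ a) ∈ d.coboundary (Finset.cons r s hr) J := by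
  have hsJ : Disjoint s J := hJ.mono_left (by simp)
  have hrJ : r ∉ J := Finset.disjoint_left.1 hJ (by simp)
  have hsJ' : Disjoint s (insert r J) := by
    rw [Finset.disjoint_insert_right]; exact ⟨hr, hsJ⟩
  have hsne : s.Nonempty := Finset.card_pos.1 (by lia)
  have hA := unionOpen_insert_right hD s J r
  have hB := unionOpen_cons (D := D) s J r hr
  have hE : s ∪ insert r J = Finset.cons r s hr ∪ J := by grind
  have hE1 : (Finset.cons r s hr ∪ J).erase r = s ∪ J := by grind
  have h1 : D (s ∪ insert r J) ≤ D (Finset.cons r s hr ∪ J) := (congrArg D hE).le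
  have h2 : D (s ∪ insert r J) ≤ D (s ∪ J) := antitone_of_union hD (by grind)
  have h3 : D (s ∪ insert r J) ≤ D (insert r J) := antitone_of_union hD (by grind)
  have hin (i : ι) (hi : i ∈ Finset.cons r s hr) :
      d.sub ((Finset.cons r s hr ∪ J).erase i) ≤ d.coboundary (Finset.cons r s hr) J :=
    le_iSup₂_of_le (f := fun i (_ : i ∈ Finset.cons r s hr) ↦
      d.sub ((Finset.cons r s hr ∪ J).erase i)) i hi le_rfl
  have hnat (b : Ext (freeOpen (D (s ∪ J))) F 0) :
      (c.γ (insert r J)).comp (extRes h2 b) (add_zero m) =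
        extRes (hA.trans_le inf_le_left) ((c.γ J).comp b (add_zero m)) := by
    rw [extRes_comp, c.naturality _ h2 (Finset.subset_insert _ _),
      Ext.comp_assoc _ _ _ (add_zero _) (add_zero _) (by lia)]
  constructor
  · intro h
    rw [c.consγ_comp hD hr J a h1] at h
    obtain ⟨u, v, huv⟩ := exists_of_mvClass_comp_eq_zero hA hB _ _ h
    obtain ⟨b, rfl⟩ := c.surjective d J hsJ u
    have hb : d.val _ (extZeroEquiv _ _ b) ∈ d.coboundary (Finset.cons r s hr) J := by
      refine hin r (by simp) ?_
      rw [hE1]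
      exact d.val_mem (hsne.mono Finset.subset_union_left) b
    rw [← hnat] at huv
    suffices d.val _ (extZeroEquiv _ _ (extRes h1 a - extRes h2 b)) ∈
        d.coboundary (Finset.cons r s hr) J by
      rw [map_sub, map_sub, d.val_extRes, d.val_extRes] at this
      have := add_mem this hb
      rwa [sub_add_cancel] at this
    rw [← sub_eq_iff_eq_add', ext_comp_sub] at huv
    obtain _ | m := m
    · obtain ⟨i, rfl⟩ := Finset.card_eq_one.1 hs
      have h0 : unionOpen D {i} (insert r J) = D ({i} ∪ insert r J) := Finset.sup_singleton
      rw [c.γ_comp_of_zero _ h0.le] at huv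
      have : extRes h1 a - extRes h2 b = extRes h3 v := by
        have := congrArg (extRes h0.ge) huv
        rwa [extRes_extRes, extRes_refl, extRes_extRes] at this
      rw [this, d.val_extRes]
      refine hin i (by simp) ?_
      rw [show (Finset.cons r {i} hr ∪ J).erase i = insert r J by grind]
      exact d.val_mem (by simp) v
    · have hv := d.acyclic _ (by simp) m v
      subst hv
      replace huv := huv.trans (Ext.comp_zero ..)
      rw [c.comp_eq_zero_iff d _ hsJ' (by simp)] at huv
      refine (iSup₂_le fun i hi ↦ ?_ : d.coboundary s (insert r J) ≤ _) huv
      rw [hE]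
      exact hin i (by simp [hi])
  · intro h
    -- The values of the classes killed by `consγ` form a subgroup, so it is enough to treat
    -- elements regular along a single i.
    have key : d.coboundary (Finset.cons r s hr) J ≤
        AddSubgroup.map ((d.val (Finset.cons r s hr ∪ J)).comp (extZeroEquiv _ F).toAddMonoidHom)
          ((c.consγ hD hr J).precomp F (add_zero (m + 1))).ker := by
      refine iSup₂_le fun i hi x hx ↦ ?_
      have hne : ((Finset.cons r s hr ∪ J).erase i).Nonempty := by
        rw [Finset.mem_cons] at hi
        rcases hi with rfl | hi
        · rw [hE1]; exact hsne.mono Finset.subset_union_left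
        · exact ⟨r, by grind⟩
      obtain ⟨z, rfl⟩ := d.exists_ext hne hx
      have h4 : D (Finset.cons r s hr ∪ J) ≤ D ((Finset.cons r s hr ∪ J).erase i) :=
        antitone_of_union hD (Finset.erase_subset _ _)
      refine ⟨extRes h4 z, ?_, d.val_extRes h4 z⟩
      change (c.consγ hD hr J).comp (extRes h4 z) (add_zero _) = 0
      rw [c.consγ_comp hD hr J _ h1, extRes_extRes]
      by_cases hir : i = r
      · subst hir
        have h5 : D (s ∪ J) ≤ D ((Finset.cons i s hr ∪ J).erase i) := (congrArg D hE1).ge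
        rw [← extRes_extRes h2 h5, hnat]
        exact mvClass_comp_extRes_left hA hB _ _
      · have his : i ∈ s := by grind
        obtain _ | m := m
        · obtain ⟨i, rfl⟩ := Finset.card_eq_one.1 hs
          obtain rfl := Finset.mem_singleton.1 his
          have h0 : unionOpen D {i} (insert r J) = D ({i} ∪ insert r J) := Finset.sup_singleton
          have h5 : D (insert r J) ≤ D ((Finset.cons r {i} hr ∪ J).erase i) :=
            antitone_of_union hD (by grind)
          rw [c.γ_comp_of_zero _ h0.le, ← extRes_extRes h3 h5, extRes_extRes]
          exact mvClass_comp_extRes_right hA hB _ _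
        · rw [(c.comp_eq_zero_iff d _ hsJ' (by simp) _).2 ?_, Ext.comp_zero]
          rw [d.val_extRes]
          refine (le_iSup₂_of_le (f := fun i (_ : i ∈ s) ↦ d.sub ((s ∪ insert r J).erase i))
            i his le_rfl :) ?_
          rwa [hE]
    obtain ⟨b, hb, hab⟩ := key h
    rw [← d.ext_injective hab]
    exact hb

/-- Adding one open set. -/
noncomputable def CechClass.cons {s : Finset ι} {m : ℕ} (hs : s.card = m + 1) (c : CechClass D s m)
    {r : ι} (hr : r ∉ s) : CechClass D (Finset.cons r s hr) (m + 1) where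
  γ := c.consγ hD hr
  naturality := c.consγ_naturality hD hr
  eq_mk₀ := fun hm ↦ by simp at hm
  eq_zero := fun d J hJ p x hp ↦ c.cons_eq_zero hD hs hr d J hJ p x hp
  surjective := fun d J hJ x ↦ by
    have hsJ : Disjoint s J := hJ.mono_left (by simp)
    have hsJ' : Disjoint s (insert r J) := by
      rw [Finset.disjoint_insert_right]; exact ⟨hr, hsJ⟩
    obtain ⟨y, rfl⟩ := exists_mvClass_comp (unionOpen_insert_right hD s J r)
      (unionOpen_cons s J r hr) (add_comm 1 m) x (c.eq_zero d J hsJ m _ (by simp))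
      (d.acyclic _ (by simp) _ _)
    obtain ⟨a, rfl⟩ := c.surjective d _ hsJ' y
    have hE : D (Finset.cons r s hr ∪ J) = D (s ∪ insert r J) := congrArg D (by grind)
    refine ⟨extRes hE.le a, ?_⟩
    rw [c.consγ_comp hD hr J _ hE.ge, extRes_extRes, extRes_refl]
  comp_eq_zero_iff := fun d J hJ _ a ↦ c.cons_comp_eq_zero_iff hD hs hr d J hJ a

/-- Each added open set raises the degree by one, through one more Mayer-Vietoris connecting map. -/
theorem CechClass.nonempty (m : ℕ) : ∀ s : Finset ι, s.card = m + 1 → Nonempty (CechClass D s m) := by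
  induction m with
  | zero =>
    intro s hs
    obtain ⟨i, rfl⟩ := Finset.card_eq_one.1 hs
    exact ⟨.singleton i⟩
  | succ m ih =>
    intro s hs
    obtain ⟨r, hr⟩ : s.Nonempty := Finset.card_pos.1 (by lia)
    have hcard : (s.erase r).card = m + 1 := by rw [Finset.card_erase_of_mem hr]; lia
    obtain ⟨c⟩ := ih _ hcard
    have := c.cons hD hcard (Finset.notMem_erase r s)
    rw [Finset.cons_eq_insert, Finset.insert_erase hr] at this
    exact ⟨this⟩

end Cech

/-! ### The two-cover condition for the structure sheaf. -/

section RingCover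

variable {X : Scheme.{u}}

/-- Restriction of functions. -/
abbrev rres {U V : X.Opens} (h : V ≤ U) : Γ(X, U) →+* Γ(X, V) := (X.presheaf.map (homOfLE h).op).hom

lemma rres_rres {U V W : X.Opens} (h : V ≤ U) (h' : W ≤ V) (s : Γ(X, U)) :
    rres h' (rres h s) = rres (h'.trans h) s :=
  (ring_map_map_apply (homOfLE h).op (homOfLE h').op s).symm

lemma rres_self {U : X.Opens} (h : U ≤ U) (s : Γ(X, U)) : rres h s = s :=
  congrArg (fun f ↦ f.hom s) (X.presheaf.map_id (op U))

/-- Functions on the intersection of two basic open sets that cover an affine open set are sums of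
functions on the two sets. -/
lemma exists_add_of_span_eq_top {U : X.Opens} (hU : IsAffineOpen U) (f g : Γ(X, U))
    (hfg : Ideal.span {f, g} = ⊤) (s : Γ(X, X.basicOpen f ⊓ X.basicOpen g)) :
    ∃ (a : Γ(X, X.basicOpen f)) (b : Γ(X, X.basicOpen g)),
      s = rres inf_le_left a + rres inf_le_right b := by
  have hD := X.basicOpen_mul f g
  have hle : X.basicOpen f ⊓ X.basicOpen g ≤ U := inf_le_left.trans (X.basicOpen_le f)
  -- A section over D(fg) extends to `U` after multiplication by a power (fg)^N.
  obtain ⟨N, r, hr⟩ := exists_eq_pow_mul_of_isAffineOpen X U hU (f * g) (rres hD.le s)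
  replace hr : rres hle r = (rres hle f * rres hle g) ^ N * s := by
    have := congrArg (rres hD.ge) hr
    rw [map_mul, map_pow, rres_rres, rres_self] at this
    rw [← map_mul, ← rres_rres (X.basicOpen_le (f * g)) hD.ge,
      ← rres_rres (X.basicOpen_le (f * g)) hD.ge (f * g)]
    exact this
  have hfg' : IsCoprime f g := by
    obtain ⟨a, b, h⟩ := Ideal.mem_span_pair.1 (hfg ▸ Submodule.mem_top : (1 : Γ(X, U)) ∈ _)
    exact ⟨a, b, h⟩
  obtain ⟨a, b, hab⟩ := hfg'.pow (m := N) (n := N)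
  have hunit (f : Γ(X, U)) : ∃ u, rres (X.basicOpen_le f) f * u = 1 :=
    IsUnit.exists_right_inv (RingedSpace.isUnit_res_basicOpen X.toRingedSpace f)
  obtain ⟨u, hu⟩ := hunit f
  obtain ⟨v, hv⟩ := hunit g
  -- With a f^N + b g^N = 1 one has r/(fg)^N = rb/f^N + ra/g^N.
  refine ⟨rres (X.basicOpen_le f) (r * b) * u ^ N, rres (X.basicOpen_le g) (r * a) * v ^ N, ?_⟩
  have hu' := congrArg (rres (inf_le_left : X.basicOpen f ⊓ X.basicOpen g ≤ _)) hu
  have hv' := congrArg (rres (inf_le_right : X.basicOpen f ⊓ X.basicOpen g ≤ _)) hv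
  have hab' := congrArg (rres hle) hab
  simp only [map_mul, map_add, map_pow, rres_rres, map_one] at hu' hv' hab' ⊢
  rw [hr]
  generalize rres hle f = f at *
  generalize rres hle g = g at *
  generalize rres inf_le_left u = u at *
  generalize rres inf_le_right v = v at *
  have hu2 : f ^ N * u ^ N = 1 := by rw [← mul_pow, hu', one_pow]
  have hv2 : g ^ N * v ^ N = 1 := by rw [← mul_pow, hv', one_pow]
  generalize rres hle a = a at *
  generalize rres hle b = b at *
  rw [mul_pow]
  linear_combination (-s * hab') - s * b * g ^ N * hu2 - s * a * f ^ N * hv2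

end RingCover

/-! ### Trivialization of 𝒪(d) where a homogeneous element does not vanish. -/

section TwistSections

variable {A σ : Type u} [CommRing A] [SetLike σ A] [AddSubgroupClass σ A]
  {𝒜 : ℕ → σ} [GradedRing 𝒜]

/-- Sections of `𝒪(0)` are regular functions. -/
lemma exists_structureSheaf {U : Opens (ProjectiveSpectrum 𝒜)} {f : ∀ x : U, LocAt 𝒜 x.1}
    (hf : IsTwistSection 𝒜 0 f) :
    ∃ r : (ProjectiveSpectrum.Proj.structureSheaf 𝒜).obj.obj (op U), ∀ x, (r.1 x).val = f x := by
  have h (x : U) : ∃ z : HomogeneousLocalization.AtPrime 𝒜 x.1.asHomogeneousIdeal.toIdeal,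
      z.val = f x := by
    obtain ⟨V, hxV, hVU, i, j, a, b, ha, hb, hij, h⟩ := hf x
    obtain rfl : i = j := by simpa using hij
    obtain ⟨hb', h⟩ := h ⟨x.1, hxV⟩
    exact ⟨.mk ⟨i, ⟨a, ha⟩, ⟨b, hb⟩, hb'⟩, (HomogeneousLocalization.val_mk _).trans h.symm⟩
  choose z hz using h
  refine ⟨⟨z, fun x ↦ ?_⟩, hz⟩
  obtain ⟨V, hxV, hVU, i, j, a, b, ha, hb, hij, h⟩ := hf x
  obtain rfl : i = j := by simpa using hij
  refine ⟨V, hxV, homOfLE hVU, i, ⟨a, ha⟩, ⟨b, hb⟩, fun y ↦ (h y).1, fun y ↦ ?_⟩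
  refine HomogeneousLocalization.val_injective _ ?_
  refine (hz _).trans ((h y).2.trans ?_)
  symm
  apply HomogeneousLocalization.val_mk

lemma mem_primeCompl_of_mem_basicOpen {ℓ : A} {x : ProjectiveSpectrum 𝒜}
    (h : x ∈ ProjectiveSpectrum.basicOpen 𝒜 ℓ) : ℓ ∈ x.asHomogeneousIdeal.toIdeal.primeCompl := h

/-- The image of an element not vanishing at `x`, as a unit. -/
noncomputable def locUnit (ℓ : A) (x : ProjectiveSpectrum 𝒜)
    (h : x ∈ ProjectiveSpectrum.basicOpen 𝒜 ℓ) : (LocAt 𝒜 x)ˣ :=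
  (IsLocalization.map_units (LocAt 𝒜 x) ⟨ℓ, mem_primeCompl_of_mem_basicOpen h⟩).unit

@[simp]
lemma locUnit_val (ℓ : A) (x : ProjectiveSpectrum 𝒜)
    (h : x ∈ ProjectiveSpectrum.basicOpen 𝒜 ℓ) :
    (locUnit ℓ x h : LocAt 𝒜 x) = algebraMap A _ ℓ := rfl

lemma isTwistSection_locUnit_zpow {m : ℕ} {ℓ : A} (hℓ : ℓ ∈ 𝒜 m)
    {U : Opens (ProjectiveSpectrum 𝒜)}
    (hU : U ≤ ProjectiveSpectrum.basicOpen 𝒜 ℓ) (a : ℤ) :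
    IsTwistSection 𝒜 (a * m)
      (fun x : U ↦ ((locUnit ℓ x.1 (hU x.2) ^ a : (LocAt 𝒜 x.1)ˣ) : LocAt 𝒜 x.1)) := by
  intro x
  obtain ⟨k, rfl | rfl⟩ := a.eq_nat_or_neg
  · refine ⟨U, x.2, le_rfl, k * m, 0, ℓ ^ k, 1, by simpa using SetLike.pow_mem_graded k hℓ,
      SetLike.GradedOne.one_mem, by simp, fun y ↦ ⟨one_mem _, ?_⟩⟩
    change ((locUnit ℓ y.1 (hU y.2) ^ (k : ℤ) : (LocAt 𝒜 y.1)ˣ) : LocAt 𝒜 y.1) = _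
    rw [zpow_natCast, Units.val_pow_eq_pow_val, locUnit_val, ← map_pow]
    exact (Localization.mk_one_eq_algebraMap _).symm
  · refine ⟨U, x.2, le_rfl, 0, k * m, 1, ℓ ^ k, SetLike.GradedOne.one_mem,
      by simpa using SetLike.pow_mem_graded k hℓ, by simp, fun y ↦ ⟨pow_mem (mem_primeCompl_of_mem_basicOpen (hU y.2)) k, ?_⟩⟩
    change ((locUnit ℓ y.1 (hU y.2) ^ (-k : ℤ) : (LocAt 𝒜 y.1)ˣ) : LocAt 𝒜 y.1) = _
    rw [zpow_neg, zpow_natCast]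
    refine Units.inv_eq_of_mul_eq_one_right ?_
    rw [Units.val_pow_eq_pow_val, locUnit_val, ← map_pow, ← Localization.mk_one_eq_algebraMap,
      Localization.mk_mul, mul_one, one_mul]
    exact Localization.mk_self (⟨ℓ ^ k, pow_mem (mem_primeCompl_of_mem_basicOpen (hU y.2)) k⟩ : y.1.asHomogeneousIdeal.toIdeal.primeCompl)

variable (𝒜) in
/-- The section `ℓ ^ a` of `𝒪(a * deg ℓ)` over an open set on which `ℓ` does not vanish. -/
noncomputable def twistGen {m : ℕ} {ℓ : A} (hℓ : ℓ ∈ 𝒜 m) (a : ℤ)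
    {U : Opens (ProjectiveSpectrum 𝒜)}
    (hU : U ≤ ProjectiveSpectrum.basicOpen 𝒜 ℓ) {d : ℤ} (hd : d = a * m) :
    twistSections 𝒜 d U :=
  ⟨fun x : U ↦ ((locUnit ℓ x.1 (hU x.2) ^ a : (LocAt 𝒜 x.1)ˣ) : LocAt 𝒜 x.1),
    hd ▸ isTwistSection_locUnit_zpow hℓ hU a⟩

variable (𝒜) in
/-- The map `r ↦ r ℓ ^ a` from functions to sections of `𝒪(a * deg ℓ)`. -/
noncomputable def smulTwistGen {m : ℕ} {ℓ : A} (hℓ : ℓ ∈ 𝒜 m) (a : ℤ)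
    {U : Opens (ProjectiveSpectrum 𝒜)} (hU : U ≤ ProjectiveSpectrum.basicOpen 𝒜 ℓ) {d : ℤ}
    (hd : d = a * m) : Γ(Proj 𝒜, U) →+ twistSections 𝒜 d U where
  toFun r := r • twistGen 𝒜 hℓ a hU hd
  map_zero' := zero_smul _ _
  map_add' _ _ := add_smul _ _ _

/-- Multiplication by ℓ^(-a) is the inverse: it brings the section into degree 0, where sections are
regular functions. -/
lemma smulTwistGen_bijective {m : ℕ} {ℓ : A} (hℓ : ℓ ∈ 𝒜 m) (a : ℤ)
    {U : Opens (ProjectiveSpectrum 𝒜)} (hU : U ≤ ProjectiveSpectrum.basicOpen 𝒜 ℓ) {d : ℤ}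
    (hd : d = a * m) : Function.Bijective (smulTwistGen 𝒜 hℓ a hU hd) := by
  subst hd
  refine ⟨fun r r' h ↦ Subtype.ext <| funext fun x ↦ ?_, fun f ↦ ?_⟩
  · refine HomogeneousLocalization.val_injective _ ?_
    have := congrFun (congrArg Subtype.val h) x
    exact (Units.mul_left_inj _).1 this
  · have h := f.2.mul (isTwistSection_locUnit_zpow hℓ hU (-a))
    rw [neg_mul, add_neg_cancel] at h
    obtain ⟨r, hr⟩ := exists_structureSheaf h
    refine ⟨r, Subtype.ext <| funext fun x ↦ ?_⟩
    refine (congrArg (· * _) (hr x)).trans ((mul_assoc _ _ _).trans ?_)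
    have : ((locUnit ℓ x.1 (hU x.2) ^ (-a) : (LocAt 𝒜 x.1)ˣ) : LocAt 𝒜 x.1) *
      (locUnit ℓ x.1 (hU x.2) ^ a : (LocAt 𝒜 x.1)ˣ) = 1 := by
      rw [← Units.val_mul, ← zpow_add, neg_add_cancel, zpow_zero, Units.val_one]
    exact (congrArg (f.1 x * ·) this).trans (mul_one _)

/-- The sheaf of abelian groups underlying `𝒪(d)`. -/
noncomputable abbrev twistAb (𝒜 : ℕ → σ) [GradedRing 𝒜] (d : ℤ) : AbSheaf (Proj 𝒜).toTopCat :=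
  (SheafOfModules.toSheaf _).obj (twistingSheaf 𝒜 d)

/-- Dividing by ℓ^a reduces the claim to the structure sheaf. -/
lemma hasTwoCoverLift_twistAb {m : ℕ} {ℓ : A} (hℓ : ℓ ∈ 𝒜 m) (a : ℤ) {U : (Proj 𝒜).Opens}
    (hU' : IsAffineOpen U)
    (hU : U ≤ ProjectiveSpectrum.basicOpen 𝒜 ℓ) {d : ℤ} (hd : d = a * m) :
    HasTwoCoverLift (twistAb 𝒜 d) U := by
  intro f g hfg (s : twistSections 𝒜 d _)
  have h1 := ((Proj 𝒜).basicOpen_le f).trans hU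
  have h2 := ((Proj 𝒜).basicOpen_le g).trans hU
  obtain ⟨r, rfl⟩ := (smulTwistGen_bijective hℓ a (inf_le_left.trans h1) hd).2 s
  obtain ⟨u, v, rfl⟩ := exists_add_of_span_eq_top hU' f g hfg r
  exact ⟨smulTwistGen 𝒜 hℓ a h1 hd u, smulTwistGen 𝒜 hℓ a h2 hd v,
    map_add (smulTwistGen 𝒜 hℓ a (inf_le_left.trans h1) hd) _ _⟩

/-- Affine vanishing for the class of affine open sets contained in D(ℓ), on which ℓ^d trivializes
𝒪(d). -/
lemma ext_twistAb_eq_zero {ℓ : A} (hℓ : ℓ ∈ 𝒜 1) (d : ℤ) {U : (Proj 𝒜).Opens}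
    (hU' : IsAffineOpen U) (hU : U ≤ Proj.basicOpen 𝒜 ℓ) (p : ℕ)
    (x : Abelian.Ext (freeOpen (X := (Proj 𝒜).toTopCat) U) (twistAb 𝒜 d) (p + 1)) : x = 0 :=
  ext_freeOpen_eq_zero
    (P := fun U ↦ IsAffineOpen U ∧ U ≤ Proj.basicOpen 𝒜 ℓ)
    (fun U h ↦ h.1) (fun U f h ↦ ⟨h.1.basicOpen f, ((Proj 𝒜).basicOpen_le f).trans h.2⟩)
    p _ (fun U h ↦ hasTwoCoverLift_twistAb hℓ d h.1 h.2 (by simp)) ⟨hU', hU⟩ x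

end TwistSections

/-! ### Regular functions on a basic open set of Proj. -/

section ProjAway

variable {A σ : Type u} [CommRing A] [SetLike σ A] [AddSubgroupClass σ A]
  {𝒜 : ℕ → σ} [GradedRing 𝒜]

/-- The functions on D(f) are the degree zero part of A_f, that is, the fractions a / f^N. -/
lemma exists_mul_pow_eq {m : ℕ} {f : A} (hf : f ∈ 𝒜 m) (hm : 0 < m)
    (r : (ProjectiveSpectrum.Proj.structureSheaf 𝒜).obj.obj
      (op (ProjectiveSpectrum.basicOpen 𝒜 f))) :
    ∃ (N : ℕ) (a : A), a ∈ 𝒜 (N * m) ∧ ∀ x, (r.1 x).val * algebraMap A _ (f ^ N) =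
      algebraMap A (LocAt 𝒜 x.1) a := by
  obtain ⟨z, rfl⟩ : ∃ z, (Proj.awayToSection 𝒜 f).hom z = r := by
    have := ((Proj.basicOpenIsoAway 𝒜 f hf hm).commRingCatIsoToRingEquiv).surjective r
    exact this
  obtain ⟨N, a, ha, rfl⟩ := HomogeneousLocalization.Away.mk_surjective 𝒜 hf z
  refine ⟨N, a, by simpa using ha, fun x ↦ ?_⟩
  have := ProjectiveSpectrum.Proj.awayToSection_apply (𝒜 := 𝒜) f
    (HomogeneousLocalization.Away.mk 𝒜 hf N a ha) x
  refine (congrArg (· * _) this).trans ?_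
  rw [HomogeneousLocalization.Away.val_mk, Localization.mk_eq_mk', IsLocalization.map_mk']
  exact IsLocalization.mk'_spec _ _ _

end ProjAway

/-! ### Sections of 𝒪(d) over coordinate open sets as Laurent polynomials. -/

section Monomials

attribute [local instance] MvPolynomial.gradedAlgebra

variable (K : Type u) [Field K] (n : ℕ)

/-- The grading of the polynomial ring by degree. -/
abbrev polyGrading : ℕ → Submodule K (MvPolynomial (Fin (n + 1)) K) :=
  MvPolynomial.homogeneousSubmodule (Fin (n + 1)) K

/-- The generic point of projective space. -/
noncomputable def genericPt : ProjectiveSpectrum (polyGrading K n) where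
  asHomogeneousIdeal := ⊥
  isPrime := by
    rw [HomogeneousIdeal.toIdeal_bot]
    exact Ideal.isPrime_bot
  not_irrelevant_le h := by
    have h1 : (MvPolynomial.X 0 : MvPolynomial (Fin (n + 1)) K) ∈
        HomogeneousIdeal.irrelevant (polyGrading K n) := by
      rw [HomogeneousIdeal.mem_irrelevant_iff, GradedRing.proj_apply,
        DirectSum.decompose_of_mem_ne _ (MvPolynomial.isHomogeneous_X K 0 : _ ∈ polyGrading K n 1)
          one_ne_zero]
    have h2 : (MvPolynomial.X 0 : MvPolynomial (Fin (n + 1)) K) ∈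
      (⊥ : HomogeneousIdeal (polyGrading K n)).toIdeal := h h1
    rw [HomogeneousIdeal.toIdeal_bot] at h2
    exact MvPolynomial.X_ne_zero _ h2

/-- The field of rational functions, as the ungraded localization at the generic point. -/
abbrev RatFunc : Type u := LocAt (polyGrading K n) (genericPt K n)

variable {K n}

lemma mem_basicOpen_genericPt {f : MvPolynomial (Fin (n + 1)) K} (hf : f ≠ 0) :
    genericPt K n ∈ ProjectiveSpectrum.basicOpen (polyGrading K n) f := by
  intro h
  refine hf ?_
  have h2 : f ∈ (⊥ : HomogeneousIdeal (polyGrading K n)).toIdeal := h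
  rwa [HomogeneousIdeal.toIdeal_bot] at h2

lemma algebraMap_ratFunc_injective :
    Function.Injective (algebraMap (MvPolynomial (Fin (n + 1)) K) (RatFunc K n)) := by
  refine IsLocalization.injective (RatFunc K n)
    (M := (genericPt K n).asHomogeneousIdeal.toIdeal.primeCompl) fun f hf ↦ ?_
  refine mem_nonZeroDivisors_of_ne_zero ?_
  rintro rfl
  exact hf (zero_mem _)

/-- The variable `xᵢ`, as a nonzero rational function. -/
noncomputable def varUnit (i : Fin (n + 1)) : (RatFunc K n)ˣ :=
  locUnit (MvPolynomial.X i) _ (mem_basicOpen_genericPt (MvPolynomial.X_ne_zero i))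

variable (K) in
/-- The Laurent monomial `x ^ e`, as a rational function. -/
noncomputable def laurentMonomial (e : Fin (n + 1) → ℤ) : (RatFunc K n)ˣ :=
  ∏ i, varUnit i ^ e i
lemma laurentMonomial_add (e f : Fin (n + 1) → ℤ) :
    laurentMonomial K (e + f) = laurentMonomial K e * laurentMonomial K f := by
  simp [laurentMonomial, zpow_add, Finset.prod_mul_distrib]

lemma laurentMonomial_single (i : Fin (n + 1)) (a : ℤ) :
    laurentMonomial K (Pi.single i a) = varUnit i ^ a := by
  rw [laurentMonomial, Finset.prod_eq_single i (fun j _ h ↦ by simp [h]) (by simp)]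
  simp

lemma laurentMonomial_natCast (f : Fin (n + 1) →₀ ℕ) :
    ((laurentMonomial K (fun i ↦ (f i : ℤ)) : (RatFunc K n)ˣ) : RatFunc K n) =
      algebraMap _ _ (MvPolynomial.monomial f (1 : K)) := by
  rw [MvPolynomial.monomial_eq, laurentMonomial, Finsupp.prod_fintype _ _ (by simp), map_mul,
    map_one, map_one, one_mul, map_prod, Units.coe_prod]
  simp [varUnit]

variable (K n) in
/-- Laurent polynomials as rational functions. -/
noncomputable def laurentMap : ((Fin (n + 1) → ℤ) →₀ K) →ₗ[K] RatFunc K n :=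
  Finsupp.linearCombination K fun e ↦ (laurentMonomial K e : RatFunc K n)

lemma laurentMap_single (e : Fin (n + 1) → ℤ) (c : K) :
    laurentMap K n (Finsupp.single e c) = c • (laurentMonomial K e : RatFunc K n) := by
  simp [laurentMap]

lemma algebraMap_monomial (f : Fin (n + 1) →₀ ℕ) (c : K) :
    algebraMap _ (RatFunc K n) (MvPolynomial.monomial f c) =
      c • (laurentMonomial K (fun i ↦ (f i : ℤ)) : RatFunc K n) := by
  rw [laurentMonomial_natCast]
  refine Eq.trans ?_ (map_smul (IsScalarTower.toAlgHom K (MvPolynomial (Fin (n + 1)) K)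
    (RatFunc K n)) c (MvPolynomial.monomial f 1))
  rw [MvPolynomial.smul_monomial, smul_eq_mul, mul_one]
  rfl

/-- Multiplying by a high power of x_0 ⋯ x_n clears all denominators and sends distinct Laurent
monomials to distinct monomials of the polynomial ring. -/
lemma laurentMap_injective : Function.Injective (laurentMap K n) := by
  rw [injective_iff_map_eq_zero]
  intro p hp
  obtain ⟨N, hN⟩ : ∃ N : ℕ, ∀ e ∈ p.support, ∀ i, 0 ≤ e i + N := by
    refine ⟨p.support.sup fun e ↦ Finset.univ.sup fun i ↦ (e i).natAbs, fun e he i ↦ ?_⟩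
    have h1 := Finset.le_sup (f := fun e : Fin (n + 1) → ℤ ↦
      Finset.univ.sup fun i ↦ (e i).natAbs) he
    have h2 := Finset.le_sup (f := fun i ↦ (e i).natAbs) (Finset.mem_univ i)
    have := h2.trans h1
    lia
  let sh (e : Fin (n + 1) → ℤ) : Fin (n + 1) →₀ ℕ := Finsupp.equivFunOnFinite.symm
    fun i ↦ (e i + N).toNat
  have hsh (e) (he : e ∈ p.support) : (fun i ↦ ((sh e i : ℕ) : ℤ)) = e + fun _ ↦ (N : ℤ) := by
    ext i
    exact Int.toNat_of_nonneg (hN e he i)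
  have h0 : ∑ e ∈ p.support, MvPolynomial.monomial (sh e) (p e) = 0 := by
    apply algebraMap_ratFunc_injective
    rw [map_zero, map_sum, ← mul_zero (laurentMonomial K (fun _ : Fin (n + 1) ↦ (N : ℤ)) : RatFunc K n), ← hp,
      laurentMap, Finsupp.linearCombination_apply, Finsupp.sum, Finset.mul_sum]
    refine Finset.sum_congr rfl fun e he ↦ ?_
    rw [algebraMap_monomial, hsh e he, laurentMonomial_add, mul_smul_comm, Units.val_mul, mul_comm]
  ext e
  by_contra he
  have he' : e ∈ p.support := by simpa using he
  have := congrArg (MvPolynomial.coeff (sh e)) h0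
  rw [MvPolynomial.coeff_sum, Finset.sum_eq_single e, MvPolynomial.coeff_monomial, if_pos rfl,
    MvPolynomial.coeff_zero] at this
  · exact he this
  · intro f hf hfe
    rw [MvPolynomial.coeff_monomial, if_neg]
    intro h
    refine hfe ?_
    have h1 := hsh f hf
    rw [h, hsh e he'] at h1
    exact (add_right_cancel h1).symm
  · exact fun h ↦ (h he').elim

/-- The exponents of the monomials of degree `d` that are regular where `xᵢ ≠ 0`, `i ∈ I`. -/
def regExps (d : ℤ) (I : Finset (Fin (n + 1))) : Set (Fin (n + 1) → ℤ) :=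
  {e | ∑ i, e i = d ∧ ∀ i ∉ I, 0 ≤ e i}

variable (K) in
/-- The Laurent polynomials of degree `d` that are regular where `xᵢ ≠ 0`, `i ∈ I`. -/
noncomputable def laurentSub (d : ℤ) (I : Finset (Fin (n + 1))) : Submodule K (RatFunc K n) :=
  (Finsupp.supported K K (regExps d I)).map (laurentMap K n)

lemma laurentMap_mem_iff {d : ℤ} {I : Finset (Fin (n + 1))} {p : (Fin (n + 1) → ℤ) →₀ K} :
    laurentMap K n p ∈ laurentSub K d I ↔ ∀ e ∈ p.support, e ∈ regExps d I := by
  rw [laurentSub, Submodule.map, Submodule.mem_mk]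
  constructor
  · rintro ⟨q, hq, h⟩
    rw [laurentMap_injective h] at hq
    exact hq
  · exact fun h ↦ ⟨p, h, rfl⟩

lemma exists_of_mem_laurentSub {d : ℤ} {I : Finset (Fin (n + 1))} {a : RatFunc K n}
    (ha : a ∈ laurentSub K d I) : ∃ p, laurentMap K n p = a ∧ ∀ e ∈ p.support, e ∈ regExps d I := by
  obtain ⟨p, hp, rfl⟩ := ha
  exact ⟨p, rfl, hp⟩

lemma laurentMonomial_mem {d : ℤ} {I : Finset (Fin (n + 1))} {e : Fin (n + 1) → ℤ}
    (he : e ∈ regExps d I) (c : K) : c • (laurentMonomial K e : RatFunc K n) ∈ laurentSub K d I := by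
  rw [← laurentMap_single, laurentMap_mem_iff]
  intro f hf
  rwa [Finset.mem_singleton.1 (Finsupp.support_single_subset hf)]

lemma laurentSub_induction {d : ℤ} {I : Finset (Fin (n + 1))} {P : AddSubgroup (RatFunc K n)}
    (h : ∀ e ∈ regExps d I, ∀ c : K, c • (laurentMonomial K e : RatFunc K n) ∈ P)
    {a : RatFunc K n} (ha : a ∈ laurentSub K d I) : a ∈ P := by
  obtain ⟨p, rfl, hp⟩ := exists_of_mem_laurentSub ha
  rw [laurentMap, Finsupp.linearCombination_apply]
  exact sum_mem fun e he ↦ h e (hp e he) _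

lemma laurentMonomial_mul_mem {d d' : ℤ} {I : Finset (Fin (n + 1))} {f : Fin (n + 1) → ℤ}
    (hd : d' = d + ∑ i, f i) (hf : ∀ i ∉ I, f i = 0) {a : RatFunc K n}
    (ha : a ∈ laurentSub K d I) : a * laurentMonomial K f ∈ laurentSub K d' I := by
  refine laurentSub_induction (P := (laurentSub K d' I).toAddSubgroup.comap
    (AddMonoidHom.mulRight (laurentMonomial K f : RatFunc K n))) (fun e he c ↦ ?_) ha
  change c • (laurentMonomial K e : RatFunc K n) * _ ∈ laurentSub K d' I
  rw [smul_mul_assoc, ← Units.val_mul, ← laurentMonomial_add]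
  refine laurentMonomial_mem ⟨?_, fun i hi ↦ ?_⟩ c
  · simp [Finset.sum_add_distrib, he.1, hd]
  · rw [Pi.add_apply, hf i hi, add_zero]
    exact he.2 i hi

/-- Homogeneous polynomials of degree `d`, as Laurent polynomials. -/
lemma algebraMap_mem_laurentSub {d : ℕ} {f : MvPolynomial (Fin (n + 1)) K}
    (hf : f ∈ polyGrading K n d) (I : Finset (Fin (n + 1))) :
    algebraMap _ (RatFunc K n) f ∈ laurentSub K d I := by
  rw [f.as_sum, map_sum]
  refine sum_mem fun v hv ↦ ?_
  rw [algebraMap_monomial]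
  refine laurentMonomial_mem ⟨?_, fun i _ ↦ by simp⟩ _
  have := hf (MvPolynomial.mem_support_iff.1 hv)
  rw [← this, Finsupp.weight_apply, Finsupp.sum_fintype _ _ (by simp)]
  simp

lemma sum_toNat (e : Fin (n + 1) → ℤ) : (∑ i, ((e i).toNat : ℤ)) = ∑ i, e i + ∑ i, ((-e i).toNat : ℤ) := by
  rw [← Finset.sum_add_distrib]
  exact Finset.sum_congr rfl fun i _ ↦ by lia

section Sections

variable (K n) in
/-- The open set where the `xᵢ`, `i ∈ I`, do not vanish. -/
noncomputable def varOpen (I : Finset (Fin (n + 1))) : Opens (projSpace K n).toTopCat :=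
  Proj.basicOpen (polyGrading K n) (∏ i ∈ I, MvPolynomial.X i)

lemma mem_varOpen {I : Finset (Fin (n + 1))} {x : ProjectiveSpectrum (polyGrading K n)} :
    x ∈ varOpen K n I ↔ ∀ i ∈ I, MvPolynomial.X i ∉ x.asHomogeneousIdeal := by
  change (∏ i ∈ I, MvPolynomial.X i) ∉ x.asHomogeneousIdeal.toIdeal ↔ _
  rw [x.isPrime.prod_mem_iff]
  push Not
  rfl

lemma varOpen_union (I J : Finset (Fin (n + 1))) :
    varOpen K n (I ∪ J) = varOpen K n I ⊓ varOpen K n J := by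
  ext x
  have (U V : Opens (projSpace K n).toTopCat) : x ∈ U ⊓ V ↔ x ∈ U ∧ x ∈ V := Iff.rfl
  rw [SetLike.mem_coe, SetLike.mem_coe, this]
  refine mem_varOpen.trans (Iff.trans ?_ (and_congr mem_varOpen mem_varOpen).symm)
  simp only [Finset.mem_union, or_imp, forall_and]

lemma prod_X_mem (I : Finset (Fin (n + 1))) :
    (∏ i ∈ I, MvPolynomial.X i) ∈ polyGrading K n I.card := by
  have := MvPolynomial.IsHomogeneous.prod I (fun i ↦ (MvPolynomial.X i : MvPolynomial _ K))
    (fun _ ↦ 1) fun i _ ↦ MvPolynomial.isHomogeneous_X K i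
  simpa using this

lemma isAffineOpen_varOpen {I : Finset (Fin (n + 1))} (hI : I.Nonempty) :
    IsAffineOpen (X := projSpace K n) (varOpen K n I) :=
  Proj.isAffineOpen_basicOpen _ _ (prod_X_mem I) (Finset.card_pos.2 hI)

lemma genericPt_mem_of_nonempty {U : Opens (ProjectiveSpectrum (polyGrading K n))}
    {x : ProjectiveSpectrum (polyGrading K n)} (hx : x ∈ U) : genericPt K n ∈ U := by
  obtain ⟨_, ⟨g, rfl⟩, hxg, hgU⟩ :=
    (ProjectiveSpectrum.isTopologicalBasis_basic_opens (polyGrading K n)).exists_subset_of_mem_open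
      hx U.isOpen
  refine hgU (mem_basicOpen_genericPt ?_)
  rintro rfl
  exact hxg (zero_mem _)

lemma genericPt_mem_varOpen (I : Finset (Fin (n + 1))) : genericPt K n ∈ varOpen K n I :=
  mem_basicOpen_genericPt (Finset.prod_ne_zero_iff.2 fun i _ ↦ MvPolynomial.X_ne_zero i)

variable (K) in
/-- The value of a section of `𝒪(d)` at the generic point. -/
noncomputable def genericVal (d : ℤ) {U : Opens (ProjectiveSpectrum (polyGrading K n))}
    (hU : genericPt K n ∈ U) : twistSections (polyGrading K n) d U →+ RatFunc K n where
  toFun s := s.1 ⟨_, hU⟩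
  map_zero' := rfl
  map_add' _ _ := rfl

/-- Locally a section is a/b. If this vanishes at the generic point then a = 0, because the
polynomial ring is a domain. -/
lemma genericVal_injective (d : ℤ) {U : Opens (ProjectiveSpectrum (polyGrading K n))}
    (hU : genericPt K n ∈ U) : Function.Injective (genericVal K d hU) := by
  rw [injective_iff_map_eq_zero]
  intro s hs
  refine Subtype.ext <| funext fun x ↦ ?_
  obtain ⟨V, hxV, hVU, i, j, a, b, ha, hb, hij, h⟩ := s.2 x
  obtain ⟨hb1, h1⟩ := h ⟨_, genericPt_mem_of_nonempty hxV⟩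
  obtain ⟨hb2, h2⟩ := h ⟨_, hxV⟩
  refine h2.trans ?_
  suffices a = 0 by
    subst this
    exact Localization.mk_zero _
  apply algebraMap_ratFunc_injective
  rw [map_zero]
  have h3 : (0 : RatFunc K n) = Localization.mk a ⟨b, hb1⟩ := hs.symm.trans h1
  rw [Localization.mk_eq_mk', eq_comm, IsLocalization.mk'_eq_iff_eq_mul, zero_mul] at h3
  exact h3

/-- For j ∈ I the section is x_j^d times a function a / (∏_{i ∈ I} x_i)^N with `a` a homogeneous
polynomial, so poles occur only along variables indexed by I. -/
lemma range_genericVal_le (d : ℤ) {I : Finset (Fin (n + 1))} (hI : I.Nonempty) :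
    (genericVal K d (genericPt_mem_varOpen I)).range ≤ (laurentSub K d I).toAddSubgroup := by
  rintro _ ⟨s, rfl⟩
  obtain ⟨j, hj⟩ := hI
  have hX := MvPolynomial.isHomogeneous_X K j
  have hle : varOpen K n I ≤ ProjectiveSpectrum.basicOpen (polyGrading K n) (MvPolynomial.X j) :=
    fun x hx ↦ mem_varOpen.1 hx j hj
  obtain ⟨r, rfl⟩ := (smulTwistGen_bijective hX d hle (by simp : d = d * (1 : ℕ))).2 s
  obtain ⟨N, a, ha, h⟩ := exists_mul_pow_eq (prod_X_mem I) (Finset.card_pos.2 ⟨j, hj⟩) r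
  have h1 := h ⟨_, genericPt_mem_varOpen I⟩
  have h2 : algebraMap _ (RatFunc K n) ((∏ i ∈ I, MvPolynomial.X i) ^ N : MvPolynomial _ K) =
      laurentMonomial K (fun i ↦ if i ∈ I then N else 0) := by
    rw [laurentMonomial, map_pow, map_prod, Units.coe_prod, ← Finset.prod_pow,
      ← Finset.prod_subset (Finset.subset_univ I) (fun i _ hi ↦ by simp [hi])]
    exact Finset.prod_congr rfl fun i hi ↦ by simp [hi, varUnit]
  change _ * ((varUnit j ^ d : (RatFunc K n)ˣ) : RatFunc K n) ∈ laurentSub K d I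
  rw [← laurentMonomial_single]
  refine laurentMonomial_mul_mem (d := 0) (by simp) (fun i hi ↦ ?_) ?_
  · rw [Pi.single_apply, if_neg]
    rintro rfl
    exact hi hj
  · have h3 := laurentMonomial_mul_mem (d := (N * I.card : ℕ)) (d' := 0) (I := I)
      (f := - fun i ↦ if i ∈ I then (N : ℤ) else 0)
      (by simp [mul_comm]) (fun i hi ↦ by simp [hi]) (algebraMap_mem_laurentSub ha I)
    rw [← h1, h2, mul_assoc, ← Units.val_mul, ← laurentMonomial_add, add_neg_cancel] at h3
    have h4 : laurentMonomial K (0 : Fin (n + 1) → ℤ) = 1 := by simp [laurentMonomial]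
    rw [h4, Units.val_one, mul_one] at h3
    exact h3

/-- Split the exponent into positive and negative parts: the denominator of x^e involves only
variables indexed by I, so it is invertible on the open set. -/
lemma laurentSub_le_range (d : ℤ) (I : Finset (Fin (n + 1))) :
    (laurentSub K d I).toAddSubgroup ≤ (genericVal K d (genericPt_mem_varOpen I)).range := by
  intro a ha
  refine laurentSub_induction (fun e he c ↦ ?_) ha
  let v : Fin (n + 1) →₀ ℕ := Finsupp.equivFunOnFinite.symm fun i ↦ (e i).toNat
  let w : Fin (n + 1) →₀ ℕ := Finsupp.equivFunOnFinite.symm fun i ↦ (-e i).toNat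
  have hw (x : ProjectiveSpectrum (polyGrading K n)) (hx : x ∈ varOpen K n I) :
      MvPolynomial.monomial w (1 : K) ∈ x.asHomogeneousIdeal.toIdeal.primeCompl := by
    rw [MvPolynomial.monomial_eq, map_one, one_mul, Finsupp.prod_fintype _ _ (by simp)]
    refine prod_mem fun i _ ↦ ?_
    by_cases hi : i ∈ I
    · exact pow_mem (mem_primeCompl_of_mem_basicOpen (mem_varOpen.1 hx i hi)) _
    · have : w i = 0 := Int.toNat_of_nonpos (by have := he.2 i hi; lia)
      rw [this, pow_zero]
      exact one_mem _
  have hv1 : MvPolynomial.monomial v c ∈ polyGrading K n (∑ i, v i) :=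
    MvPolynomial.isHomogeneous_monomial c (by
      rw [Finsupp.degree_eq_sum])
  have hw1 : MvPolynomial.monomial w (1 : K) ∈ polyGrading K n (∑ i, w i) :=
    MvPolynomial.isHomogeneous_monomial _ (by rw [Finsupp.degree_eq_sum])
  have hdeg : ((∑ i, v i : ℕ) : ℤ) = (∑ i, w i : ℕ) + d := by
    push_cast
    rw [← he.1]
    exact (sum_toNat e).trans (add_comm _ _)
  refine ⟨⟨fun x ↦ Localization.mk (MvPolynomial.monomial v c) ⟨_, hw x.1 x.2⟩, fun x ↦
    ⟨varOpen K n I, x.2, le_rfl, _, _, _, _, hv1, hw1, hdeg, fun y ↦ ⟨hw y.1 y.2, rfl⟩⟩⟩, ?_⟩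
  change (Localization.mk (MvPolynomial.monomial v c) ⟨_, hw _ (genericPt_mem_varOpen I)⟩ :
    RatFunc K n) = _
  rw [Localization.mk_eq_mk', IsLocalization.mk'_eq_iff_eq_mul, algebraMap_monomial]
  change _ = _ * algebraMap _ _ (MvPolynomial.monomial w (1 : K))
  rw [algebraMap_monomial, one_smul, smul_mul_assoc, ← Units.val_mul, ← laurentMonomial_add]
  congr 3
  ext i
  change ((e i).toNat : ℤ) = e i + ((-e i).toNat : ℤ)
  lia

lemma laurentSub_inf_le (d : ℤ) (I J : Finset (Fin (n + 1))) :
    laurentSub K d I ⊓ laurentSub K d J ≤ laurentSub K d (I ∩ J) := by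
  rintro a ⟨hI, hJ⟩
  obtain ⟨p, rfl, hp⟩ := exists_of_mem_laurentSub hI
  replace hJ := laurentMap_mem_iff.1 hJ
  rw [laurentMap_mem_iff]
  refine fun e he ↦ ⟨(hp e he).1, fun i hi ↦ ?_⟩
  by_cases hiI : i ∈ I
  · exact (hJ e he).2 i fun h ↦ hi (Finset.mem_inter.2 ⟨hiI, h⟩)
  · exact (hp e he).2 i hiI

variable (K n) in
/-- A linear retraction of the rational functions onto the Laurent polynomials. -/
noncomputable def laurentRetract : RatFunc K n →ₗ[K] ((Fin (n + 1) → ℤ) →₀ K) :=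
  (LinearMap.exists_leftInverse_of_injective _
    (LinearMap.ker_eq_bot.2 laurentMap_injective)).choose

@[simp]
lemma laurentRetract_laurentMap (p : (Fin (n + 1) → ℤ) →₀ K) :
    laurentRetract K n (laurentMap K n p) = p :=
  LinearMap.congr_fun (LinearMap.exists_leftInverse_of_injective _
    (LinearMap.ker_eq_bot.2 laurentMap_injective)).choose_spec p

variable (K n) in
/-- The data that compute the cohomology of `𝒪(d)` on projective space. -/
noncomputable def twistCechDatum (d : ℤ) :
    CechDatum (twistAb (polyGrading K n) d) (varOpen K n) (RatFunc K n) where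
  val I := genericVal K d (genericPt_mem_varOpen I)
  val_injective I := genericVal_injective d _
  val_res _ _ := rfl
  sub I := (laurentSub K d I).toAddSubgroup
  range_val I hI := le_antisymm (range_genericVal_le d hI) (laurentSub_le_range d I)
  sub_inter := laurentSub_inf_le d
  -- The projection keeps the monomials with nonnegative exponent at i. It must be defined on all
  -- rational functions, so a linear retraction onto Laurent polynomials is applied first.
  proj i := (laurentMap K n).toAddMonoidHom.comp
    ((Finsupp.filterAddHom fun e ↦ 0 ≤ e i).comp (laurentRetract K n).toAddMonoidHom)
  proj_mem i I a ha := by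
    obtain ⟨p, rfl, hp⟩ := exists_of_mem_laurentSub ha
    change laurentMap K n (Finsupp.filter (fun e ↦ 0 ≤ e i)
      (laurentRetract K n (laurentMap K n p))) ∈ laurentSub K d _
    rw [laurentRetract_laurentMap, laurentMap_mem_iff]
    intro e he
    rw [Finsupp.support_filter, Finset.mem_filter] at he
    refine ⟨(hp e he.1).1, fun j hj ↦ ?_⟩
    by_cases hji : j = i
    · exact hji ▸ he.2
    · exact (hp e he.1).2 j fun h ↦ hj (Finset.mem_erase.2 ⟨hji, h⟩)
  proj_eq i I a hi ha := by
    obtain ⟨p, rfl, hp⟩ := exists_of_mem_laurentSub ha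
    change laurentMap K n (Finsupp.filter (fun e ↦ 0 ≤ e i)
      (laurentRetract K n (laurentMap K n p))) = _
    rw [laurentRetract_laurentMap, (Finsupp.filter_eq_self_iff _ _).2]
    exact fun e he ↦ (hp e (by simpa using he)).2 i hi
  acyclic I hI p x := by
    obtain ⟨j, hj⟩ := hI
    exact ext_twistAb_eq_zero (MvPolynomial.isHomogeneous_X K j) d (isAffineOpen_varOpen ⟨j, hj⟩)
      (fun x hx ↦ mem_varOpen.1 hx j hj) p x

end Sections

end Monomials

/-! ### The residue pairing between polynomials and Laurent polynomials. -/

section Residue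

attribute [local instance] MvPolynomial.gradedAlgebra

open Abelian

variable {K : Type u} [Field K] {n : ℕ}

variable (K n) in
/-- The residue of a rational function: the coefficient of `(x₀ ⋯ xₙ)⁻¹` (with respect to a chosen
retraction onto the Laurent polynomials). -/
noncomputable def residue : RatFunc K n →ₗ[K] K :=
  Finsupp.lapply (fun _ ↦ -1) ∘ₗ laurentRetract K n

/-- The exponent of `x ^ (-1 - v)`. -/
def dualExp (v : Fin (n + 1) →₀ ℕ) : Fin (n + 1) → ℤ := fun i ↦ -1 - v i

/-- The product x^v x^e equals (x_0 ⋯ x_n)⁻¹ only for e = -1 - v, so monomials are dual bases for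
the pairing. -/
lemma residue_monomial_mul_laurentMap (v : Fin (n + 1) →₀ ℕ) (c : K)
    (p : (Fin (n + 1) → ℤ) →₀ K) :
    residue K n (algebraMap _ _ (MvPolynomial.monomial v c) * laurentMap K n p) =
      c * p (dualExp v) := by
  induction p using Finsupp.induction_linear with
  | zero => simp
  | add f g hf hg => rw [map_add, mul_add, map_add, hf, hg, Finsupp.add_apply, mul_add]
  | single e a =>
    rw [laurentMap_single, algebraMap_monomial, smul_mul_smul_comm, ← Units.val_mul,
      ← laurentMonomial_add, ← laurentMap_single, residue, LinearMap.comp_apply,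
      laurentRetract_laurentMap, Finsupp.lapply_apply, Finsupp.single_apply, Finsupp.single_apply,
      mul_ite, mul_zero]
    refine if_congr ⟨fun h ↦ ?_, fun h ↦ ?_⟩ rfl rfl
    · ext i
      have := congrFun h i
      simp only [Pi.add_apply, dualExp] at this ⊢
      lia
    · ext i
      have := congrFun h i
      simp only [Pi.add_apply, dualExp] at this ⊢
      lia

variable (K) in
/-- The Laurent polynomials of degree `d` all of whose monomials are regular along some `xᵢ`. -/
noncomputable def laurentCob (d : ℤ) : AddSubgroup (RatFunc K n) :=
  ⨆ i ∈ (Finset.univ : Finset (Fin (n + 1))),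
    (laurentSub K d ((Finset.univ ∪ ∅ : Finset (Fin (n + 1))).erase i)).toAddSubgroup

lemma laurentMonomial_mem_laurentCob {d : ℤ} {e : Fin (n + 1) → ℤ} (he : ∑ i, e i = d)
    {i : Fin (n + 1)} (hi : 0 ≤ e i) (c : K) :
    c • (laurentMonomial K e : RatFunc K n) ∈ laurentCob K d := by
  refine (le_iSup₂_of_le (f := fun i (_ : i ∈ (Finset.univ : Finset (Fin (n + 1)))) ↦
    (laurentSub K d ((Finset.univ ∪ ∅ : Finset (Fin (n + 1))).erase i)).toAddSubgroup) i
    (Finset.mem_univ i) le_rfl :) ?_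
  refine laurentMonomial_mem ⟨he, fun j hj ↦ ?_⟩ _
  obtain rfl : j = i := by simpa using hj
  exact hi

/-- Multiplying by a polynomial keeps a monomial regular along x_i, so (x_0 ⋯ x_n)⁻¹ never appears.
-/
lemma residue_eq_zero_of_mem_laurentCob {d : ℤ} {a : RatFunc K n} (ha : a ∈ laurentCob K d)
    (f : MvPolynomial (Fin (n + 1)) K) : residue K n (algebraMap _ _ f * a) = 0 := by
  have h : laurentCob K d ≤ ((residue K n).toAddMonoidHom.comp
      (AddMonoidHom.mulLeft (algebraMap _ (RatFunc K n) f))).ker := by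
    refine iSup₂_le fun i _ a ha ↦ ?_
    obtain ⟨p, rfl, hp⟩ := exists_of_mem_laurentSub ha
    change residue K n (algebraMap _ _ f * _) = 0
    rw [f.as_sum, map_sum, Finset.sum_mul, map_sum]
    refine Finset.sum_eq_zero fun v _ ↦ ?_
    rw [residue_monomial_mul_laurentMap, Finsupp.notMem_support_iff.1, mul_zero]
    intro hv
    have := (hp _ hv).2 i (by simp)
    simp only [dualExp] at this
    lia
  exact h ha

/-- Nondegeneracy of the pairing modulo coboundaries: a monomial x^e with all exponents negative is
detected by the polynomial x^(-1-e), whose degree is -d - (n + 1) = m. -/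
lemma mem_laurentCob {d : ℤ} {a : RatFunc K n} (ha : a ∈ laurentSub K d Finset.univ) {m : ℕ}
    (hm : d + m + (n + 1) = 0)
    (h : ∀ f ∈ polyGrading K n m, residue K n (algebraMap _ _ f * a) = 0) : a ∈ laurentCob K d := by
  obtain ⟨p, rfl, hp⟩ := exists_of_mem_laurentSub ha
  rw [laurentMap, Finsupp.linearCombination_apply]
  refine sum_mem fun e he ↦ ?_
  obtain ⟨i, hi⟩ : ∃ i, 0 ≤ e i := by
    by_contra! hneg
    let v : Fin (n + 1) →₀ ℕ := Finsupp.equivFunOnFinite.symm fun i ↦ (-1 - e i).toNat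
    have hv (i) : (v i : ℤ) = -1 - e i := Int.toNat_of_nonneg (by have := hneg i; lia)
    have := h (MvPolynomial.monomial v 1) (MvPolynomial.isHomogeneous_monomial _ (by
      rw [Finsupp.degree_eq_sum]
      zify
      rw [Finset.sum_congr rfl fun i _ ↦ hv i, Finset.sum_sub_distrib, (hp e he).1]
      simp
      linarith))
    rw [residue_monomial_mul_laurentMap, one_mul] at this
    have hve : dualExp v = e := by
      ext i
      simp [dualExp, hv]
    rw [hve] at this
    exact Finsupp.mem_support_iff.1 he this
  exact laurentMonomial_mem_laurentCob (hp e he).1 hi _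

/-- If all n + 1 exponents were negative, their sum would be at most -(n + 1). -/
lemma mem_laurentCob_of_lt {d : ℤ} {a : RatFunc K n} (ha : a ∈ laurentSub K d Finset.univ)
    (hd : 0 < d + (n + 1)) : a ∈ laurentCob K d := by
  refine laurentSub_induction (fun e he c ↦ ?_) ha
  obtain ⟨i, hi⟩ : ∃ i, 0 ≤ e i := by
    by_contra! hneg
    have : ∑ i, e i ≤ ∑ i : Fin (n + 1), (-1) := Finset.sum_le_sum fun i _ ↦ by
      have := hneg i; lia
    rw [he.1] at this
    simp at this
    linarith
  exact laurentMonomial_mem_laurentCob he.1 hi _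

-- The Laurent polynomial ∑ μ(x^v) x^(-1-v), over the monomials x^v of degree m, represents μ on
-- forms of degree m.
variable (n) in
lemma exists_laurent_residue {m : ℕ} {d : ℤ} (hm : d + m + (n + 1) = 0)
    (μ : MvPolynomial (Fin (n + 1)) K →ₗ[K] K) :
    ∃ a ∈ laurentSub K d (Finset.univ : Finset (Fin (n + 1))),
      ∀ f ∈ polyGrading K n m, residue K n (algebraMap _ _ f * a) = μ f := by
  classical
  let p : (Fin (n + 1) → ℤ) →₀ K := ∑ v ∈ Finset.finsuppAntidiag Finset.univ m,
    Finsupp.single (dualExp v) (μ (MvPolynomial.monomial v 1))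
  refine ⟨laurentMap K n p, ?_, fun f hf ↦ ?_⟩
  · rw [map_sum]
    refine sum_mem fun v hv ↦ ?_
    rw [laurentMap_single]
    refine laurentMonomial_mem ⟨?_, fun i hi ↦ (hi (Finset.mem_univ i)).elim⟩ _
    have := (Finset.mem_finsuppAntidiag.1 hv).1
    simp only [dualExp, Finset.sum_sub_distrib, ← Nat.cast_sum, this]
    simp
    linarith
  · have key (v : Fin (n + 1) →₀ ℕ) (c : K) (hv : ∑ i, v i = m) :
        residue K n (algebraMap _ _ (MvPolynomial.monomial v c) * laurentMap K n p) =
          μ (MvPolynomial.monomial v c) := by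
      rw [residue_monomial_mul_laurentMap, Finsupp.finsetSum_apply, Finset.sum_eq_single v]
      · rw [Finsupp.single_eq_same, ← smul_eq_mul, ← map_smul, MvPolynomial.smul_monomial,
          smul_eq_mul, mul_one]
      · intro w _ hw
        refine Finsupp.single_eq_of_ne fun h ↦ hw ?_
        ext i
        have := congrFun h i
        simp only [dualExp] at this
        lia
      · exact fun h ↦ (h (Finset.mem_finsuppAntidiag.2 ⟨hv, Finset.subset_univ _⟩)).elim
    have h1 := congrArg μ f.as_sum
    have h2 := congrArg (fun f ↦ residue K n (algebraMap _ _ f * laurentMap K n p)) f.as_sum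
    refine h2.trans (Eq.trans ?_ h1.symm)
    simp only [map_sum, Finset.sum_mul]
    refine Finset.sum_congr rfl fun v hv ↦ key v _ ?_
    have := hf (MvPolynomial.mem_support_iff.1 hv)
    rw [Finsupp.weight_apply, Finsupp.sum_fintype _ _ (by simp)] at this
    simpa using this

end Residue

/-! ### The class that computes the cohomology of 𝒪(d) on projective space. -/

section TwistCohomology

attribute [local instance] MvPolynomial.gradedAlgebra

open Abelian

variable {K : Type u} [Field K] {n : ℕ}

variable (K n) in
/-- The sheaf `𝒪(d)` on projective space, as a sheaf of abelian groups. -/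
noncomputable abbrev lineAb (d : ℤ) : AbSheaf (projSpace K n).toTopCat :=
  twistAb (polyGrading K n) d

/-- Multiplication by a linear form. -/
noncomputable def mulAb (ℓ : polyGrading K n 1) {d e : ℤ} (h : e = d + 1) :
    lineAb K n d ⟶ lineAb K n e :=
  (SheafOfModules.toSheaf _).map (twistMul ℓ (by simpa using h))

variable (K n) in
/-- Cohomology classes on projective space. -/
abbrev PClass (F : AbSheaf (projSpace K n).toTopCat) (p : ℕ) : Type u :=
  Ext (freeOpen (X := (projSpace K n).toTopCat) ⊤) F p

/-- The variables generate the polynomial ring over its degree zero part, so the coordinate open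
sets cover Proj. -/
lemma unionOpen_varOpen : unionOpen (varOpen K n) Finset.univ ∅ = ⊤ := by
  refine top_le_iff.1 fun (x : ProjectiveSpectrum (polyGrading K n)) _ ↦ ?_
  obtain ⟨i, hi⟩ : ∃ i : Fin (n + 1), MvPolynomial.X i ∉ x.asHomogeneousIdeal := by
    by_contra! h
    have := Proj.iSup_basicOpen_eq_top' (polyGrading K n)
      (fun i ↦ (MvPolynomial.X i : MvPolynomial (Fin (n + 1)) K))
      (fun i ↦ ⟨1, MvPolynomial.isHomogeneous_X K i⟩) ?_
    · have hx : x ∈ (⊤ : (Proj (polyGrading K n)).Opens) := trivial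
      rw [← this] at hx
      obtain ⟨i, hi⟩ := Opens.mem_iSup.1 hx
      exact hi (h i)
    · refine top_le_iff.1 fun f _ ↦ ?_
      induction f using MvPolynomial.induction_on with
      | C a =>
        exact Subalgebra.algebraMap_mem _ (⟨MvPolynomial.C a, MvPolynomial.isHomogeneous_C _ a⟩ : polyGrading K n 0)
      | add f g hf hg => exact add_mem (hf trivial) (hg trivial)
      | mul_X f i hf => exact mul_mem (hf trivial) (Algebra.subset_adjoin ⟨i, rfl⟩)
  have hle : varOpen K n (insert i ∅) ≤ unionOpen (varOpen K n) Finset.univ ∅ :=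
    Finset.le_sup (f := fun i ↦ varOpen K n (insert i ∅)) (Finset.mem_univ i)
  exact hle (mem_varOpen.2 fun j hj ↦ by
    obtain rfl : j = i := by simpa using hj
    exact hi)

/-- The value at the generic point of a class of degree `0`. -/
noncomputable def genericValExt {d : ℤ} {U : Opens (projSpace K n).toTopCat}
    (hU : genericPt K n ∈ U) : Ext (freeOpen U) (lineAb K n d) 0 →+ RatFunc K n :=
  AddMonoidHom.comp (genericVal K d hU) (extZeroEquiv U (lineAb K n d)).toAddMonoidHom

lemma genericValExt_mul {d e : ℤ} {U : Opens (projSpace K n).toTopCat} (hU : genericPt K n ∈ U)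
    (x : Ext (freeOpen U) (lineAb K n d) 0) (ℓ : polyGrading K n 1) (h : e = d + 1) :
    genericValExt hU (x.comp (Ext.mk₀ (mulAb ℓ h)) (add_zero 0)) =
      algebraMap _ _ ℓ.1 * genericValExt hU x :=
  congrArg (genericVal K e hU) (extZeroEquiv_comp x (mulAb ℓ h))

lemma genericValExt_injective {d : ℤ} {U : Opens (projSpace K n).toTopCat}
    (hU : genericPt K n ∈ U) : Function.Injective (genericValExt (d := d) hU) :=
  (genericVal_injective d hU).comp (extZeroEquiv U (lineAb K n d)).injective

variable (K n) in
/-- The cohomology of the line bundles on projective space is computed by a class of degree `n`. -/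
theorem exists_top_class : ∃ γ : Ext (freeOpen (X := (projSpace K n).toTopCat) ⊤)
    (freeOpen (varOpen K n Finset.univ)) n,
    ∀ d, (∀ p (x : PClass K n (lineAb K n d) (p + 1)), p + 1 ≠ n → x = 0) ∧
      (∀ x : PClass K n (lineAb K n d) n, ∃ a, x = γ.comp a (add_zero n)) ∧
      (n ≠ 0 → ∀ a : Ext (freeOpen (varOpen K n Finset.univ)) (lineAb K n d) 0,
        γ.comp a (add_zero n) = 0 ↔
          genericValExt (genericPt_mem_varOpen Finset.univ) a ∈ laurentCob K d) := by
  obtain ⟨c⟩ := CechClass.nonempty (D := varOpen K n) varOpen_union n Finset.univ (by simp)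
  -- The open set and the index set are made variables because the identities with ⊤ and with `univ`
  -- are not definitional; this allows them to be substituted.
  have key (W : Opens (projSpace K n).toTopCat) (J : Finset (Fin (n + 1)))
    (hW : unionOpen (varOpen K n) Finset.univ ∅ = W) (hJ : Finset.univ ∪ ∅ = J) :
    ∃ γ : Ext (freeOpen W) (freeOpen (varOpen K n J)) n,
    ∀ d, (∀ p (x : Ext (freeOpen W) (lineAb K n d) (p + 1)), p + 1 ≠ n → x = 0) ∧
      (∀ x : Ext (freeOpen W) (lineAb K n d) n, ∃ a, x = γ.comp a (add_zero n)) ∧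
      (n ≠ 0 → ∀ a : Ext (freeOpen (varOpen K n J)) (lineAb K n d) 0,
        γ.comp a (add_zero n) = 0 ↔
          genericValExt (genericPt_mem_varOpen J) a ∈ laurentCob K d) := by
    subst hW hJ
    have hdis : Disjoint (Finset.univ : Finset (Fin (n + 1))) ∅ := Finset.disjoint_empty_right _
    exact ⟨c.γ ∅, fun d ↦ ⟨c.eq_zero (twistCechDatum K n d) ∅ hdis,
      c.surjective (twistCechDatum K n d) ∅ hdis,
      c.comp_eq_zero_iff (twistCechDatum K n d) ∅ hdis⟩⟩
  exact key ⊤ _ unionOpen_varOpen (Finset.union_empty _)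

end TwistCohomology

/-! ### Serre duality for matrices of linear forms. -/

section TopCohomology

attribute [local instance] MvPolynomial.gradedAlgebra

open Abelian MvPolynomial

variable {K : Type u} [Field K] {n : ℕ}

lemma eq_zero_of_ne {d : ℤ} {p : ℕ} (x : PClass K n (lineAb K n d) p) (h0 : p ≠ 0) (hn : p ≠ n) :
    x = 0 := by
  obtain _ | p := p
  · exact (h0 rfl).elim
  · obtain ⟨γ, hγ⟩ := exists_top_class K n
    exact (hγ d).1 p x hn

lemma genericValExt_mem {d : ℤ} {I : Finset (Fin (n + 1))} (hI : I.Nonempty)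
    (x : Ext (freeOpen (varOpen K n I)) (lineAb K n d) 0) :
    genericValExt (genericPt_mem_varOpen I) x ∈ laurentSub K d I :=
  range_genericVal_le d hI ⟨_, rfl⟩

lemma exists_genericValExt_eq {d : ℤ} {I : Finset (Fin (n + 1))} {a : RatFunc K n}
    (ha : a ∈ laurentSub K d I) : ∃ x : Ext (freeOpen (varOpen K n I)) (lineAb K n d) 0,
      genericValExt (genericPt_mem_varOpen I) x = a := by
  obtain ⟨s, hs⟩ := laurentSub_le_range d I ha
  refine ⟨(extZeroEquiv _ _).symm s, Eq.trans ?_ hs⟩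
  exact congrArg (genericVal K d _) ((extZeroEquiv _ (lineAb K n d)).apply_symm_apply s)

lemma eq_zero_of_top (hn : n ≠ 0) {d : ℤ} (hd : 0 < d + (n + 1)) (x : PClass K n (lineAb K n d) n) :
    x = 0 := by
  obtain ⟨γ, hγ⟩ := exists_top_class K n
  obtain ⟨a, rfl⟩ := (hγ d).2.1 x
  rw [(hγ d).2.2 hn]
  exact mem_laurentCob_of_lt (genericValExt_mem Finset.univ_nonempty a) hd

lemma comp_sum_comp_mulAb {U V : Opens (projSpace K n).toTopCat} {p q : ℕ}
    (γ : Ext (freeOpen U) (freeOpen V) p) {d e : ℤ} (h : e = d + 1)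
    (b : Fin q → polyGrading K n 1) (a : Fin q → Ext (freeOpen V) (lineAb K n d) 0) :
    ∑ j, (γ.comp (a j) (add_zero p)).comp (Ext.mk₀ (mulAb (b j) h)) (add_zero p) =
      γ.comp (∑ j, (a j).comp (Ext.mk₀ (mulAb (b j) h)) (add_zero 0)) (add_zero p) := by
  rw [Ext.comp_sum]
  exact Finset.sum_congr rfl fun j _ ↦ Ext.comp_assoc _ _ _ _ _ (by lia)

/-- A matrix of linear forms acts injectively on the top cohomology if its transpose acts
surjectively on polynomials. -/
theorem top_injective (hn : n ≠ 0) {p q : ℕ} (B : Fin p → Fin q → polyGrading K n 1) {m : ℕ}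
    {d e : ℤ} (h : e = d + 1) (hm : d + (m + 1) + (n + 1) = 0)
    (hB : ∀ w : Fin q → MvPolynomial (Fin (n + 1)) K, (∀ j, w j ∈ polyGrading K n (m + 1)) →
      ∃ u : Fin p → MvPolynomial (Fin (n + 1)) K, (∀ i, u i ∈ polyGrading K n m) ∧
        ∀ j, ∑ i, (B i j).1 * u i = w j)
    (x : Fin q → PClass K n (lineAb K n d) n)
    (hx : ∀ i, ∑ j, (x j).comp (Ext.mk₀ (mulAb (B i j) h)) (add_zero n) = 0) : x = 0 := by
  obtain ⟨γ, hγ⟩ := exists_top_class K n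
  choose a ha using fun j ↦ (hγ d).2.1 (x j)
  obtain rfl := funext ha
  let v (j : Fin q) := genericValExt (genericPt_mem_varOpen Finset.univ) (a j)
  -- In terms of Laurent representatives, the hypothesis says that the entries of B v are
  -- coboundaries.
  have hv (i : Fin p) : ∑ j, algebraMap _ (RatFunc K n) (B i j).1 * v j ∈ laurentCob K e := by
    have := hx i
    rw [comp_sum_comp_mulAb, (hγ e).2.2 hn, map_sum] at this
    simpa only [genericValExt_mul] using this
  ext j
  rw [Pi.zero_apply, (hγ d).2.2 hn]
  refine mem_laurentCob (m := m + 1) (genericValExt_mem Finset.univ_nonempty _)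
    (by push_cast; exact hm) fun f hf ↦ ?_
  -- Writing f e_j = Bᵀ u gives f v_j = ∑ u_i (B v)_i. The right side has residue 0, so v_j pairs to
  -- zero with every f.
  obtain ⟨u, hu, hw⟩ := hB (Pi.single j f) fun k ↦ by
    obtain rfl | hk := eq_or_ne k j
    · rwa [Pi.single_eq_same]
    · rw [Pi.single_eq_of_ne hk]; exact zero_mem _
  have h1 : algebraMap _ (RatFunc K n) f * v j = ∑ i, algebraMap _ (RatFunc K n) (u i) *
      ∑ j, algebraMap _ (RatFunc K n) (B i j).1 * v j := by
    simp only [Finset.mul_sum]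
    rw [Finset.sum_comm, Finset.sum_eq_single j]
    · have := congrArg (algebraMap _ (RatFunc K n)) (hw j)
      rw [Pi.single_eq_same] at this
      rw [← this, map_sum, Finset.sum_mul]
      exact Finset.sum_congr rfl fun i _ ↦ by rw [map_mul]; ring
    · intro k _ hk
      have := congrArg (fun f ↦ algebraMap _ (RatFunc K n) f * v k) (hw k)
      rw [Pi.single_eq_of_ne hk, map_zero, zero_mul, map_sum, Finset.sum_mul] at this
      rw [← this]
      exact Finset.sum_congr rfl fun i _ ↦ by rw [map_mul]; ring
    · exact fun h ↦ (h (Finset.mem_univ _)).elim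
  change residue K n (_ * v j) = 0
  rw [h1, map_sum]
  exact Finset.sum_eq_zero fun i _ ↦ residue_eq_zero_of_mem_laurentCob (hv i) _

/-- A matrix of linear forms acts surjectively on the top cohomology if its transpose acts
injectively on polynomials. -/
theorem top_surjective (hn : n ≠ 0) {p q : ℕ} (B : Fin p → Fin q → polyGrading K n 1) {m : ℕ}
    {d e : ℤ} (h : e = d + 1) (hm : d + (m + 1) + (n + 1) = 0)
    (hB : ∀ u : Fin p → MvPolynomial (Fin (n + 1)) K, (∀ i, u i ∈ polyGrading K n m) →
      (∀ j, ∑ i, (B i j).1 * u i = 0) → u = 0)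
    (y : Fin p → PClass K n (lineAb K n e) n) :
    ∃ x : Fin q → PClass K n (lineAb K n d) n,
      ∀ i, ∑ j, (x j).comp (Ext.mk₀ (mulAb (B i j) h)) (add_zero n) = y i := by
  obtain ⟨γ, hγ⟩ := exists_top_class K n
  choose b hb using fun j ↦ (hγ e).2.1 (y j)
  obtain rfl := funext hb
  let v (i : Fin p) := genericValExt (genericPt_mem_varOpen Finset.univ) (b i)
  let T : (Fin p → MvPolynomial (Fin (n + 1)) K) →ₗ[K] (Fin q → MvPolynomial (Fin (n + 1)) K) :=
    LinearMap.pi fun j ↦ ∑ i, LinearMap.mulLeft K (B i j).1 ∘ₗ LinearMap.proj i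
  have hT (u j) : T u j = ∑ i, (B i j).1 * u i := by
    simp [T, LinearMap.sum_apply]
  let V : Submodule K (Fin p → MvPolynomial (Fin (n + 1)) K) :=
    Submodule.pi Set.univ fun _ ↦ polyGrading K n m
  -- The given class defines the functional u ↦ ∑ res(u_i v_i) on S_m^p. Since Bᵀ is injective
  -- there, this functional factors through Bᵀ as a functional μ.
  obtain ⟨G, hG⟩ := LinearMap.exists_leftInverse_of_injective (T ∘ₗ V.subtype) (by
    refine LinearMap.ker_eq_bot'.2 fun u hu ↦ Subtype.ext (hB u.1 (fun i ↦ u.2 i trivial) fun j ↦ ?_)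
    rw [← hT]
    exact congrFun hu j)
  let Λ : (Fin p → MvPolynomial (Fin (n + 1)) K) →ₗ[K] K :=
    ∑ i, residue K n ∘ₗ LinearMap.mulRight K (v i) ∘ₗ
      (IsScalarTower.toAlgHom K (MvPolynomial (Fin (n + 1)) K) (RatFunc K n)).toLinearMap ∘ₗ
        LinearMap.proj i
  let μ : (Fin q → MvPolynomial (Fin (n + 1)) K) →ₗ[K] K := Λ ∘ₗ V.subtype ∘ₗ G
  have hμ (i : Fin p) (g) (hg : g ∈ polyGrading K n m) :
      μ (T (Pi.single i g)) = residue K n (algebraMap _ _ g * v i) := by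
    have hV : Pi.single i g ∈ V := fun k _ ↦ by
      obtain rfl | hk := eq_or_ne k i
      · rwa [Pi.single_eq_same]
      · rw [Pi.single_eq_of_ne hk]; exact zero_mem _
    have h1 := LinearMap.congr_fun hG ⟨_, hV⟩
    have h2 : G (T (Pi.single i g)) = ⟨_, hV⟩ := h1
    simp only [μ, LinearMap.comp_apply, h2, Λ, LinearMap.sum_apply]
    rw [Finset.sum_eq_single i]
    · simp
    · intro k _ hk
      simp [hk]
    · exact fun h ↦ (h (Finset.mem_univ _)).elim
  -- Each component of μ is the residue against a Laurent polynomial. These Laurent polynomials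
  -- represent the preimage sought.
  choose a ha1 ha2 using fun j ↦ exists_laurent_residue n (m := m + 1) (d := d)
    (by push_cast; exact hm) (μ ∘ₗ LinearMap.single K (fun _ ↦ MvPolynomial (Fin (n + 1)) K) j)
  choose x hx using fun j ↦ exists_genericValExt_eq (ha1 j)
  refine ⟨fun j ↦ γ.comp (x j) (add_zero n), fun i ↦ ?_⟩
  rw [comp_sum_comp_mulAb, ← sub_eq_zero, ext_comp_sub, (hγ e).2.2 hn]
  refine mem_laurentCob (m := m) (genericValExt_mem Finset.univ_nonempty _)
    (by linarith) fun g hg ↦ ?_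
  have h3 (j : Fin q) : (B i j).1 * g ∈ polyGrading K n (m + 1) := by
    have := SetLike.mul_mem_graded (B i j).2 hg
    rwa [Nat.add_comm 1 m] at this
  have h4 : T (Pi.single i g) = ∑ j, Pi.single j ((B i j).1 * g) := by
    ext1 k
    rw [hT, Finset.sum_apply, Finset.sum_eq_single i, Finset.sum_eq_single k]
    · simp
    · intro l _ hl; simp [hl.symm]
    · exact fun h ↦ (h (Finset.mem_univ _)).elim
    · intro l _ hl; simp [hl]
    · exact fun h ↦ (h (Finset.mem_univ _)).elim
  rw [map_sub, map_sum, mul_sub, map_sub, Finset.mul_sum, map_sum]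
  change _ - residue K n (_ * v i) = 0
  rw [← hμ i g hg, h4, map_sum, sub_eq_zero]
  refine Finset.sum_congr rfl fun j _ ↦ ?_
  rw [genericValExt_mul, hx, ← mul_assoc, ← map_mul, mul_comm g, ha2 j _ (h3 j)]
  rfl

end TopCohomology

/-! ### Global sections of 𝒪(d) are the forms of degree d. -/

section GlobalSections

attribute [local instance] MvPolynomial.gradedAlgebra

open Abelian MvPolynomial

variable {K : Type u} [Field K] {n : ℕ}

lemma genericPt_mem_top : genericPt K n ∈ (⊤ : Opens (projSpace K n).toTopCat) := trivial

/-- The section is regular over both D(x_0) and D(x_n). For n ≠ 0 these are different variables, so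
no poles remain. -/
lemma genericValExt_mem_empty (hn : n ≠ 0) {d : ℤ} (x : PClass K n (lineAb K n d) 0) :
    genericValExt genericPt_mem_top x ∈ laurentSub K d ∅ := by
  have h (i : Fin (n + 1)) : genericValExt genericPt_mem_top x ∈ laurentSub K d {i} := by
    have := genericValExt_mem (Finset.singleton_nonempty i)
      (extRes (le_top : varOpen K n {i} ≤ ⊤) x)
    rwa [show genericValExt (genericPt_mem_varOpen {i}) (extRes (le_top : varOpen K n {i} ≤ ⊤) x) =
      genericValExt genericPt_mem_top x from
        congrArg (genericVal K d (genericPt_mem_varOpen {i})) (extZeroEquiv_res _ x)] at this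
  have := laurentSub_inf_le d _ _ ⟨h 0, h (Fin.last n)⟩
  rwa [Finset.singleton_inter_of_notMem] at this
  rw [Finset.mem_singleton]
  exact fun h ↦ hn (congrArg Fin.val h).symm

lemma eq_zero_of_neg (hn : n ≠ 0) {d : ℤ} (hd : d < 0) (x : PClass K n (lineAb K n d) 0) :
    x = 0 := by
  apply genericValExt_injective genericPt_mem_top
  rw [map_zero]
  obtain ⟨p, hp, h⟩ := exists_of_mem_laurentSub (genericValExt_mem_empty hn x)
  suffices p.support = ∅ by rw [← hp, Finsupp.support_eq_empty.1 this, map_zero]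
  refine Finset.eq_empty_of_forall_notMem fun e he ↦ ?_
  have := Finset.sum_nonneg fun i (_ : i ∈ Finset.univ) ↦ (h e he).2 i (Finset.notMem_empty i)
  rw [(h e he).1] at this
  lia

lemma exists_polynomial (hn : n ≠ 0) {d : ℕ} (x : PClass K n (lineAb K n d) 0) :
    ∃ f ∈ polyGrading K n d, genericValExt genericPt_mem_top x = algebraMap _ _ f := by
  have h := laurentSub_induction (P := ((polyGrading K n d).toAddSubgroup.map
    (algebraMap (MvPolynomial (Fin (n + 1)) K) (RatFunc K n)).toAddMonoidHom)) (fun e he c ↦ ?_)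
    (genericValExt_mem_empty hn x)
  · obtain ⟨f, hf, h⟩ := h
    exact ⟨f, hf, h.symm⟩
  · have hv (i) : ((e i).toNat : ℤ) = e i := Int.toNat_of_nonneg (he.2 i (Finset.notMem_empty i))
    refine ⟨monomial (Finsupp.equivFunOnFinite.symm fun i ↦ (e i).toNat) c, ?_, ?_⟩
    · refine isHomogeneous_monomial c ?_
      rw [Finsupp.degree_eq_sum]
      zify
      exact (Finset.sum_congr rfl fun i _ ↦ hv i).trans he.1
    · refine (algebraMap_monomial _ c).trans ?_
      congr 3
      exact funext hv

lemma exists_class_eq {d : ℕ} {f : MvPolynomial (Fin (n + 1)) K} (hf : f ∈ polyGrading K n d) :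
    ∃ x : PClass K n (lineAb K n d) 0, genericValExt genericPt_mem_top x = algebraMap _ _ f := by
  let s : twistSections (polyGrading K n) d ⊤ :=
    ⟨fun x ↦ algebraMap _ (LocAt (polyGrading K n) x.1) f, isTwistSection_const hf ⊤⟩
  refine ⟨(extZeroEquiv ⊤ _).symm s, ?_⟩
  exact congrArg (genericVal K d _) ((extZeroEquiv _ (lineAb K n d)).apply_symm_apply s)

/-- On global sections the matrix acts as it does on forms, since values at the generic point
determine sections. -/
theorem global_injective (hn : n ≠ 0) {p q : ℕ} (B : Fin p → Fin q → polyGrading K n 1) {d : ℕ}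
    {e : ℤ} (h : e = d + 1)
    (hB : ∀ u : Fin q → MvPolynomial (Fin (n + 1)) K, (∀ j, u j ∈ polyGrading K n d) →
      (∀ i, ∑ j, (B i j).1 * u j = 0) → u = 0)
    (x : Fin q → PClass K n (lineAb K n d) 0)
    (hx : ∀ i, ∑ j, (x j).comp (Ext.mk₀ (mulAb (B i j) h)) (add_zero 0) = 0) : x = 0 := by
  choose f hf hxf using fun j ↦ exists_polynomial hn (x j)
  have := hB f hf fun i ↦ by
    apply algebraMap_ratFunc_injective
    have := congrArg (genericValExt genericPt_mem_top) (hx i)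
    rw [map_sum] at this
    simpa [genericValExt_mul, hxf] using this
  ext j
  apply genericValExt_injective genericPt_mem_top
  rw [hxf, this]
  simp

theorem global_surjective (hn : n ≠ 0) {p q : ℕ} (B : Fin p → Fin q → polyGrading K n 1) {d : ℕ}
    {e : ℤ} (h : e = d + 1)
    (hB : ∀ w : Fin p → MvPolynomial (Fin (n + 1)) K, (∀ j, w j ∈ polyGrading K n (d + 1)) →
      ∃ u : Fin q → MvPolynomial (Fin (n + 1)) K, (∀ i, u i ∈ polyGrading K n d) ∧
        ∀ i, ∑ j, (B i j).1 * u j = w i)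
    (y : Fin p → PClass K n (lineAb K n e) 0) :
    ∃ x : Fin q → PClass K n (lineAb K n d) 0,
      ∀ i, ∑ j, (x j).comp (Ext.mk₀ (mulAb (B i j) h)) (add_zero 0) = y i := by
  obtain rfl : e = (d + 1 : ℕ) := by rw [h]; simp
  choose f hf hyf using fun i ↦ exists_polynomial hn (y i)
  obtain ⟨u, hu, huf⟩ := hB f hf
  choose x hx using fun j ↦ exists_class_eq (hu j)
  refine ⟨x, fun i ↦ ?_⟩
  apply genericValExt_injective genericPt_mem_top
  rw [hyf, ← huf, map_sum, map_sum]
  exact Finset.sum_congr rfl fun j _ ↦ by rw [genericValExt_mul, hx, map_mul]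

end GlobalSections

/-! ### Maximal rank of the block Hankel matrix of variables. -/

section GenericMatrix

open MvPolynomial

variable {K : Type u} [Field K]

section Hankel

/-- Setting `x₀ = 0` in a polynomial in `n + 2` variables. -/
noncomputable def killZero (n : ℕ) :
    MvPolynomial (Fin (n + 2)) K →ₐ[K] MvPolynomial (Fin (n + 1)) K :=
  aeval (Fin.cases 0 X)

@[simp]
lemma killZero_X_zero (n : ℕ) : killZero (K := K) n (X 0) = 0 := by simp [killZero]

@[simp]
lemma killZero_X_succ (n : ℕ) (i : Fin (n + 1)) : killZero (K := K) n (X i.succ) = X i := by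
  simp [killZero]

lemma killZero_rename (n : ℕ) (f : MvPolynomial (Fin (n + 1)) K) :
    killZero n (rename Fin.succ f) = f := by
  rw [killZero, aeval_rename]
  exact aeval_X_left_apply f

lemma killZero_isHomogeneous {n d : ℕ} {f : MvPolynomial (Fin (n + 2)) K} (hf : f.IsHomogeneous d) :
    (killZero n f).IsHomogeneous d := by
  have := hf.aeval (Fin.cases 0 X : Fin (n + 2) → MvPolynomial (Fin (n + 1)) K) (n := 1) fun i ↦ by
    cases i using Fin.cases with
    | zero => exact isHomogeneous_zero _ _ _
    | succ i => exact isHomogeneous_X _ _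
  rwa [one_mul] at this

/-- A polynomial is congruent modulo x_0 to the polynomial obtained by setting x_0 = 0. -/
lemma X_dvd_of_killZero {n : ℕ} {f : MvPolynomial (Fin (n + 2)) K} (hf : killZero n f = 0) :
    X 0 ∣ f := by
  suffices h : X 0 ∣ f - rename Fin.succ (killZero n f) by simpa [hf] using h
  clear hf
  induction f using MvPolynomial.induction_on with
  | C a => simp [killZero]
  | add f g hf hg =>
    convert dvd_add hf hg using 1
    rw [map_add, map_add]
    ring
  | mul_X f i hf =>
    cases i using Fin.cases with
    | zero => simp
    | succ i =>
      convert hf.mul_right (X i.succ) using 1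
      rw [map_mul, map_mul, killZero_X_succ, rename_X]
      ring

lemma isHomogeneous_of_X_mul {σ : Type*} {i : σ} {d : ℕ} {f : MvPolynomial σ K}
    (hf : (X i * f).IsHomogeneous (d + 1)) : f.IsHomogeneous d := by
  intro v hv
  have := hf (d := Finsupp.single i 1 + v) (by rwa [coeff_X_mul])
  rw [map_add, Finsupp.weight_single] at this
  simp at this
  lia

lemma exists_eq_X_mul {n d : ℕ} {f : MvPolynomial (Fin (n + 2)) K} (hf : f.IsHomogeneous (d + 1))
    (h : killZero n f = 0) : ∃ g : MvPolynomial (Fin (n + 2)) K, g.IsHomogeneous d ∧ f = X 0 * g := by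
  obtain ⟨g, rfl⟩ := X_dvd_of_killZero h
  exact ⟨g, isHomogeneous_of_X_mul hf, rfl⟩

lemma eq_zero_of_killZero {n : ℕ} {f : MvPolynomial (Fin (n + 2)) K} (hf : f.IsHomogeneous 0)
    (h : killZero n f = 0) : f = 0 := by
  obtain ⟨c, rfl⟩ : ∃ c, f = C c :=
    ⟨_, totalDegree_eq_zero_iff_eq_C.1 ((totalDegree_zero_iff_isHomogeneous _).2 hf)⟩
  rw [killZero, aeval_C, algebraMap_eq] at h
  rw [C_eq_zero.1 h, C_0]

lemma isHomogeneous_X_mul {σ : Type*} (i : σ) {d : ℕ} {f : MvPolynomial σ K}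
    (hf : f.IsHomogeneous d) : (X i * f).IsHomogeneous (d + 1) := by
  have := (isHomogeneous_X K i).mul hf
  rwa [Nat.add_comm 1 d] at this

lemma hankel_row {n : ℕ} (k : ℕ) (p : ℕ → MvPolynomial (Fin (n + 2)) K) (j : ℕ) :
    ∑ a : Fin (n + 2), X a * p (j + k * a) =
      X 0 * p j + ∑ a : Fin (n + 1), X a.succ * p (j + k * a + k) := by
  rw [Fin.sum_univ_succ, Fin.val_zero, mul_zero, add_zero]
  simp only [Fin.val_succ, mul_add, mul_one, add_assoc]

/-- The block Hankel matrix of linear forms with the variables on its diagonals is injective in low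
degrees. -/
lemma hankel_injective {k : ℕ} : ∀ (n d t : ℕ), k * (d + 1) ≤ t →
    ∀ p : ℕ → MvPolynomial (Fin (n + 1)) K, (∀ i < t + k * n, (p i).IsHomogeneous d) →
      (∀ j < t, ∑ a : Fin (n + 1), X a * p (j + k * a) = 0) → ∀ i < t + k * n, p i = 0
  | 0, d, t, _, p, _, h, i, hi => by
    have := h i (by simpa using hi)
    simpa using this
  | n + 1, d, t, ht, p, hp, h, i, hi => by
    have hk : k ≤ t := le_trans (by nlinarith) ht
    have hrow (j) (hj : j < t) :
        X 0 * p j + ∑ a : Fin (n + 1), X a.succ * p (j + k * a + k) = 0 := by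
      rw [← hankel_row]
      exact h j hj
    -- Setting x_0 = 0 removes the first term of each row. What remains is the Hankel system in one
    -- variable fewer for the shifted sequence p (· + k), with the same d and t.
    have h0 (i) (hi : i < t + k * n) : killZero n (p (i + k)) = 0 := by
      refine hankel_injective n d t ht (fun i ↦ killZero n (p (i + k))) (fun i hi ↦
        killZero_isHomogeneous (hp _ (by linarith))) (fun j hj ↦ ?_) i hi
      have := congrArg (killZero n) (hrow j hj)
      simp only [map_add, map_mul, map_sum, killZero_X_zero, killZero_X_succ, zero_mul, zero_add,
        map_zero] at this
      exact this
    -- Hence p (i + k) = x_0 q i, and the rows from k on, divided by x_0, form the Hankel system for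
    -- q with one degree less and t - k rows. The bound survives because k(d + 2) ≤ t gives k(d + 1)
    -- ≤ t - k. In degree 0 a multiple of x_0 is already zero.
    have hlarge (i) (hi : i < t + k * n) : p (i + k) = 0 := by
      match d, ht, hp with
      | 0, ht, hp => exact eq_zero_of_killZero (hp _ (by linarith)) (h0 i hi)
      | d + 1, ht, hp =>
        have hq (i) : ∃ q : MvPolynomial (Fin (n + 2)) K, i < t + k * n →
            q.IsHomogeneous d ∧ p (i + k) = X 0 * q := by
          by_cases hi : i < t + k * n
          · obtain ⟨q, hq⟩ := exists_eq_X_mul (hp (i + k) (by linarith)) (h0 i hi)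
            exact ⟨q, fun _ ↦ hq⟩
          · exact ⟨0, fun h ↦ (hi h).elim⟩
        choose q hq using hq
        have hkt : t - k + k = t := Nat.sub_add_cancel hk
        have hlt {i} (hi : i < t - k + k * (n + 1)) : i < t + k * n := by rw [mul_add] at hi; lia
        have hbd (j) (hj : j < t - k) (a : Fin (n + 2)) : j + k * a < t + k * n := by
          have : k * a ≤ k * (n + 1) := Nat.mul_le_mul_left _ (by lia)
          rw [mul_add] at this
          lia
        have := hankel_injective (n + 1) d (t - k) (by rw [mul_add, mul_one] at ht ⊢; lia) q
          (fun i hi ↦ (hq i (hlt hi)).1) (fun j hj ↦ ?_) i (by rw [mul_add]; lia)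
        · rw [(hq i hi).2, this, mul_zero]
        · have := h (j + k) (by lia)
          have h2 : ∑ a : Fin (n + 2), X a * p (j + k + k * a) =
              X 0 * ∑ a : Fin (n + 2), X a * q (j + k * a) := by
            rw [Finset.mul_sum]
            refine Finset.sum_congr rfl fun a _ ↦ ?_
            rw [Nat.add_right_comm j k, (hq _ (hbd j hj a)).2]
            ring
          rw [h2] at this
          exact (mul_eq_zero.1 this).resolve_left (X_ne_zero _)
    -- For i < k every other term of row i has index at least k and vanishes, leaving x_0 p i = 0.
    by_cases hik : i < k
    · have := hrow i (by lia)
      rw [Finset.sum_eq_zero fun a _ ↦ ?_, add_zero] at this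
      · exact (mul_eq_zero.1 this).resolve_left (X_ne_zero _)
      · rw [hlarge, mul_zero]
        have : k * a ≤ k * n := Nat.mul_le_mul_left _ (by lia)
        lia
    · obtain ⟨i, rfl⟩ := Nat.exists_eq_add_of_le' (not_lt.1 hik)
      exact hlarge i (by rw [mul_add] at hi; lia)
  termination_by n d => (n, d)

/-- Take p = v on the indices below t and 0 afterwards: the terms other than the first have index at
least k ≥ t. -/
lemma hankel_X_zero_of_le {n k d t : ℕ} (htk : t ≤ k) {v : ℕ → MvPolynomial (Fin (n + 2)) K}
    (hv : ∀ j, (v j).IsHomogeneous d) :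
    ∃ p : ℕ → MvPolynomial (Fin (n + 2)) K, (∀ i, (p i).IsHomogeneous d) ∧
        ∀ j < t, ∑ a : Fin (n + 2), X a * p (j + k * a) = X 0 * v j := by
  obtain ⟨p, hp1, hp2⟩ : ∃ p : ℕ → MvPolynomial (Fin (n + 2)) K,
      (∀ j < t, p j = v j) ∧ ∀ j, t ≤ j → p j = 0 :=
    ⟨fun j ↦ if j < t then v j else 0, fun j hj ↦ if_pos hj, fun j hj ↦ if_neg (not_lt.2 hj)⟩
  refine ⟨p, fun i ↦ ?_, fun j hj ↦ ?_⟩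
  · by_cases hi : i < t
    · exact hp1 i hi ▸ hv i
    · rw [hp2 i (not_lt.1 hi)]
      exact isHomogeneous_zero _ _ _
  · rw [hankel_row, hp1 j hj, Finset.sum_eq_zero, add_zero]
    exact fun a _ ↦ by rw [hp2 _ (htk.trans (Nat.le_add_left k _)), mul_zero]

lemma exists_shift {α : Type*} (k : ℕ) (f g : ℕ → α) :
    ∃ p : ℕ → α, (∀ i, p (i + k) = f i) ∧ ∀ i < k, p i = g i :=
  ⟨fun i ↦ if i < k then g i else f (i - k), fun i ↦ by simp, fun i hi ↦ if_pos hi⟩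

/-- Put p (i + k) = x_0 q i. Rows from k on are then x_0 times the rows for q. In row i < k the
entry p i occurs with coefficient x_0 and is otherwise free, and all remaining terms are divisible
by x_0, so p i can be solved for. -/
lemma hankel_X_zero_of_shift {n k d t : ℕ} {v q : ℕ → MvPolynomial (Fin (n + 2)) K}
    (hv : ∀ j, (v j).IsHomogeneous (d + 1)) (hq : ∀ j, (q j).IsHomogeneous d)
    (h : ∀ j < t - k, ∑ a : Fin (n + 2), X a * q (j + k * a) = v (j + k)) :
    ∃ p : ℕ → MvPolynomial (Fin (n + 2)) K, (∀ i, (p i).IsHomogeneous (d + 1)) ∧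
        ∀ j < t, ∑ a : Fin (n + 2), X a * p (j + k * a) = X 0 * v j := by
  obtain ⟨p, hp1, hp2⟩ := exists_shift k (fun i ↦ X 0 * q i)
    fun i ↦ v i - ∑ a : Fin (n + 1), X a.succ * q (i + k * a)
  refine ⟨p, fun i ↦ ?_, fun j hj ↦ ?_⟩
  · by_cases hi : i < k
    · rw [hp2 i hi]
      exact (hv _).sub (IsHomogeneous.sum _ _ _ fun a _ ↦ isHomogeneous_X_mul _ (hq _))
    · obtain ⟨i, rfl⟩ := Nat.exists_eq_add_of_le' (not_lt.1 hi)
      rw [hp1]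
      exact isHomogeneous_X_mul _ (hq _)
  · by_cases hjk : j < k
    · have h2 : ∑ a : Fin (n + 1), X a.succ * p (j + k * a + k) =
          X 0 * ∑ a : Fin (n + 1), X a.succ * q (j + k * a) := by
        rw [Finset.mul_sum]
        refine Finset.sum_congr rfl fun a _ ↦ ?_
        rw [hp1]
        ring
      rw [hankel_row, h2, hp2 j hjk]
      ring
    · obtain ⟨j, rfl⟩ := Nat.exists_eq_add_of_le' (not_lt.1 hjk)
      rw [← h j (by lia), Finset.mul_sum]
      refine Finset.sum_congr rfl fun a _ ↦ ?_
      rw [Nat.add_right_comm j k, hp1]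
      ring

/-- The block Hankel matrix of linear forms with the variables on its diagonals is surjective in
high degrees. -/
lemma hankel_surjective {k : ℕ} (hk : 1 ≤ k) : ∀ (n d t : ℕ), t ≤ k * (d + 1) →
    ∀ w : ℕ → MvPolynomial (Fin (n + 1)) K, (∀ j, (w j).IsHomogeneous (d + 1)) →
      ∃ p : ℕ → MvPolynomial (Fin (n + 1)) K, (∀ i, (p i).IsHomogeneous d) ∧
        ∀ j < t, ∑ a : Fin (n + 1), X a * p (j + k * a) = w j
  | 0, d, t, _, w, hw => by
    -- In one variable every form of positive degree is divisible by the variable.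
    have h (j) : ∃ g : MvPolynomial (Fin 1) K, g.IsHomogeneous d ∧ w j = X 0 * g := by
      have : X 0 ∣ w j := by
        rw [(w j).as_sum]
        refine Finset.dvd_sum fun v hv ↦ (X_dvd_monomial).2 (Or.inr ?_)
        have := hw j (mem_support_iff.1 hv)
        rw [Finsupp.weight_apply, Finsupp.sum_fintype _ _ (by simp)] at this
        simp at this
        simp [this]
      obtain ⟨g, hg⟩ := this
      exact ⟨g, isHomogeneous_of_X_mul (hg ▸ hw j), hg⟩
    choose g hg using h
    exact ⟨g, fun i ↦ (hg i).1, fun j _ ↦ by simp [(hg j).2]⟩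
  | n + 1, d, t, ht, w, hw => by
    obtain ⟨p', hp', h'⟩ := hankel_surjective hk n d t ht (fun j ↦ killZero n (w j))
      fun j ↦ killZero_isHomogeneous (hw j)
    -- A solution of the system modulo x_0 in one variable fewer, placed in the indices from k on,
    -- because setting x_0 = 0 shifts the system by k.
    let p₁ (i : ℕ) : MvPolynomial (Fin (n + 2)) K := if k ≤ i then rename Fin.succ (p' (i - k)) else 0
    have hp₁ (i) : (p₁ i).IsHomogeneous d := by
      by_cases h : k ≤ i
      · simp only [p₁, if_pos h]
        exact (hp' _).rename_isHomogeneous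
      · simp only [p₁, if_neg h]
        exact isHomogeneous_zero _ _ _
    -- The remaining error is divisible by x_0, so only right-hand sides of the form x_0 v have to
    -- be solved.
    have hv (j) : ∃ v : MvPolynomial (Fin (n + 2)) K, v.IsHomogeneous d ∧
        (j < t → w j - ∑ a : Fin (n + 2), X a * p₁ (j + k * a) = X 0 * v) := by
      by_cases hj : j < t
      · obtain ⟨v, h1, h2⟩ := exists_eq_X_mul (n := n) (d := d)
          (f := w j - ∑ a : Fin (n + 2), X a * p₁ (j + k * a)) ((hw j).sub
            (IsHomogeneous.sum _ _ _ fun a _ ↦ isHomogeneous_X_mul _ (hp₁ _))) (by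
          rw [hankel_row, map_sub, ← h' j hj, map_add, map_mul, killZero_X_zero, zero_mul, zero_add,
            map_sum, sub_eq_zero]
          simp [p₁, killZero_rename])
        exact ⟨v, h1, fun _ ↦ h2⟩
      · exact ⟨0, isHomogeneous_zero _ _ _, fun h ↦ (hj h).elim⟩
    choose v hv1 hv2 using hv
    suffices h : ∃ p : ℕ → MvPolynomial (Fin (n + 2)) K, (∀ i, (p i).IsHomogeneous d) ∧
        ∀ j < t, ∑ a : Fin (n + 2), X a * p (j + k * a) = X 0 * v j by
      obtain ⟨p, hp, h⟩ := h
      refine ⟨p + p₁, fun i ↦ (hp i).add (hp₁ i), fun j hj ↦ ?_⟩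
      simp only [Pi.add_apply, mul_add, Finset.sum_add_distrib] at h ⊢
      rw [h j hj, ← hv2 j hj, sub_add_cancel]
    -- With at most k rows the solution is explicit. Otherwise t ≤ k(d + 1) forces d > 0, and the
    -- system with t - k rows in degree d - 1 is solved first.
    by_cases htk : t ≤ k
    · exact hankel_X_zero_of_le htk hv1
    · match d, ht, hv1 with
      | 0, ht, _ => lia
      | d + 1, ht, hv1 =>
        obtain ⟨q, hq, h⟩ := hankel_surjective hk (n + 1) d (t - k)
          (by rw [mul_add, mul_one] at ht; lia) (fun j ↦ v (j + k)) fun j ↦ hv1 _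
        exact hankel_X_zero_of_shift hv1 hq h
  termination_by n d => (n, d)

end Hankel

end GenericMatrix

/-! ### From one example of maximal rank to a general matrix. -/

section Generic

open MvPolynomial

attribute [local instance] MvPolynomial.gradedAlgebra

variable {K : Type u} [Field K] {n : ℕ}

/-- A family of endomorphisms that depends linearly on parameters and is invertible for some choice
of them is invertible for a general one. -/
lemma exists_polynomial_of_bijective {ι : Type} [Fintype ι] {V : Type u} [AddCommGroup V]
    [Module K V] [Module.Finite K V] (E : ι → V →ₗ[K] V) (M₀ : ι → K)
    (h : ∑ i, M₀ i • E i = LinearMap.id) :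
    ∃ F : MvPolynomial ι K, F ≠ 0 ∧ ∀ M : ι → K, eval M F ≠ 0 →
      Function.Bijective (∑ i, M i • E i : V →ₗ[K] V) := by
  let b := Module.finBasis K V
  let A (i : ι) := LinearMap.toMatrix b b (E i)
  -- The determinant of the generic member of the family; its value at M₀ is 1, hence it is not the
  -- zero polynomial.
  let F : MvPolynomial ι K := (∑ i, (X i : MvPolynomial ι K) • (A i).map C).det
  have hF (M : ι → K) : eval M F = LinearMap.det (∑ i, M i • E i) := by
    rw [← LinearMap.det_toMatrix b, map_sum, RingHom.map_det]
    congr 1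
    ext r c
    simp [A, Matrix.sum_apply]
  refine ⟨F, ?_, fun M hM ↦ ?_⟩
  · rintro h0
    have := hF M₀
    rw [h0, h, LinearMap.det_id, map_zero] at this
    exact zero_ne_one this
  · rw [hF] at hM
    exact (LinearEquiv.ofIsUnitDet (f := ∑ i, M i • E i) (v := b) (v' := b) (by
      rw [LinearMap.det_toMatrix]; exact hM.isUnit)).bijective

/-- Compose the family with a left inverse of its member at M₀: the composite is the identity at M₀,
hence bijective for general M, and then the first factor is injective. -/
lemma exists_polynomial_of_injective {ι : Type} [Fintype ι] {V W : Type u} [AddCommGroup V]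
    [Module K V] [Module.Finite K V] [AddCommGroup W] [Module K W] (E : ι → V →ₗ[K] W) (M₀ : ι → K)
    (h : Function.Injective (∑ i, M₀ i • E i : V →ₗ[K] W)) :
    ∃ F : MvPolynomial ι K, F ≠ 0 ∧ ∀ M : ι → K, eval M F ≠ 0 →
      Function.Injective (∑ i, M i • E i : V →ₗ[K] W) := by
  obtain ⟨G, hG⟩ := LinearMap.exists_leftInverse_of_injective _ (LinearMap.ker_eq_bot.2 h)
  have key (M : ι → K) : ∑ i, M i • (G ∘ₗ E i) = G ∘ₗ (∑ i, M i • E i) := by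
    ext; simp [LinearMap.sum_apply]
  obtain ⟨F, hF, h⟩ := exists_polynomial_of_bijective (fun i ↦ G ∘ₗ E i) M₀ ((key _).trans hG)
  refine ⟨F, hF, fun M hM ↦ ?_⟩
  have := (h M hM).1
  rw [key, LinearMap.coe_comp] at this
  exact this.of_comp

/-- Dually, precompose with a right inverse of the member at M₀. -/
lemma exists_polynomial_of_surjective {ι : Type} [Fintype ι] {V W : Type u} [AddCommGroup V]
    [Module K V] [AddCommGroup W] [Module K W] [Module.Finite K W] (E : ι → V →ₗ[K] W) (M₀ : ι → K)
    (h : Function.Surjective (∑ i, M₀ i • E i : V →ₗ[K] W)) :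
    ∃ F : MvPolynomial ι K, F ≠ 0 ∧ ∀ M : ι → K, eval M F ≠ 0 →
      Function.Surjective (∑ i, M i • E i : V →ₗ[K] W) := by
  obtain ⟨G, hG⟩ := LinearMap.exists_rightInverse_of_surjective _ (LinearMap.range_eq_top.2 h)
  have key (M : ι → K) : ∑ i, M i • (E i ∘ₗ G) = (∑ i, M i • E i) ∘ₗ G := by
    ext; simp [LinearMap.sum_apply]
  obtain ⟨F, hF, h⟩ := exists_polynomial_of_bijective (fun i ↦ E i ∘ₗ G) M₀ ((key _).trans hG)
  refine ⟨F, hF, fun M hM ↦ ?_⟩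
  have := (h M hM).2
  rw [key, LinearMap.coe_comp] at this
  exact this.of_comp

variable {s t : ℕ}

/-- The transpose of a matrix of linear forms is injective on tuples of forms of degree `d`. -/
def TransInjective (B : Fin s → Fin t → polyGrading K n 1) (d : ℕ) : Prop :=
  ∀ u : Fin s → MvPolynomial (Fin (n + 1)) K, (∀ i, u i ∈ polyGrading K n d) →
    (∀ j, ∑ i, (B i j).1 * u i = 0) → u = 0

/-- The transpose of a matrix of linear forms is surjective from tuples of forms of degree `d`. -/
def TransSurjective (B : Fin s → Fin t → polyGrading K n 1) (d : ℕ) : Prop :=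
  ∀ w : Fin t → MvPolynomial (Fin (n + 1)) K, (∀ j, w j ∈ polyGrading K n (d + 1)) →
    ∃ u : Fin s → MvPolynomial (Fin (n + 1)) K, (∀ i, u i ∈ polyGrading K n d) ∧
      ∀ j, ∑ i, (B i j).1 * u i = w j

/-- The matrix of linear forms with coefficients `M`. -/
noncomputable def formMatrix (M : Fin s × Fin t × Fin (n + 1) → K) (i : Fin s) (j : Fin t) :
    polyGrading K n 1 :=
  linearForm fun k ↦ M (i, j, k)

instance (d : ℕ) : Module.Finite K (polyGrading K n d) :=
  Module.Finite.iff_fg.2 (homogeneousSubmodule_fg _ _ d)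

/-- Multiplication by a linear form. -/
noncomputable def mulForm (d : ℕ) (ℓ : polyGrading K n 1) :
    polyGrading K n d →ₗ[K] polyGrading K n (d + 1) :=
  (LinearMap.mulLeft K ℓ.1).restrict fun f hf ↦ by
    have := SetLike.mul_mem_graded ℓ.2 hf
    rwa [Nat.add_comm 1 d] at this

/-- The elementary pieces of the transpose of a matrix of linear forms. -/
noncomputable def transPiece (d : ℕ) (e : Fin s × Fin t × Fin (n + 1)) :
    (Fin s → polyGrading K n d) →ₗ[K] (Fin t → polyGrading K n (d + 1)) :=
  LinearMap.single K (fun _ ↦ polyGrading K n (d + 1)) e.2.1 ∘ₗ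
    mulForm d ⟨X e.2.2, isHomogeneous_X K _⟩ ∘ₗ LinearMap.proj e.1

/-- The action of the transpose of a matrix of linear forms. -/
noncomputable def transMap (M : Fin s × Fin t × Fin (n + 1) → K) (d : ℕ) :
    (Fin s → polyGrading K n d) →ₗ[K] (Fin t → polyGrading K n (d + 1)) :=
  ∑ e, M e • transPiece d e

lemma transMap_apply (M : Fin s × Fin t × Fin (n + 1) → K) (d : ℕ)
    (u : Fin s → polyGrading K n d) (j : Fin t) :
    (transMap M d u j).1 = ∑ i, (formMatrix M i j).1 * (u i).1 := by
  have h (e : Fin s × Fin t × Fin (n + 1)) : ((M e • transPiece d e) u j).1 =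
      if e.2.1 = j then C (M e) * X e.2.2 * (u e.1).1 else 0 := by
    rw [LinearMap.smul_apply, Pi.smul_apply, Submodule.coe_smul, smul_eq_C_mul]
    change C (M e) * (Pi.single (M := fun _ ↦ polyGrading K n (d + 1)) e.2.1
      (mulForm d ⟨X e.2.2, isHomogeneous_X K _⟩ (u e.1)) j).1 = _
    split_ifs with hj
    · subst hj
      rw [Pi.single_eq_same, mul_assoc]
      rfl
    · rw [Pi.single_eq_of_ne (Ne.symm hj), Submodule.coe_zero, mul_zero]
  rw [transMap, LinearMap.sum_apply, Finset.sum_apply, AddSubmonoidClass.coe_finsetSum]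
  simp only [h]
  rw [Fintype.sum_prod_type]
  refine Finset.sum_congr rfl fun i _ ↦ ?_
  rw [Fintype.sum_prod_type, Finset.sum_eq_single j]
  · simp [formMatrix, linearForm, Finset.sum_mul]
  · intro k _ hk
    simp [hk]
  · exact fun h ↦ (h (Finset.mem_univ _)).elim

lemma transInjective_iff (M : Fin s × Fin t × Fin (n + 1) → K) (d : ℕ) :
    TransInjective (formMatrix M) d ↔ Function.Injective (transMap M d) := by
  rw [injective_iff_map_eq_zero]
  constructor
  · intro h u hu
    have := h (fun i ↦ (u i).1) (fun i ↦ (u i).2) fun j ↦ by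
      rw [← transMap_apply, hu]; rfl
    exact funext fun i ↦ Subtype.ext (congrFun this i)
  · intro h u hu hu'
    let u' (i : Fin s) : polyGrading K n d := ⟨u i, hu i⟩
    have h0 : transMap M d u' = 0 := by
      ext1 j
      apply Subtype.ext
      rw [transMap_apply M d u' j]
      exact hu' j
    have := h u' h0
    exact funext fun i ↦ congrArg Subtype.val (congrFun this i)

lemma transSurjective_iff (M : Fin s × Fin t × Fin (n + 1) → K) (d : ℕ) :
    TransSurjective (formMatrix M) d ↔ Function.Surjective (transMap M d) := by
  constructor
  · intro h w
    obtain ⟨u, hu, huw⟩ := h (fun j ↦ (w j).1) fun j ↦ (w j).2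
    let u' (i : Fin s) : polyGrading K n d := ⟨u i, hu i⟩
    refine ⟨u', ?_⟩
    ext1 j
    apply Subtype.ext
    rw [transMap_apply M d u' j]
    exact huw j
  · intro h w hw
    let w' (j : Fin t) : polyGrading K n (d + 1) := ⟨w j, hw j⟩
    obtain ⟨u, hu⟩ := h w'
    refine ⟨fun i ↦ (u i).1, fun i ↦ (u i).2, fun j ↦ ?_⟩
    rw [← transMap_apply, hu]

/-- Multiplication by a power of x_0 embeds the kernel in degree d into the kernel in degree e. -/
lemma TransInjective.of_le {B : Fin s → Fin t → polyGrading K n 1} {d e : ℕ} (hde : d ≤ e)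
    (h : TransInjective B e) : TransInjective B d := by
  intro u hu hu'
  have := h (fun i ↦ X 0 ^ (e - d) * u i) (fun i ↦ ?_) fun j ↦ ?_
  · refine funext fun i ↦ ?_
    exact (mul_eq_zero.1 (congrFun this i)).resolve_left (pow_ne_zero _ (X_ne_zero _))
  · have h1 := SetLike.mul_mem_graded (isHomogeneous_X_pow (R := K) (0 : Fin (n + 1)) (e - d) :
      _ ∈ polyGrading K n (e - d)) (hu i)
    rwa [Nat.sub_add_cancel hde] at h1
  · have h1 : ∑ i, (B i j).1 * (X 0 ^ (e - d) * u i) = X 0 ^ (e - d) * ∑ i, (B i j).1 * u i := by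
      rw [Finset.mul_sum]
      exact Finset.sum_congr rfl fun i _ ↦ mul_left_comm _ _ _
    rw [h1, hu', mul_zero]

/-- Every monomial of degree d + 2 is a variable times a monomial of degree d + 1, and the map is
linear over polynomials. -/
lemma TransSurjective.succ {B : Fin s → Fin t → polyGrading K n 1} {d : ℕ}
    (h : TransSurjective B d) : TransSurjective B (d + 1) := by
  have hX (a : Fin (n + 1)) {d : ℕ} {f} (hf : f ∈ polyGrading K n d) :
      X a * f ∈ polyGrading K n (d + 1) := by
    have := SetLike.mul_mem_graded (isHomogeneous_X K a : _ ∈ polyGrading K n 1) hf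
    rwa [Nat.add_comm 1 d] at this
  let T : (Fin s → MvPolynomial (Fin (n + 1)) K) →ₗ[K] (Fin t → MvPolynomial (Fin (n + 1)) K) :=
    LinearMap.pi fun j ↦ ∑ i, LinearMap.mulLeft K (B i j).1 ∘ₗ LinearMap.proj i
  have hT (u j) : T u j = ∑ i, (B i j).1 * u i := by
    simp [T, LinearMap.sum_apply]
  let Z := (Submodule.pi Set.univ fun _ ↦ polyGrading K n (d + 1)).map T
  intro w hw
  suffices hZ : w ∈ Z by
    obtain ⟨u, hu, rfl⟩ := hZ
    exact ⟨u, fun i ↦ hu i trivial, fun j ↦ (hT u j).symm⟩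
  rw [← Finset.univ_sum_single w]
  refine sum_mem fun j _ ↦ ?_
  rw [(w j).as_sum, ← LinearMap.single_apply (R := K) (φ := fun _ ↦ MvPolynomial (Fin (n + 1)) K),
    map_sum]
  refine sum_mem fun v hv ↦ ?_
  have hdeg := hw j (mem_support_iff.1 hv)
  obtain ⟨a, ha⟩ : ∃ a, v a ≠ 0 := by
    by_contra! h0
    have : v = 0 := Finsupp.ext h0
    rw [this] at hdeg
    simp at hdeg
  have hva : Finsupp.single a 1 + (v - Finsupp.single a 1) = v :=
    add_tsub_cancel_of_le (Finsupp.single_le_iff.2 (Nat.one_le_iff_ne_zero.2 ha))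
  generalize coeff v (w j) = c
  generalize v - Finsupp.single a 1 = v' at hva
  subst hva
  have hdeg' : v'.degree = d + 1 := by
    have h1 : (Finsupp.single a 1 + v').degree = d + 1 + 1 := by
      rw [Finsupp.degree_eq_weight_one]
      exact hdeg
    rw [map_add, Finsupp.degree_single] at h1
    lia
  obtain ⟨u, hu, huw⟩ := h (Pi.single j (monomial v' c)) fun k ↦ by
    obtain rfl | hk := eq_or_ne k j
    · rw [Pi.single_eq_same]
      exact isHomogeneous_monomial c hdeg'
    · rw [Pi.single_eq_of_ne hk]; exact zero_mem _
  refine ⟨fun i ↦ X a * u i, fun i _ ↦ hX a (hu i), funext fun k ↦ ?_⟩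
  rw [hT]
  have h1 : ∑ i, (B i k).1 * (X a * u i) = X a * ∑ i, (B i k).1 * u i := by
    rw [Finset.mul_sum]
    exact Finset.sum_congr rfl fun i _ ↦ mul_left_comm _ _ _
  rw [h1, huw, LinearMap.single_apply]
  obtain rfl | hk := eq_or_ne k j
  · rw [Pi.single_eq_same, Pi.single_eq_same, X, monomial_mul, one_mul]
  · rw [Pi.single_eq_of_ne hk, Pi.single_eq_of_ne hk, mul_zero]

lemma TransSurjective.of_le {B : Fin s → Fin t → polyGrading K n 1} {d e : ℕ} (hde : d ≤ e)
    (h : TransSurjective B d) : TransSurjective B e := by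
  induction e, hde using Nat.le_induction with
  | base => exact h
  | succ e _ ih => exact ih.succ

/-- The coefficients of the block Hankel matrix with the variables on its diagonals. -/
def hankelCoeff (K : Type u) [Field K] (n k t : ℕ)
    (e : Fin (t + k * n) × Fin t × Fin (n + 1)) : K :=
  if (e.1 : ℕ) = e.2.1 + k * e.2.2 then 1 else 0

lemma sum_formMatrix_hankelCoeff (k t : ℕ) (p : ℕ → MvPolynomial (Fin (n + 1)) K) (j : Fin t) :
    ∑ i, (formMatrix (hankelCoeff K n k t) i j).1 * p i = ∑ a : Fin (n + 1), X a * p (j + k * a) := by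
  simp only [formMatrix, linearForm, hankelCoeff, Finset.sum_mul]
  rw [Finset.sum_comm]
  refine Finset.sum_congr rfl fun a _ ↦ ?_
  have hlt : (j + k * a : ℕ) < t + k * n := by
    have : k * (a : ℕ) ≤ k * n := Nat.mul_le_mul_left _ (by lia)
    have := j.2
    lia
  rw [Finset.sum_eq_single ⟨j + k * a, hlt⟩]
  · simp
  · intro i _ hi
    rw [if_neg, C_0, zero_mul, zero_mul]
    exact fun h ↦ hi (Fin.ext h)
  · exact fun h ↦ (h (Finset.mem_univ _)).elim

lemma transInjective_hankelCoeff {k t d : ℕ} (h : k * (d + 1) ≤ t) :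
    TransInjective (formMatrix (hankelCoeff K n k t)) d := by
  intro u hu hu'
  let p (i : ℕ) : MvPolynomial (Fin (n + 1)) K := if h : i < t + k * n then u ⟨i, h⟩ else 0
  have hp (i : Fin (t + k * n)) : p i = u i := dif_pos i.2
  have := hankel_injective n d t h p (fun i hi ↦ (hp ⟨i, hi⟩).symm ▸ hu ⟨i, hi⟩) fun j hj ↦ by
    rw [← sum_formMatrix_hankelCoeff k t p ⟨j, hj⟩, ← hu' ⟨j, hj⟩]
    simp only [hp]
  exact funext fun i ↦ (hp i).symm.trans (this i i.2)

lemma transSurjective_hankelCoeff {k t d : ℕ} (hk : 1 ≤ k) (h : t ≤ k * (d + 1)) :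
    TransSurjective (formMatrix (hankelCoeff K n k t)) d := by
  intro w hw
  obtain ⟨p, hp, h⟩ := hankel_surjective hk n d t h (fun j ↦ if h : j < t then w ⟨j, h⟩ else 0)
    fun j ↦ by
      by_cases h : j < t
      · simp only [dif_pos h]
        exact hw _
      · simp only [dif_neg h]
        exact isHomogeneous_zero _ _ _
  refine ⟨fun i ↦ p i, fun i ↦ hp i, fun j ↦ ?_⟩
  rw [sum_formMatrix_hankelCoeff k t p j, h j j.2, dif_pos j.2]

/-- A general matrix of linear forms has maximal rank in all degrees. -/
theorem exists_polynomial_maximal_rank (K : Type u) [Field K] (n : ℕ) {k : ℕ} (t : ℕ) (hk : 1 ≤ k) :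
    ∃ F : MvPolynomial (Fin (t + k * n) × Fin t × Fin (n + 1)) K, F ≠ 0 ∧ ∀ M, eval M F ≠ 0 →
      ∀ d, (k * (d + 1) ≤ t → TransInjective (formMatrix M) d) ∧
        (t ≤ k * (d + 1) → TransSurjective (formMatrix M) d) := by
  obtain ⟨F, hF, h1⟩ : ∃ F : MvPolynomial (Fin (t + k * n) × Fin t × Fin (n + 1)) K, F ≠ 0 ∧
      ∀ M, eval M F ≠ 0 → ∀ d, k * (d + 1) ≤ t → TransInjective (formMatrix M) d := by
    by_cases hkt : k ≤ t
    · have hq : 1 ≤ t / k := (Nat.one_le_div_iff hk).2 hkt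
      -- The largest degree with k(d + 1) ≤ t is t/k - 1; injectivity there implies it in all lower
      -- degrees.
      have hinj := (transInjective_iff _ _).1 (transInjective_hankelCoeff (K := K) (n := n)
        (d := t / k - 1) (k := k) (t := t) (by
          rw [Nat.sub_add_cancel hq]; exact Nat.mul_div_le t k))
      obtain ⟨F, hF, h⟩ := exists_polynomial_of_injective _ _ hinj
      refine ⟨F, hF, fun M hM d hd ↦ ((transInjective_iff M _).2 (h M hM)).of_le ?_⟩
      have : d + 1 ≤ t / k := (Nat.le_div_iff_mul_le hk).2 (by rwa [mul_comm])
      lia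
    · exact ⟨1, one_ne_zero, fun M _ d hd ↦ (hkt (le_trans (by nlinarith) hd)).elim⟩
  -- The least degree in which surjectivity is required; for t = 0 truncated subtraction correctly
  -- gives degree 0.
  have hd (d : ℕ) : t ≤ k * (d + 1) ↔ (t - 1) / k ≤ d := by
    rw [← Nat.lt_succ_iff (m := (t - 1) / k), Nat.div_lt_iff_lt_mul hk, Nat.succ_eq_add_one,
      mul_comm k]
    have : 0 < (d + 1) * k := by positivity
    lia
  have hsurj := (transSurjective_iff _ _).1 (transSurjective_hankelCoeff (K := K) (n := n) hk
    ((hd _).2 le_rfl))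
  obtain ⟨G, hG, h2⟩ := exists_polynomial_of_surjective _ _ hsurj
  refine ⟨F * G, mul_ne_zero hF hG, fun M hM d ↦ ?_⟩
  rw [map_mul] at hM
  exact ⟨h1 M (left_ne_zero_of_mul hM) d, fun h ↦
    ((transSurjective_iff M _).2 (h2 M (right_ne_zero_of_mul hM))).of_le ((hd d).1 h)⟩

/-- If the transpose is surjective in some degree, the matrix is injective. -/
lemma TransSurjective.eq_zero {B : Fin s → Fin t → polyGrading K n 1} {d : ℕ}
    (h : TransSurjective B d) {v : Fin t → MvPolynomial (Fin (n + 1)) K}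
    (hv : ∀ i, ∑ j, (B i j).1 * v j = 0) : v = 0 := by
  refine funext fun j ↦ ?_
  obtain ⟨u, -, hu⟩ := h (Pi.single j (X 0 ^ (d + 1))) fun k ↦ by
    obtain rfl | hk := eq_or_ne k j
    · rw [Pi.single_eq_same]; exact isHomogeneous_X_pow _ _
    · rw [Pi.single_eq_of_ne hk]; exact zero_mem _
  -- Pairing v with Bᵀu = x_0^(d+1) e_j gives x_0^(d+1) v_j = ∑ u_i (B v)_i = 0.
  have h1 : ∑ k, (∑ i, (B i k).1 * u i) * v k = 0 := by
    simp only [Finset.sum_mul]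
    rw [Finset.sum_comm]
    refine Finset.sum_eq_zero fun i _ ↦ ?_
    have : ∑ k, (B i k).1 * u i * v k = u i * ∑ k, (B i k).1 * v k := by
      rw [Finset.mul_sum]
      exact Finset.sum_congr rfl fun k _ ↦ by ring
    rw [this, hv, mul_zero]
  simp only [hu] at h1
  rw [Finset.sum_eq_single j (fun k _ hk ↦ by rw [Pi.single_eq_of_ne hk, zero_mul]) (by simp),
    Pi.single_eq_same] at h1
  exact (mul_eq_zero.1 h1).resolve_left (pow_ne_zero _ (X_ne_zero _))

/-- If the transpose is surjective in some degree, the maximal minors have no common zeros. -/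
lemma TransSurjective.exists_minor {B : Fin s → Fin t → polyGrading K n 1} {d : ℕ}
    (h : TransSurjective B d) (x : ProjectiveSpectrum (polyGrading K n)) :
    ∃ f : Fin t → Fin s, Matrix.det (fun a b ↦ (B (f a) b).1) ∉ x.asHomogeneousIdeal.toIdeal := by
  obtain ⟨l, hl⟩ : ∃ l, X l ∉ x.asHomogeneousIdeal.toIdeal := by
    have hx : x ∈ (⊤ : Opens (projSpace K n).toTopCat) := trivial
    rw [← unionOpen_varOpen, unionOpen, Finset.sup_eq_iSup] at hx
    obtain ⟨i, hx⟩ := Opens.mem_iSup.1 hx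
    obtain ⟨-, hx⟩ := Opens.mem_iSup.1 hx
    exact ⟨i, mem_varOpen.1 hx i (by simp)⟩
  by_contra! hf
  have h1 (j : Fin t) : ∃ u : Fin s → MvPolynomial (Fin (n + 1)) K,
      ∀ k, ∑ i, (B i k).1 * u i = (Pi.single j (X l ^ (d + 1)) : Fin t → _) k := by
    obtain ⟨u, -, hu⟩ := h (Pi.single j (X l ^ (d + 1))) fun k ↦ by
      obtain rfl | hk := eq_or_ne k j
      · rw [Pi.single_eq_same]; exact isHomogeneous_X_pow _ _
      · rw [Pi.single_eq_of_ne hk]; exact zero_mem _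
    exact ⟨u, hu⟩
  choose u hu using h1
  -- The vectors u_j solve Bᵀ u_j = x_l^(d+1) e_j, so this matrix is diagonal.
  have h2 : Matrix.det (fun j ↦ ∑ i, u j i • fun k ↦ (B i k).1) = (X l ^ (d + 1)) ^ t := by
    have : (fun j ↦ ∑ i, u j i • fun k ↦ (B i k).1) =
        Matrix.diagonal fun _ : Fin t ↦ (X l : MvPolynomial (Fin (n + 1)) K) ^ (d + 1) := by
      ext1 j; ext1 k
      rw [Matrix.diagonal_apply, Finset.sum_apply]
      have := hu j k
      simp only [Pi.smul_apply, smul_eq_mul, mul_comm (u j _)]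
      rw [this, Pi.single_apply]
      exact if_congr eq_comm rfl rfl
    rw [this, Matrix.det_diagonal]
    simp
  refine hl (x.isPrime.mem_of_pow_mem (d + 1) (x.isPrime.mem_of_pow_mem t ?_))
  rw [← h2]
  -- Multilinearity in the rows, as in the Cauchy-Binet formula, writes this power of x_l as a
  -- combination of the minors. If all of them lay in the prime, so would x_l.
  have h3 := (Matrix.detRowAlternating (n := Fin t) (R := MvPolynomial (Fin (n + 1)) K)).map_sum
    (fun j i ↦ u j i • fun k ↦ (B i k).1)
  refine (congrArg (· ∈ x.asHomogeneousIdeal.toIdeal) h3).mpr (sum_mem fun f _ ↦ ?_)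
  have h4 := (Matrix.detRowAlternating (n := Fin t) (R := MvPolynomial (Fin (n + 1)) K)).map_smul_univ
    (fun j ↦ u j (f j)) (fun j k ↦ (B (f j) k).1)
  exact (congrArg (· ∈ x.asHomogeneousIdeal.toIdeal) h4).mpr (Ideal.mul_mem_left _ _ (hf f))

end Generic

/-! ### Local criteria for exactness of abelian sheaves. -/

section Exactness

variable {X : TopCat.{u}}

lemma app_injective {F G : AbSheaf X} (f : F ⟶ G) [Mono f] (U : Opens X) :
    Function.Injective (f.hom.app (op U)) := by
  have : Mono ((sheafToPresheaf _ _).map f) := inferInstance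
  have : Mono (f.hom.app (op U)) := (NatTrans.mono_iff_mono_app f.hom).1 this (op U)
  exact (AddCommGrpCat.mono_iff_injective _).1 this

lemma mono_of_app_injective {F G : AbSheaf X} (f : F ⟶ G)
    (h : ∀ U : Opens X, Function.Injective (f.hom.app (op U))) : Mono f := by
  have (U : (Opens X)ᵒᵖ) : Mono (f.hom.app U) := (AddCommGrpCat.mono_iff_injective _).2 (h U.unop)
  have : Mono ((sheafToPresheaf _ _).map f) := (NatTrans.mono_iff_mono_app f.hom).2 this
  exact (sheafToPresheaf _ _).mono_of_mono_map this

lemma epi_of_exists_local_lift {F G : AbSheaf X} (f : F ⟶ G)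
    (h : ∀ (U : Opens X) (s : G.obj.obj (op U)), ∀ x ∈ U, ∃ (V : Opens X) (h : V ≤ U)
      (t : F.obj.obj (op V)), x ∈ V ∧ f.hom.app (op V) t = res G h s) : Epi f := by
  refine (Sheaf.isLocallySurjective_iff_epi' AddCommGrpCat.{u} f).1 ⟨fun {U} s x hx ↦ ?_⟩
  obtain ⟨V, hV, t, hx, ht⟩ := h U s x hx
  exact ⟨V, homOfLE hV, ⟨t, ht⟩, hx⟩

/-- Exactness of a short complex of abelian sheaves can be checked locally. -/
lemma shortExact_of_local (S : ShortComplex (AbSheaf X))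
    (hf : ∀ U : Opens X, Function.Injective (S.f.hom.app (op U)))
    (hfg : ∀ (U : Opens X) (s : S.X₂.obj.obj (op U)), S.g.hom.app (op U) s = 0 → ∀ x ∈ U,
      ∃ (V : Opens X) (h : V ≤ U) (t : S.X₁.obj.obj (op V)), x ∈ V ∧
        S.f.hom.app (op V) t = res S.X₂ h s)
    (hg : ∀ (U : Opens X) (s : S.X₃.obj.obj (op U)), ∀ x ∈ U,
      ∃ (V : Opens X) (h : V ≤ U) (t : S.X₂.obj.obj (op V)), x ∈ V ∧
        S.g.hom.app (op V) t = res S.X₃ h s) : S.ShortExact where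
  mono_f := mono_of_app_injective _ hf
  epi_g := epi_of_exists_local_lift _ hg
  exact := by
    rw [S.exact_iff_epi_kernel_lift]
    refine epi_of_exists_local_lift _ fun U s x hx ↦ ?_
    obtain ⟨V, hV, t, hxV, ht⟩ := hfg U ((kernel.ι S.g).hom.app (op U) s)
      (ConcreteCategory.congr_hom (congrArg (fun φ ↦ φ.hom.app (op U)) (kernel.condition S.g)) s)
      x hx
    refine ⟨V, hV, t, hxV, app_injective (kernel.ι S.g) V ?_⟩
    rw [← res_app, ← ht]
    exact ConcreteCategory.congr_hom
      (congrArg (fun φ ↦ φ.hom.app (op V)) (kernel.lift_ι S.g S.f S.zero)) t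

end Exactness

/-! ### Epimorphisms of sheaves of modules are locally surjective. -/

section LocallySurjective

/-- An epimorphism of sheaves of modules is locally surjective. -/
lemma isLocallySurjective_of_epi {C : Type u} [SmallCategory C] {J : GrothendieckTopology C}
    {R : Sheaf J RingCat.{u}} {F G : SheafOfModules.{u} R} (f : F ⟶ G) [Epi f] :
    Presheaf.IsLocallySurjective J ((PresheafOfModules.toPresheaf R.obj).map f.val) := by
  let adj := PresheafOfModules.sheafificationAdjunction.{u} (𝟙 R.obj)
  let f' := (SheafOfModules.forget R ⋙ PresheafOfModules.restrictScalars (𝟙 R.obj)).map f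
  let π := cokernel.π f'
  -- Through the counit isomorphisms the sheafification of f' is f, hence epi. It composes to zero
  -- with the sheafified projection π, which therefore vanishes.
  have h1 : (PresheafOfModules.sheafification.{u} (𝟙 R.obj)).map π = 0 := by
    have h2 := adj.counit.naturality f
    have h3 : Epi (adj.counit.app F ≫ (𝟭 _).map f) := epi_comp _ _
    rw [← h2] at h3
    have h4 : (PresheafOfModules.sheafification.{u} (𝟙 R.obj)).map f' ≫
        (PresheafOfModules.sheafification.{u} (𝟙 R.obj)).map π = 0 := by
      rw [← Functor.map_comp, cokernel.condition, Functor.map_zero]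
    have h5 : Epi ((PresheafOfModules.sheafification.{u} (𝟙 R.obj)).map f') := by
      have := epi_comp (((SheafOfModules.forget R ⋙ PresheafOfModules.restrictScalars (𝟙 R.obj)) ⋙
        PresheafOfModules.sheafification.{u} (𝟙 R.obj)).map f ≫ adj.counit.app G)
        (inv (adj.counit.app G))
      rwa [Category.assoc, IsIso.hom_inv_id, Category.comp_id] at this
    rwa [← cancel_epi ((PresheafOfModules.sheafification.{u} (𝟙 R.obj)).map f'), comp_zero]
  let π' := (PresheafOfModules.toPresheaf R.obj).map π
  -- So the image of every section of G in the presheaf cokernel is locally zero, and by objectwise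
  -- exactness the section lifts locally.
  have h6 : π' ≫ toSheafify J _ = 0 := by
    have h7 : (presheafToSheaf J AddCommGrpCat.{u}).map π' = 0 :=
      congrArg (SheafOfModules.toSheaf R).map h1
    rw [toSheafify_naturality]
    refine (congrArg (toSheafify J _ ≫ ·) (congrArg (sheafToPresheaf J _).map h7)).trans ?_
    exact comp_zero
  refine ⟨fun {U} s ↦ ?_⟩
  refine J.superset_covering ?_ (Presheaf.equalizerSieve_mem J (toSheafify J _)
    (π'.app (op U) s) 0 ?_)
  · intro V i hi
    have h8 : π'.app (op V) (G.val.presheaf.map i.op s) = 0 :=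
      (ConcreteCategory.congr_hom (π'.naturality i.op) s).trans
        (hi.trans (map_zero (((PresheafOfModules.toPresheaf R.obj).obj (cokernel f')).map i.op).hom))
    have h9 := ((ShortComplex.exact_cokernel f').map
      (PresheafOfModules.evaluation R.obj (op V)))
    rw [ShortComplex.moduleCat_exact_iff] at h9
    exact h9 _ h8
  · exact (ConcreteCategory.congr_hom (congrArg (fun φ ↦ φ.app (op U)) h6) s).trans
      (map_zero ((toSheafify J ((PresheafOfModules.toPresheaf R.obj).obj (cokernel f'))).app (op U)).hom).symm

end LocallySurjective

/-! ### Restriction and local lifts for sheaves of modules. -/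

section ModuleSheaves

variable {X : Scheme.{u}}

/-- Restriction of sections of a sheaf of modules. -/
noncomputable abbrev mres (F : X.Modules) {U V : X.Opens} (h : V ≤ U) : Γ(F, U) →+ Γ(F, V) :=
  (F.presheaf.map (homOfLE h).op).hom

lemma mres_mres (F : X.Modules) {U V W : X.Opens} (h : V ≤ U) (h' : W ≤ V) (s : Γ(F, U)) :
    mres F h' (mres F h s) = mres F (h'.trans h) s := map_map_apply F h h' s

lemma mres_self (F : X.Modules) {U : X.Opens} (h : U ≤ U) (s : Γ(F, U)) : mres F h s = s :=
  ConcreteCategory.congr_hom (F.presheaf.map_id (op U)) s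

lemma mres_smul (F : X.Modules) {U V : X.Opens} (h : V ≤ U) (r : Γ(X, U)) (s : Γ(F, U)) :
    mres F h (r • s) = rres h r • mres F h s := Scheme.Modules.map_smul ..

lemma mres_app {F G : X.Modules} (f : F ⟶ G) {U V : X.Opens} (h : V ≤ U) (s : Γ(F, U)) :
    mres G h (f.app U s) = f.app V (mres F h s) :=
  (ConcreteCategory.congr_hom (f.mapPresheaf.naturality (homOfLE h).op) s).symm

/-- An epimorphism of sheaves of modules is locally surjective. -/
lemma exists_local_lift_of_epi {F G : X.Modules} (f : F ⟶ G) [hf : Epi f] {U : X.Opens}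
    (s : Γ(G, U)) {x : X} (hx : x ∈ U) :
    ∃ (V : X.Opens) (h : V ≤ U) (t : Γ(F, V)), x ∈ V ∧ f.app V t = mres G h s := by
  have : Epi (C := SheafOfModules X.ringCatSheaf) f := hf
  obtain ⟨V, i, ⟨t, ht⟩, hxV⟩ := (isLocallySurjective_of_epi (R := X.ringCatSheaf) f).imageSieve_mem s x hx
  exact ⟨V, i.le, t, hxV, ht⟩

end ModuleSheaves

/-! ### Sheafification is locally bijective. -/

section Sheafify

variable {X : TopCat.{u}} (P : (Opens X)ᵒᵖ ⥤ AddCommGrpCat.{u})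

lemma isLocallySurjective_toSheafify : Presheaf.IsLocallySurjective (Opens.grothendieckTopology X)
    (CategoryTheory.toSheafify (Opens.grothendieckTopology X) P) := inferInstance

lemma isLocallyInjective_toSheafify : Presheaf.IsLocallyInjective (Opens.grothendieckTopology X)
    (CategoryTheory.toSheafify (Opens.grothendieckTopology X) P) := inferInstance

end Sheafify

/-! ### Tensor products with a sheaf that has a local basis. -/

section Tensor

open TensorProduct

variable {X : Scheme.{u}} (F G : X.Modules)

/-- The abelian sheaf underlying the tensor product of two sheaves of modules. -/
noncomputable abbrev tensorAb : AbSheaf X.toTopCat :=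
  (SheafOfModules.toSheaf X.ringCatSheaf).obj (tensor F G)

/-- The presheaf tensor product. -/
noncomputable abbrev preTensor : X.PresheafOfModules :=
  PresheafOfModules.Monoidal.tensorObj (R := X.presheaf) F.val G.val

/-- The map from the presheaf tensor product to the tensor product. -/
noncomputable def toTensor : (preTensor F G).presheaf ⟶ (tensorAb F G).obj :=
  CategoryTheory.toSheafify (Opens.grothendieckTopology X) (preTensor F G).presheaf

/-- The map `F(W) ⊗ G(W) → (F ⊗ G)(W)`. -/
noncomputable def tmulHom (W : X.Opens) :
    Γ(F, W) ⊗[Γ(X, W)] Γ(G, W) →+ (tensorAb F G).obj.obj (op W) :=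
  ((toTensor F G).app (op W)).hom

variable {F G}

lemma res_tmulHom {U V : X.Opens} (h : V ≤ U) (m : Γ(F, U)) (g : Γ(G, U)) :
    res (tensorAb F G) h (tmulHom F G U (m ⊗ₜ g)) = tmulHom F G V (mres F h m ⊗ₜ mres G h g) :=
  (ConcreteCategory.congr_hom ((toTensor F G).naturality (homOfLE h).op) (m ⊗ₜ[Γ(X, U)] g)).symm

lemma exists_tmulHom_eq {U : X.Opens} (z : (tensorAb F G).obj.obj (op U)) {x : X} (hx : x ∈ U) :
    ∃ (V : X.Opens) (h : V ≤ U) (p : Γ(F, V) ⊗[Γ(X, V)] Γ(G, V)), x ∈ V ∧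
      tmulHom F G V p = res (tensorAb F G) h z := by
  have : Presheaf.IsLocallySurjective (Opens.grothendieckTopology X) (toTensor F G) :=
    isLocallySurjective_toSheafify (X := X.toTopCat) _
  obtain ⟨V, i, ⟨t, ht⟩, hxV⟩ := Presheaf.imageSieve_mem (Opens.grothendieckTopology X)
    (toTensor F G) z x hx
  exact ⟨V, i.le, t, hxV, ht⟩

lemma exists_tmul_eq_zero {U : X.Opens} (m : Γ(F, U)) (g : Γ(G, U))
    (h : tmulHom F G U (m ⊗ₜ g) = 0) {x : X} (hx : x ∈ U) :
    ∃ (V : X.Opens) (h : V ≤ U), x ∈ V ∧ mres F h m ⊗ₜ[Γ(X, V)] mres G h g = 0 := by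
  have : Presheaf.IsLocallyInjective (Opens.grothendieckTopology X) (toTensor F G) :=
    isLocallyInjective_toSheafify (X := X.toTopCat) _
  obtain ⟨V, i, ht, hxV⟩ := Presheaf.equalizerSieve_mem (Opens.grothendieckTopology X)
    (toTensor F G) (X := op U) (m ⊗ₜ[Γ(X, U)] g) 0 (h.trans (map_zero (tmulHom F G U)).symm) x hx
  exact ⟨V, i.le, hxV, ht.trans (map_zero ((preTensor F G).presheaf.map i.op).hom)⟩

/-- `q` is a basis of `G` over `U`. -/
def IsFrame {U : X.Opens} (q : Γ(G, U)) : Prop :=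
  ∀ (V : X.Opens) (h : V ≤ U), Function.Bijective fun r : Γ(X, V) ↦ r • mres G h q

lemma IsFrame.exists_smul {U : X.Opens} {q : Γ(G, U)} (hq : IsFrame q) {V : X.Opens} (h : V ≤ U)
    (g : Γ(G, V)) : ∃ r : Γ(X, V), r • mres G h q = g := (hq V h).2 g

lemma IsFrame.mres {U : X.Opens} {q : Γ(G, U)} (hq : IsFrame q) {V : X.Opens} (h : V ≤ U) :
    IsFrame (mres G h q) := by
  intro W hW
  simp only [mres_mres]
  exact hq W (hW.trans h)

/-- The coefficient of the second factor with respect to q moves to the first factor. -/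
lemma IsFrame.exists_tmul {U : X.Opens} {q : Γ(G, U)} (hq : IsFrame q)
    (p : Γ(F, U) ⊗[Γ(X, U)] Γ(G, U)) : ∃ m, p = m ⊗ₜ q := by
  induction p with
  | zero => exact ⟨0, (zero_tmul _ _).symm⟩
  | tmul m g =>
    obtain ⟨r, rfl⟩ := hq.exists_smul le_rfl g
    exact ⟨r • m, by rw [mres_self, smul_tmul]⟩
  | add a b ha hb =>
    obtain ⟨m, rfl⟩ := ha
    obtain ⟨m', rfl⟩ := hb
    exact ⟨m + m', (add_tmul _ _ _).symm⟩

/-- The coordinate isomorphism attached to q turns m ⊗ q into m ⊗ 1. -/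
lemma IsFrame.eq_zero_of_tmul {U : X.Opens} {q : Γ(G, U)} (hq : IsFrame q)
    {m : Γ(F, U)} (h : m ⊗ₜ[Γ(X, U)] q = 0) : m = 0 := by
  have hb := hq U le_rfl
  simp only [mres_self] at hb
  let e := LinearEquiv.ofBijective (LinearMap.toSpanSingleton Γ(X, U) Γ(G, U) q) hb
  have h1 : e.symm q = 1 := by
    rw [LinearEquiv.symm_apply_eq]
    exact (one_smul _ _).symm
  have h2 := congrArg (TensorProduct.rid Γ(X, U) Γ(F, U) ∘
    LinearMap.lTensor Γ(F, U) e.symm.toLinearMap) h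
  simpa [h1] using h2

/-- If `q` is a basis of `G`, sections of `F ⊗ G` are locally of the form `m ⊗ q`. -/
lemma IsFrame.exists_tmulHom {U : X.Opens} {q : Γ(G, U)} (hq : IsFrame q)
    (z : (tensorAb F G).obj.obj (op U)) {x : X} (hx : x ∈ U) :
    ∃ (V : X.Opens) (h : V ≤ U) (m : Γ(F, V)), x ∈ V ∧
      tmulHom F G V (m ⊗ₜ Steiner.mres G h q) = res (tensorAb F G) h z := by
  obtain ⟨V, hV, p, hx, hp⟩ := exists_tmulHom_eq z hx
  obtain ⟨m, rfl⟩ := (hq.mres hV).exists_tmul p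
  exact ⟨V, hV, m, hx, hp⟩

/-- If `q` is a basis of `G`, the map `m ↦ m ⊗ q` is injective. -/
lemma IsFrame.eq_zero_of_tmulHom {U : X.Opens} {q : Γ(G, U)} (hq : IsFrame q)
    {m : Γ(F, U)} (h : tmulHom F G U (m ⊗ₜ q) = 0) : m = 0 := by
  have h1 (x : U) := exists_tmul_eq_zero m q h x.2
  choose V hV hx h0 using h1
  refine eq_of_res_eq ((SheafOfModules.toSheaf X.ringCatSheaf).obj F) V hV
    (fun x hx' ↦ Opens.mem_iSup.2 ⟨⟨x, hx'⟩, hx _⟩) m 0 fun x ↦ ?_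
  exact ((hq.mres (hV x)).eq_zero_of_tmul (h0 x)).trans (map_zero (Steiner.mres F (hV x))).symm

/-- Multiplication by a global section `m` of `F`, as a map `G ⟶ F ⊗ G`. -/
noncomputable def tensorLeft (m : Γ(F, ⊤)) :
    (SheafOfModules.toSheaf X.ringCatSheaf).obj G ⟶ tensorAb F G where
  hom :=
    { app := fun W ↦ AddCommGrpCat.ofHom
        ((tmulHom F G W.unop).comp
          (TensorProduct.mk Γ(X, W.unop) Γ(F, W.unop) Γ(G, W.unop)
            (Steiner.mres F le_top m)).toAddMonoidHom)
      naturality := fun U V i ↦ by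
        ext g
        have := res_tmulHom (F := F) (G := G) i.unop.le (Steiner.mres F le_top m) g
        rw [mres_mres] at this
        exact this.symm }

lemma sum_tmulHom_smul {ι : Type*} [Fintype ι] {U : X.Opens} (r : ι → Γ(X, U)) (m : ι → Γ(F, U))
    (q : Γ(G, U)) :
    ∑ i, tmulHom F G U (m i ⊗ₜ (r i • q)) = tmulHom F G U ((∑ i, r i • m i) ⊗ₜ q) := by
  rw [TensorProduct.sum_tmul, map_sum]
  exact Finset.sum_congr rfl fun i _ ↦ congrArg _ (TensorProduct.smul_tmul (r i) (m i) q).symm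

lemma res_sum_tensorLeft {ι : Type*} [Fintype ι] (m : ι → Γ(F, ⊤)) {U V : X.Opens} (h : V ≤ U)
    (c : ι → Γ(G, U)) :
    res (tensorAb F G) h (∑ i, (tensorLeft (G := G) (m i)).hom.app (op U) (c i)) =
      ∑ i, tmulHom F G V (Steiner.mres F le_top (m i) ⊗ₜ Steiner.mres G h (c i)) :=
  (map_sum _ _ _).trans (Finset.sum_congr rfl fun i _ ↦ res_app (tensorLeft (m i)) h (c i))

end Tensor

/-! ### Sections of finite direct sums of abelian sheaves. -/

section BiproductSections

attribute [local instance] Abelian.hasFiniteBiproducts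

variable {X : TopCat.{u}}

/-- The action of morphisms of abelian sheaves on sections. -/
noncomputable def onSections (U : Opens X) (F G : AbSheaf X) :
    (F ⟶ G) →+ (F.obj.obj (op U) →+ G.obj.obj (op U)) where
  toFun f := (f.hom.app (op U)).hom
  map_zero' := rfl
  map_add' _ _ := rfl

variable {m : ℕ} (A : Fin m → AbSheaf X) {U : Opens X}

/-- A section of a direct sum of sheaves, given by its components. -/
noncomputable def biprodSection (a : ∀ i, (A i).obj.obj (op U)) : (⨁ A).obj.obj (op U) :=
  ∑ i, (biproduct.ι A i).hom.app (op U) (a i)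

variable {A}

lemma biproduct_total_app (s : (⨁ A).obj.obj (op U)) :
    biprodSection A (fun i ↦ (biproduct.π A i).hom.app (op U) s) = s := by
  have h := congrArg (onSections U _ _) (biproduct.total (f := A))
  rw [map_sum] at h
  have h' := DFunLike.congr_fun h s
  rw [AddMonoidHom.finsetSum_apply] at h'
  exact h'

lemma π_biprodSection (a : ∀ i, (A i).obj.obj (op U)) (i : Fin m) :
    (biproduct.π A i).hom.app (op U) (biprodSection A a) = a i := by
  refine (map_sum (onSections U _ _ (biproduct.π A i)) _ _).trans ?_
  rw [Finset.sum_eq_single i]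
  · exact ConcreteCategory.congr_hom
      (congrArg (fun φ ↦ φ.hom.app (op U)) (biproduct.ι_π_self A i)) (a i)
  · intro j _ hj
    exact ConcreteCategory.congr_hom
      (congrArg (fun φ ↦ φ.hom.app (op U)) (biproduct.ι_π_ne A hj)) (a j)
  · exact fun h ↦ (h (Finset.mem_univ _)).elim

lemma biprodSection_ext {s s' : (⨁ A).obj.obj (op U)}
    (h : ∀ i, (biproduct.π A i).hom.app (op U) s = (biproduct.π A i).hom.app (op U) s') :
    s = s' := by
  rw [← biproduct_total_app s, ← biproduct_total_app s']
  exact congrArg _ (funext h)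

lemma biprodSection_zero : biprodSection A (0 : ∀ i, (A i).obj.obj (op U)) = 0 :=
  Finset.sum_eq_zero fun _ _ ↦ map_zero _

lemma desc_biprodSection {G : AbSheaf X} (φ : ∀ i, A i ⟶ G) (a : ∀ i, (A i).obj.obj (op U)) :
    (biproduct.desc φ).hom.app (op U) (biprodSection A a) = ∑ i, (φ i).hom.app (op U) (a i) := by
  refine (map_sum (onSections U _ _ (biproduct.desc φ)) _ _).trans ?_
  exact Finset.sum_congr rfl fun i _ ↦ ConcreteCategory.congr_hom
      (congrArg (fun φ ↦ φ.hom.app (op U)) (biproduct.ι_desc φ i)) (a i)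

lemma π_lift_app {G : AbSheaf X} (φ : ∀ i, G ⟶ A i) (g : G.obj.obj (op U)) (i : Fin m) :
    (biproduct.π A i).hom.app (op U) ((biproduct.lift φ).hom.app (op U) g) =
      (φ i).hom.app (op U) g :=
  ConcreteCategory.congr_hom (congrArg (fun φ ↦ φ.hom.app (op U)) (biproduct.lift_π φ i)) g

lemma π_matrix_biprodSection {k : ℕ} {B : Fin k → AbSheaf X} (φ : ∀ i j, A i ⟶ B j)
    (a : ∀ i, (A i).obj.obj (op U)) (j : Fin k) :
    (biproduct.π B j).hom.app (op U) ((biproduct.matrix φ).hom.app (op U) (biprodSection A a)) =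
      ∑ i, (φ i j).hom.app (op U) (a i) := by
  refine (ConcreteCategory.congr_hom (congrArg (fun φ ↦ φ.hom.app (op U))
    (biproduct.matrix_π φ j)) (biprodSection A a)).trans ?_
  exact desc_biprodSection _ a

lemma res_biprodSection {V : Opens X} (h : V ≤ U) (a : ∀ i, (A i).obj.obj (op U)) :
    res (⨁ A) h (biprodSection A a) = biprodSection A fun i ↦ res (A i) h (a i) := by
  refine biprodSection_ext fun i ↦ ?_
  rw [← res_app, π_biprodSection, π_biprodSection]

end BiproductSections

/-! ### Products of sections of twisting sheaves, and local left inverses. -/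

section Twists

variable {A σ : Type u} [CommRing A] [SetLike σ A] [AddSubgroupClass σ A]
  {𝒜 : ℕ → σ} [GradedRing 𝒜]

/-- The values of a regular function in the ungraded localizations. -/
noncomputable def regVal {W : Opens (ProjectiveSpectrum 𝒜)} :
    Γ(Proj 𝒜, W) →+* (∀ x : W, LocAt 𝒜 x.1) where
  toFun r x := (r.1 x).val
  map_one' := funext fun _ ↦ HomogeneousLocalization.val_one
  map_zero' := funext fun _ ↦ HomogeneousLocalization.val_zero
  map_mul' _ _ := funext fun _ ↦ HomogeneousLocalization.val_mul _ _
  map_add' _ _ := funext fun _ ↦ HomogeneousLocalization.val_add _ _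

lemma regVal_injective {W : Opens (ProjectiveSpectrum 𝒜)} :
    Function.Injective (regVal (𝒜 := 𝒜) (W := W)) := fun _ _ h ↦
  Subtype.ext <| funext fun x ↦ HomogeneousLocalization.val_injective _ (congrFun h x)

lemma exists_regVal_eq {W : Opens (ProjectiveSpectrum 𝒜)} (f : twistSections 𝒜 0 W) :
    ∃ r, regVal r = f.1 := by
  obtain ⟨r, hr⟩ := exists_structureSheaf f.2
  exact ⟨r, funext hr⟩

/-- The product of sections of two twisting sheaves. -/
def twistProd {W : Opens (ProjectiveSpectrum 𝒜)} {d e k : ℤ} (h : k = d + e)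
    (f : twistSections 𝒜 d W) (g : twistSections 𝒜 e W) : twistSections 𝒜 k W :=
  ⟨f.1 * g.1, h ▸ f.2.mul g.2⟩

/-- A homogeneous element as a section of a twisting sheaf. -/
def twistConst {m : ℕ} {d : ℤ} (h : d = m) (ℓ : 𝒜 m) (W : Opens (ProjectiveSpectrum 𝒜)) :
    twistSections 𝒜 d W :=
  ⟨fun x ↦ algebraMap A (LocAt 𝒜 x.1) ℓ, h ▸ isTwistSection_const ℓ.2 W⟩

/-- Restriction of sections of the twisting sheaves. -/
def tres {d : ℤ} {W W' : Opens (ProjectiveSpectrum 𝒜)} (h : W' ≤ W) (f : twistSections 𝒜 d W) :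
    twistSections 𝒜 d W' := ⟨fun x ↦ f.1 ⟨x.1, h x.2⟩, f.2.res h⟩

/-- Multiplication by an element of degree `1`, as a map of sheaves of abelian groups. -/
noncomputable def mulTwist (ℓ : 𝒜 1) {d e : ℤ} (h : e = d + 1) : twistAb 𝒜 d ⟶ twistAb 𝒜 e :=
  (SheafOfModules.toSheaf _).map (twistMul ℓ (by simpa using h))

lemma isFrame_twistGen {m : ℕ} {ℓ : A} (hℓ : ℓ ∈ 𝒜 m) (a : ℤ)
    {U : Opens (ProjectiveSpectrum 𝒜)} (hU : U ≤ ProjectiveSpectrum.basicOpen 𝒜 ℓ) {d : ℤ}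
    (hd : d = a * m) :
    IsFrame (X := Proj 𝒜) (G := twistingSheaf 𝒜 d) (twistGen 𝒜 hℓ a hU hd) := fun _ h ↦
  smulTwistGen_bijective hℓ a (h.trans hU) hd

/-- A left inverse of a matrix of elements of degree `1` over an open set. -/
def HasLeftInverse {s t : ℕ} (B : Fin s → Fin t → 𝒜 1) (W : Opens (ProjectiveSpectrum 𝒜)) : Prop :=
  ∃ ρ : Fin t → Fin s → twistSections 𝒜 (-1) W, ∀ (x : W) (j k : Fin t),
    ∑ i, (ρ j i).1 x * algebraMap A (LocAt 𝒜 x.1) (B i k) = if j = k then 1 else 0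

lemma HasLeftInverse.eq_zero {s t : ℕ} {B : Fin s → Fin t → 𝒜 1} {W : Opens (ProjectiveSpectrum 𝒜)}
    (h : HasLeftInverse B W) {x : W} {b : Fin t → LocAt 𝒜 x.1}
    (hb : ∀ i, ∑ j, algebraMap A (LocAt 𝒜 x.1) (B i j) * b j = 0) : b = 0 := by
  obtain ⟨ρ, hρ⟩ := h
  ext1 j
  have h1 : ∑ k, (∑ i, (ρ j i).1 x * algebraMap A (LocAt 𝒜 x.1) (B i k)) * b k = 0 := by
    simp only [Finset.sum_mul]
    rw [Finset.sum_comm]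
    refine Finset.sum_eq_zero fun i _ ↦ ?_
    rw [← mul_zero ((ρ j i).1 x), ← hb i, Finset.mul_sum]
    exact Finset.sum_congr rfl fun k _ ↦ mul_assoc _ _ _
  simpa [hρ] using h1

end Twists

/-! ### The twisted presentation 𝒪(d)^t → 𝒪(d+1)^s → V(d+1). -/

section Presentation

attribute [local instance] Abelian.hasFiniteBiproducts

variable {A σ : Type u} [CommRing A] [SetLike σ A] [AddSubgroupClass σ A]
  {𝒜 : ℕ → σ} [GradedRing 𝒜] {s t : ℕ}

/-- Restriction of global sections. -/
noncomputable abbrev glob {X : Scheme.{u}} {F : X.Modules} (m : Γ(F, ⊤)) (U : X.Opens) : Γ(F, U) :=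
  mres F le_top m

/-- The sheaf of modules `V` on `Proj 𝒜` is generated by its global sections `e`, with relations
given by the columns of the matrix `B`. -/
structure IsPresentedBy (V : (Proj 𝒜).Modules) (e : Fin s → Γ(V, ⊤)) (B : Fin s → Fin t → 𝒜 1) :
    Prop where
  exists_local : ∀ {U : (Proj 𝒜).Opens} (v : Γ(V, U)) {x : Proj 𝒜}, x ∈ U →
    ∃ (W : (Proj 𝒜).Opens) (h : W ≤ U) (c : Fin s → Γ(Proj 𝒜, W)), x ∈ W ∧
      ∑ i, c i • glob (e i) W = mres V h v
  sum_eq_zero_iff : ∀ {U : (Proj 𝒜).Opens} (c : Fin s → Γ(Proj 𝒜, U)),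
    ∑ i, c i • glob (e i) U = 0 ↔
      ∃ b : Fin t → twistSections 𝒜 (-1) U, ∀ i
        (x : (U : Opens (ProjectiveSpectrum 𝒜))), regVal (c i) x = ∑ j, algebraMap A (LocAt 𝒜 x.1) (B i j) * (b j).1 x

variable {V : (Proj 𝒜).Modules} {e : Fin s → Γ(V, ⊤)} {B : Fin s → Fin t → 𝒜 1}

variable (𝒜) in
/-- Locally on `Proj 𝒜` there are elements of degree one that do not vanish. -/
def HasDegreeOneCover : Prop :=
  ∀ x : ProjectiveSpectrum 𝒜, ∃ ℓ ∈ 𝒜 1, x ∈ ProjectiveSpectrum.basicOpen 𝒜 ℓ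

/-- The section of `𝒪(d)` with coordinate `r` with respect to `ℓ ^ d`. -/
noncomputable def ofCoord {ℓ : A} (hℓ : ℓ ∈ 𝒜 1) (d : ℤ) {U : Opens (ProjectiveSpectrum 𝒜)}
    (hU : U ≤ ProjectiveSpectrum.basicOpen 𝒜 ℓ) (r : Γ(Proj 𝒜, U)) : twistSections 𝒜 d U :=
  smulTwistGen 𝒜 hℓ d hU (by simp) r

lemma ofCoord_val {ℓ : A} (hℓ : ℓ ∈ 𝒜 1) (d : ℤ) {U : Opens (ProjectiveSpectrum 𝒜)}
    (hU : U ≤ ProjectiveSpectrum.basicOpen 𝒜 ℓ) (r : Γ(Proj 𝒜, U)) (x : U) :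
    (ofCoord hℓ d hU r).1 x =
      regVal r x * ((locUnit ℓ x.1 (hU x.2) ^ d : (LocAt 𝒜 x.1)ˣ) : LocAt 𝒜 x.1) := rfl

lemma exists_ofCoord_eq {ℓ : A} (hℓ : ℓ ∈ 𝒜 1) (d : ℤ) {U : Opens (ProjectiveSpectrum 𝒜)}
    (hU : U ≤ ProjectiveSpectrum.basicOpen 𝒜 ℓ) (f : twistSections 𝒜 d U) :
    ∃ r : Γ(Proj 𝒜, U), ofCoord hℓ d hU r = f :=
  (smulTwistGen_bijective hℓ d hU (by simp)).2 f

lemma sum_tmulHom_ofCoord {ℓ : A} (hℓ : ℓ ∈ 𝒜 1) (d : ℤ) {U : (Proj 𝒜).Opens}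
    (hU : U ≤ ProjectiveSpectrum.basicOpen 𝒜 ℓ) (r : Fin s → Γ(Proj 𝒜, U)) (m : Fin s → Γ(V, U)) :
    ∑ i, tmulHom V (twistingSheaf 𝒜 d) U (m i ⊗ₜ ofCoord hℓ d hU (r i)) =
      tmulHom V (twistingSheaf 𝒜 d) U ((∑ i, r i • m i) ⊗ₜ twistGen 𝒜 hℓ d hU (by simp)) :=
  sum_tmulHom_smul (G := twistingSheaf 𝒜 d) r m _

section

variable {ℓ : A} (hℓ : ℓ ∈ 𝒜 1) {d d' : ℤ} (h : d' = d + 1) {U : Opens (ProjectiveSpectrum 𝒜)}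
  (hU : U ≤ ProjectiveSpectrum.basicOpen 𝒜 ℓ) (r : Γ(Proj 𝒜, U)) (a : Fin t → 𝒜 1)

include hℓ h

lemma exists_ofCoord_eq_sum (b : Fin t → twistSections 𝒜 (-1) U) :
    ∃ b' : Fin t → twistSections 𝒜 d U, ∀ j x, (b' j).1 x = (b j).1 x *
      ((locUnit ℓ x.1 (hU x.2) ^ d' : (LocAt 𝒜 x.1)ˣ) : LocAt 𝒜 x.1) :=
  ⟨fun j ↦ twistProd (by lia) (b j) (twistGen 𝒜 hℓ d' hU (d := d') (by simp)), fun _ _ ↦ rfl⟩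

lemma exists_regVal_eq_sum (b : Fin t → twistSections 𝒜 d U) :
    ∃ b' : Fin t → twistSections 𝒜 (-1) U, ∀ j x, (b j).1 x = (b' j).1 x *
      ((locUnit ℓ x.1 (hU x.2) ^ d' : (LocAt 𝒜 x.1)ˣ) : LocAt 𝒜 x.1) := by
  refine ⟨fun j ↦ twistProd (by lia) (b j) (twistGen 𝒜 hℓ (-d') hU (d := -d') (by simp)),
    fun j x ↦ ?_⟩
  change _ = (b j).1 x * ((locUnit ℓ x.1 (hU x.2) ^ (-d') : (LocAt 𝒜 x.1)ˣ) : LocAt 𝒜 x.1) * _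
  rw [mul_assoc, ← Units.val_mul, ← zpow_add, neg_add_cancel, zpow_zero, Units.val_one, mul_one]

omit h in
lemma ofCoord_eq_sum_iff {b b' : Fin t → ∀ x : U, LocAt 𝒜 x.1} (hb : ∀ j x, b j x = b' j x *
      ((locUnit ℓ x.1 (hU x.2) ^ d' : (LocAt 𝒜 x.1)ˣ) : LocAt 𝒜 x.1)) (x : U) :
    (ofCoord hℓ d' hU r).1 x = ∑ j, algebraMap A (LocAt 𝒜 x.1) (a j) * b j x ↔
      regVal r x = ∑ j, algebraMap A (LocAt 𝒜 x.1) (a j) * b' j x := by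
  simp only [ofCoord_val, hb, ← mul_assoc]
  rw [← Finset.sum_mul, Units.mul_left_inj]

end

/-- On D(ℓ) the power ℓ^d' is a basis of 𝒪(d'); taking coordinates reduces the relations of the
twist to those of V. -/
lemma sum_tmulHom_eq_zero_iff (hV : IsPresentedBy V e B) {ℓ : A} (hℓ : ℓ ∈ 𝒜 1) {d d' : ℤ}
    (h : d' = d + 1) {U : (Proj 𝒜).Opens} (hU : U ≤ ProjectiveSpectrum.basicOpen 𝒜 ℓ)
    (c : Fin s → twistSections 𝒜 d' U) :
    ∑ i, tmulHom V (twistingSheaf 𝒜 d') U (glob (e i) U ⊗ₜ c i) = 0 ↔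
      ∃ b : Fin t → twistSections 𝒜 d U, ∀ i (x : (U : Opens (ProjectiveSpectrum 𝒜))),
        (c i).1 x = ∑ j, algebraMap A (LocAt 𝒜 x.1) (B i j) * (b j).1 x := by
  choose r hr using fun i ↦ exists_ofCoord_eq hℓ d' hU (c i)
  obtain rfl := funext hr
  have hsum := sum_tmulHom_ofCoord hℓ d' hU r fun i ↦ glob (e i) U
  have hq := isFrame_twistGen hℓ d' hU (d := d') (by simp)
  constructor
  · intro h0
    obtain ⟨b, hb⟩ := (hV.sum_eq_zero_iff r).1 (hq.eq_zero_of_tmulHom (hsum.symm.trans h0))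
    obtain ⟨b', hb'⟩ := exists_ofCoord_eq_sum hℓ h hU b
    exact ⟨b', fun i x ↦ (ofCoord_eq_sum_iff hℓ hU (r i) (B i) hb' x).2 (hb i x)⟩
  · rintro ⟨b, hb⟩
    obtain ⟨b', hb'⟩ := exists_regVal_eq_sum hℓ h hU b
    have h0 := (hV.sum_eq_zero_iff r).2 ⟨b', fun i x ↦
      (ofCoord_eq_sum_iff hℓ hU (r i) (B i) hb' x).1 (hb i x)⟩
    exact hsum.trans ((congrArg (fun m ↦ tmulHom V (twistingSheaf 𝒜 d') U (m ⊗ₜ _)) h0).trans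
        ((congrArg _ (TensorProduct.zero_tmul _ _)).trans (map_zero _)))

/-- The multiple of column j of the matrix by g is the relation with coefficient vector g e_j. This
is checked on the sets D(ℓ), which cover. -/
lemma mulTwist_tensorLeft_sum (hA : HasDegreeOneCover 𝒜) (hV : IsPresentedBy V e B) {d d' : ℤ}
    (h : d' = d + 1) (j : Fin t) :
    ∑ i, mulTwist (B i j) h ≫ tensorLeft (G := twistingSheaf 𝒜 d') (e i) = 0 := by
  refine Sheaf.hom_ext (NatTrans.ext (funext fun U ↦ ?_))
  ext (g : twistSections 𝒜 d U.unop)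
  refine eq_of_res_eq (tensorAb V (twistingSheaf 𝒜 d'))
    (fun ℓ : 𝒜 1 ↦ U.unop ⊓ ProjectiveSpectrum.basicOpen 𝒜 ℓ.1) (W := U.unop) (fun _ ↦ inf_le_left)
    (fun x hx ↦ ?_) _ _ fun ℓ ↦ ?_
  · obtain ⟨ℓ, hℓ, hxℓ⟩ := hA x
    exact Opens.mem_iSup.2 ⟨⟨ℓ, hℓ⟩, hx, hxℓ⟩
  · let W : (Proj 𝒜).Opens := U.unop ⊓ ProjectiveSpectrum.basicOpen 𝒜 ℓ.1
    let g' : twistSections 𝒜 d W := tres inf_le_left g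
    have h0 := (sum_tmulHom_eq_zero_iff hV ℓ.2 h (U := W) inf_le_right (fun i ↦
      (mulTwist (B i j) h).hom.app (op W) g')).2 ⟨Pi.single j g', fun i x ↦ ?_⟩
    · refine (res_app _ _ _).trans (Eq.trans ?_ (h0.trans (map_zero _).symm))
      refine (DFunLike.congr_fun (map_sum (onSections W (twistAb 𝒜 d)
        (tensorAb V (twistingSheaf 𝒜 d'))) _ _) (res (twistAb 𝒜 d) inf_le_left g)).trans ?_
      exact AddMonoidHom.finsetSum_apply _ _ _
    · rw [Finset.sum_eq_single j, Pi.single_eq_same]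
      · rfl
      · intro k _ hk
        rw [Pi.single_eq_of_ne hk]
        exact mul_zero _
      · exact fun h ↦ (h (Finset.mem_univ _)).elim

variable (V e B) in
/-- The complex `𝒪(d)^t ⟶ 𝒪(d + 1)^s ⟶ V(d + 1)`. -/
noncomputable def presentationComplex (hA : HasDegreeOneCover 𝒜) (hV : IsPresentedBy V e B) {d d' : ℤ}
    (h : d' = d + 1) : ShortComplex (AbSheaf (Proj 𝒜).toTopCat) :=
  ShortComplex.mk (X₁ := ⨁ fun _ : Fin t ↦ twistAb 𝒜 d) (X₂ := ⨁ fun _ : Fin s ↦ twistAb 𝒜 d')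
    (X₃ := tensorAb V (twistingSheaf 𝒜 d'))
    (biproduct.matrix fun j i ↦ mulTwist (B i j) h)
    (biproduct.desc fun i ↦ tensorLeft (e i)) (by
      refine biproduct.hom_ext' _ _ fun j ↦ ?_
      rw [biproduct.ι_matrix_assoc, biproduct.lift_desc, mulTwist_tensorLeft_sum hA hV h, comp_zero])

/-- Evaluation of sections of a twisting sheaf at a point. -/
def evalAt {U : Opens (ProjectiveSpectrum 𝒜)} (d : ℤ) (x : U) : twistSections 𝒜 d U →+ LocAt 𝒜 x.1 where
  toFun f := f.1 x
  map_zero' := rfl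
  map_add' _ _ := rfl

lemma sum_mulTwist_val {d d' : ℤ} (h : d' = d + 1) {U : Opens (ProjectiveSpectrum 𝒜)} {ι : Type*}
    [Fintype ι] (a : ι → 𝒜 1) (b : ι → twistSections 𝒜 d U) (x : U) :
    (∑ j, (mulTwist (a j) h).hom.app (op U) (b j) : twistSections 𝒜 d' U).1 x =
      ∑ j, algebraMap A (LocAt 𝒜 x.1) (a j) * (b j).1 x :=
  map_sum (evalAt d' x) _ _

lemma biprodSection_mulTwist_ext {d d' : ℤ} (h : d' = d + 1) {U : Opens (ProjectiveSpectrum 𝒜)}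
    (a : Fin t → Fin s → 𝒜 1) {b : Fin t → twistSections 𝒜 d U} {c : Fin s → twistSections 𝒜 d' U}
    (hbc : ∀ i x, (c i).1 x = ∑ j, algebraMap A (LocAt 𝒜 x.1) (a j i) * (b j).1 x) :
    (biproduct.matrix fun j i ↦ mulTwist (a j i) h).hom.app (op U)
      (biprodSection (fun _ : Fin t ↦ twistAb 𝒜 d) b) =
      biprodSection (fun _ : Fin s ↦ twistAb 𝒜 d') c := by
  refine biprodSection_ext fun i ↦ (π_matrix_biprodSection _ _ _).trans
    (Eq.trans ?_ (π_biprodSection _ _).symm)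
  refine Subtype.ext (funext fun x ↦ ?_)
  exact (sum_mulTwist_val h (fun j ↦ a j i) b x).trans (hbc i x).symm

lemma sum_eq_of_biprodSection_mulTwist {d d' : ℤ} (h : d' = d + 1) {U : Opens (ProjectiveSpectrum 𝒜)}
    (a : Fin t → Fin s → 𝒜 1) {b : Fin t → twistSections 𝒜 d U} {c : Fin s → twistSections 𝒜 d' U}
    (hbc : (biproduct.matrix fun j i ↦ mulTwist (a j i) h).hom.app (op U)
      (biprodSection (fun _ : Fin t ↦ twistAb 𝒜 d) b) =
      biprodSection (fun _ : Fin s ↦ twistAb 𝒜 d') c) (i : Fin s) (x : U) :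
    (c i).1 x = ∑ j, algebraMap A (LocAt 𝒜 x.1) (a j i) * (b j).1 x := by
  have h1 := congrArg ((biproduct.π (fun _ : Fin s ↦ twistAb 𝒜 d') i).hom.app (op U)) hbc
  have h2 : c i = ∑ j, (mulTwist (a j i) h).hom.app (op U) (b j) :=
    (π_biprodSection _ _).symm.trans (h1.symm.trans (π_matrix_biprodSection _ _ _))
  exact (congrFun (congrArg Subtype.val h2) x).trans (sum_mulTwist_val h (fun j ↦ a j i) b x)

lemma exists_eq_biprodSection {d : ℤ} {m : ℕ} {U : Opens (ProjectiveSpectrum 𝒜)}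
    (b : (⨁ fun _ : Fin m ↦ twistAb 𝒜 d).obj.obj (op U)) :
    ∃ b' : Fin m → twistSections 𝒜 d U, b = biprodSection (fun _ : Fin m ↦ twistAb 𝒜 d) b' :=
  ⟨_, (biproduct_total_app b).symm⟩

/-- Local left inverses of B give injectivity on the left. The other two conditions are the
presentation of V, transported to the twist by a local basis ℓ^d'. -/
theorem presentationComplex_shortExact (hA : HasDegreeOneCover 𝒜) (hV : IsPresentedBy V e B)
    (hB : ∀ x, ∃ W : Opens (ProjectiveSpectrum 𝒜), x ∈ W ∧ HasLeftInverse B W) {d d' : ℤ}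
    (h : d' = d + 1) : (presentationComplex V e B hA hV h).ShortExact := by
  refine shortExact_of_local _ (fun U ↦ ?_) (fun U c hc x hx ↦ ?_) (fun U z x hx ↦ ?_)
  · refine (injective_iff_map_eq_zero
      (onSections U _ _ (presentationComplex V e B hA hV h).f)).2 fun b hb ↦ ?_
    obtain ⟨b, rfl⟩ := exists_eq_biprodSection b
    have h0 := sum_eq_of_biprodSection_mulTwist h (fun j i ↦ B i j) (b := b) (c := 0)
      (hb.trans biprodSection_zero.symm)
    have hb0 : b = 0 := by
      refine funext fun j ↦ Subtype.ext (funext fun x ↦ ?_)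
      obtain ⟨W, hxW, hW⟩ := hB x.1
      exact congrFun (hW.eq_zero (x := ⟨x.1, hxW⟩) (b := fun j ↦ (b j).1 x)
        fun i ↦ (h0 i x).symm) j
    rw [hb0]
    exact biprodSection_zero
  · obtain ⟨ℓ, hℓ, hxℓ⟩ := hA x
    obtain ⟨c, rfl⟩ := exists_eq_biprodSection c
    let W : (Proj 𝒜).Opens := U ⊓ ProjectiveSpectrum.basicOpen 𝒜 ℓ
    have h1 := (desc_biprodSection (U := U)
      (fun i ↦ tensorLeft (G := twistingSheaf 𝒜 d') (e i)) c).symm.trans hc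
    have h2 := (res_sum_tensorLeft (G := twistingSheaf 𝒜 d') e (inf_le_left : W ≤ U) c).symm.trans
      ((congrArg (res (tensorAb V (twistingSheaf 𝒜 d')) inf_le_left) h1).trans (map_zero _))
    obtain ⟨b, hb⟩ := (sum_tmulHom_eq_zero_iff hV hℓ h (U := W) inf_le_right
      (fun i ↦ tres inf_le_left (c i))).1 h2
    refine ⟨W, inf_le_left, biprodSection _ b, ⟨hx, hxℓ⟩, ?_⟩
    refine (biprodSection_mulTwist_ext h (fun j i ↦ B i j) hb).trans ?_
    exact (res_biprodSection (A := fun _ : Fin s ↦ twistAb 𝒜 d') (inf_le_left : W ≤ U) c).symm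
  · obtain ⟨ℓ, hℓ, hxℓ⟩ := hA x
    have hle : U ⊓ ProjectiveSpectrum.basicOpen 𝒜 ℓ ≤ ProjectiveSpectrum.basicOpen 𝒜 ℓ :=
      inf_le_right
    have hq := isFrame_twistGen hℓ d' hle (d := d') (by simp)
    obtain ⟨W, hW, m, hxW, hm⟩ := hq.exists_tmulHom (F := V)
      (res (tensorAb V (twistingSheaf 𝒜 d')) inf_le_left z) (x := x) ⟨hx, hxℓ⟩
    obtain ⟨W', hW', c, hxW', hc⟩ := hV.exists_local m hxW
    refine ⟨W', (hW'.trans hW).trans inf_le_left, biprodSection _ fun i ↦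
      ofCoord hℓ d' (hW'.trans (hW.trans inf_le_right)) (c i), hxW', ?_⟩
    refine (desc_biprodSection _ _).trans ?_
    refine (sum_tmulHom_ofCoord hℓ d' _ c fun i ↦ glob (e i) W').trans ?_
    rw [hc]
    have h2 := congrArg (res (tensorAb V (twistingSheaf 𝒜 d')) hW') hm
    exact (res_tmulHom hW' m _).symm.trans (h2.trans ((res_res _ _ _ _).trans (res_res _ _ _ _)))

end Presentation

/-! ### Homomorphisms out of a sheaf generated by global sections. -/

section LocallyGenerated

variable {X : Scheme.{u}} {ι : Type*} [Fintype ι]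

/-- The sheaf of modules `V` is generated by its global sections `e`. -/
def IsGeneratedBy (V : X.Modules) (e : ι → Γ(V, ⊤)) : Prop :=
  ∀ {U : X.Opens} (v : Γ(V, U)) {x : X}, x ∈ U →
    ∃ (W : X.Opens) (h : W ≤ U) (c : ι → Γ(X, W)), x ∈ W ∧ ∑ i, c i • glob (e i) W = mres V h v

variable {V G : X.Modules} {e : ι → Γ(V, ⊤)} {W : X.Opens}

lemma mres_sum_smul_glob {U U' : X.Opens} (h : U' ≤ U) (c : ι → Γ(X, U)) :
    mres V h (∑ i, c i • glob (e i) U) = ∑ i, rres h (c i) • glob (e i) U' := by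
  rw [map_sum]
  exact Finset.sum_congr rfl fun i _ ↦ by rw [mres_smul, mres_mres]

lemma mres_sum_smul {U U' : X.Opens} (hU : U ≤ W) (h : U' ≤ U) (c : ι → Γ(X, U)) (r : ι → Γ(G, W)) :
    mres G h (∑ i, c i • mres G hU (r i)) = ∑ i, rres h (c i) • mres G (h.trans hU) (r i) := by
  rw [map_sum]
  exact Finset.sum_congr rfl fun i _ ↦ by rw [mres_smul, mres_mres]

/-- A linear function on the generators that respects the relations extends to the sheaf. -/
lemma exists_homSections (hV : IsGeneratedBy V e) (r : ι → Γ(G, W))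
    (hr : ∀ (U : X.Opens) (h : U ≤ W) (c : ι → Γ(X, U)), ∑ i, c i • glob (e i) U = 0 →
      ∑ i, c i • mres G h (r i) = 0) :
    ∃ φ : homSections V G W, ∀ i, φ.1 ⟨W, le_rfl⟩ (glob (e i) W) = r i := by
  -- Two expressions of the same section give the same value, so the locally defined values agree on
  -- overlaps and glue.
  have hr' (U : X.Opens) (h : U ≤ W) (c c' : ι → Γ(X, U))
      (hc : ∑ i, c i • glob (e i) U = ∑ i, c' i • glob (e i) U) :
      ∑ i, c i • mres G h (r i) = ∑ i, c' i • mres G h (r i) := by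
    rw [← sub_eq_zero, ← Finset.sum_sub_distrib] at hc ⊢
    simp only [← sub_smul] at hc ⊢
    exact hr U h _ hc
  -- the value at `v`, specified locally
  let P (U : X.Opens) (hU : U ≤ W) (v : Γ(V, U)) (u : Γ(G, U)) : Prop :=
    ∀ (U' : X.Opens) (h : U' ≤ U) (c : ι → Γ(X, U')), ∑ i, c i • glob (e i) U' = mres V h v →
      mres G h u = ∑ i, c i • mres G (h.trans hU) (r i)
  have hex (U : X.Opens) (hU : U ≤ W) (v : Γ(V, U)) : ∃ u, P U hU v u := by
    choose W' hW' c hxW' hc using fun x : U ↦ hV v x.2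
    obtain ⟨u, hu⟩ := exists_glue ((SheafOfModules.toSheaf X.ringCatSheaf).obj G) W' hW'
      (fun x hx ↦ Opens.mem_iSup.2 ⟨⟨x, hx⟩, hxW' _⟩)
      (fun x ↦ ∑ i, c x i • mres G ((hW' x).trans hU) (r i)) fun x y ↦ by
        refine (mres_sum_smul _ _ _ _).trans (Eq.trans ?_ (mres_sum_smul _ _ _ _).symm)
        refine hr' _ _ _ _ ?_
        rw [← mres_sum_smul_glob, ← mres_sum_smul_glob, hc, hc, mres_mres, mres_mres]
    refine ⟨u, fun U' h c' hc' ↦ ?_⟩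
    refine eq_of_res_eq ((SheafOfModules.toSheaf X.ringCatSheaf).obj G) (fun x ↦ W' x ⊓ U')
      (fun _ ↦ inf_le_right) (fun x hx ↦ Opens.mem_iSup.2 ⟨⟨x, h hx⟩, hxW' _, hx⟩) _ _ fun x ↦ ?_
    refine Eq.trans ?_ (mres_sum_smul _ inf_le_right _ _).symm
    have h1 := congrArg (mres G (inf_le_left : W' x ⊓ U' ≤ W' x)) (hu x)
    refine ((mres_mres G h inf_le_right u).trans (mres_mres G (hW' x) inf_le_left u).symm).trans
      (h1.trans ((mres_sum_smul _ _ _ _).trans ?_))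
    refine hr' _ _ _ _ ?_
    rw [← mres_sum_smul_glob, ← mres_sum_smul_glob, hc, hc', mres_mres, mres_mres]
  choose Φ hΦ using hex
  -- The value is pinned down by any local expressions over a cover; additivity, linearity and
  -- compatibility with restriction all follow from this.
  have hchar (U : X.Opens) (hU : U ≤ W) (v : Γ(V, U)) (u : Γ(G, U))
      (h : ∀ x ∈ U, ∃ (U' : X.Opens) (h : U' ≤ U) (c : ι → Γ(X, U')), x ∈ U' ∧
        ∑ i, c i • glob (e i) U' = mres V h v ∧
        mres G h u = ∑ i, c i • mres G (h.trans hU) (r i)) : Φ U hU v = u := by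
    choose W' hW' c hxW' hc hc' using fun x : U ↦ h x.1 x.2
    exact eq_of_res_eq ((SheafOfModules.toSheaf X.ringCatSheaf).obj G) W' hW'
      (fun x hx ↦ Opens.mem_iSup.2 ⟨⟨x, hx⟩, hxW' _⟩) _ _ fun x ↦
        (hΦ U hU v _ (hW' x) _ (hc x)).trans (hc' x).symm
  refine ⟨⟨fun U ↦
    { toFun := Φ U.1 U.2
      map_add' := fun v v' ↦ hchar _ _ _ _ fun x hx ↦ ?_
      map_smul' := fun a v ↦ hchar _ _ _ _ fun x hx ↦ ?_ }, fun U U' h v ↦ ?_⟩, fun i ↦ ?_⟩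
  · obtain ⟨U₁, h₁, c, hx₁, hc⟩ := hV v hx
    obtain ⟨U₂, h₂, c', hx₂, hc'⟩ := hV v' hx
    refine ⟨U₁ ⊓ U₂, inf_le_left.trans h₁, fun i ↦ rres inf_le_left (c i) + rres inf_le_right (c' i),
      ⟨hx₁, hx₂⟩, ?_, ?_⟩
    · simp only [add_smul, Finset.sum_add_distrib]
      rw [← mres_sum_smul_glob, ← mres_sum_smul_glob, hc, hc', mres_mres, mres_mres, map_add]
    · simp only [add_smul, Finset.sum_add_distrib, map_add]
      rw [← mres_sum_smul (G := G) (h₁.trans U.2) inf_le_left,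
        ← mres_sum_smul (G := G) (h₂.trans U.2) inf_le_right,
        ← hΦ _ U.2 v _ h₁ c hc, ← hΦ _ U.2 v' _ h₂ c' hc', mres_mres, mres_mres]
  · obtain ⟨U₁, h₁, c, hx₁, hc⟩ := hV v hx
    refine ⟨U₁, h₁, fun i ↦ rres h₁ a * c i, hx₁, ?_, ?_⟩
    · simp only [mul_smul, ← Finset.smul_sum]
      rw [hc, mres_smul]
    · simp only [mul_smul, ← Finset.smul_sum]
      rw [← hΦ _ U.2 v _ h₁ c hc, RingHom.id_apply, mres_smul]
  · refine (hchar _ _ _ _ fun x hx ↦ ?_).symm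
    obtain ⟨U₁, h₁, c, hx₁, hc⟩ := hV v (h hx)
    refine ⟨U' ⊓ U₁, inf_le_left, fun i ↦ rres inf_le_right (c i), ⟨hx, hx₁⟩, ?_, ?_⟩
    · rw [← mres_sum_smul_glob, hc, mres_mres]
      exact (mres_mres _ _ _ _).symm
    · rw [← mres_sum_smul (G := G) (h₁.trans U.2) inf_le_right, ← hΦ _ U.2 v _ h₁ c hc]
      exact (mres_mres _ _ _ _).trans (mres_mres _ _ _ _).symm
  · classical
    refine hchar _ _ _ _ fun x hx ↦ ⟨W, le_rfl, Pi.single i 1, hx, ?_, ?_⟩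
    · rw [Finset.sum_eq_single i (fun j _ hj ↦ by rw [Pi.single_eq_of_ne hj, zero_smul]) (by simp),
        Pi.single_eq_same, one_smul, mres_self]
    · rw [Finset.sum_eq_single i (fun j _ hj ↦ by rw [Pi.single_eq_of_ne hj, zero_smul]) (by simp),
        Pi.single_eq_same, one_smul]

lemma homSections_sum_smul (φ : homSections V G W) {U : X.Opens} (hU : U ≤ W) (c : ι → Γ(X, U)) :
    φ.1 ⟨U, hU⟩ (∑ i, c i • glob (e i) U) =
      ∑ i, c i • mres G hU (φ.1 ⟨W, le_rfl⟩ (glob (e i) W)) := by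
  rw [map_sum]
  refine Finset.sum_congr rfl fun i _ ↦ ?_
  rw [map_smul]
  refine congrArg (c i • ·) ?_
  rw [φ.2 ⟨W, le_rfl⟩ ⟨U, hU⟩ hU]
  exact congrArg _ (mres_mres _ _ _ _).symm

/-- A homomorphism is determined by the images of the generators. -/
lemma homSections_eq_zero (hV : IsGeneratedBy V e) (φ : homSections V G W)
    (h : ∀ i, φ.1 ⟨W, le_rfl⟩ (glob (e i) W) = 0) : φ = 0 := by
  refine Subtype.ext (funext fun U ↦ LinearMap.ext fun v ↦ ?_)
  choose W' hW' c hxW' hc using fun x : U.1 ↦ hV v x.2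
  refine eq_of_res_eq ((SheafOfModules.toSheaf X.ringCatSheaf).obj G) W' hW'
    (fun x hx ↦ Opens.mem_iSup.2 ⟨⟨x, hx⟩, hxW' _⟩) _ _ fun x ↦ ?_
  refine (φ.2 U ⟨W' x, (hW' x).trans U.2⟩ (hW' x) v).trans (Eq.trans ?_ (map_zero _).symm)
  refine (congrArg _ (hc x).symm).trans ((homSections_sum_smul φ _ _).trans ?_)
  exact Finset.sum_eq_zero fun i _ ↦ by rw [h, map_zero, smul_zero]

end LocallyGenerated

/-! ### Evaluation of the dual sheaf on sections. -/

section Contraction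

open TensorProduct

variable {X : Scheme.{u}} {F G : X.Modules}

/-- Evaluation of a linear function at a section. -/
noncomputable def evalDual {U : X.Opens} (m : Γ(F, U)) : Γ(dual F, U) →ₗ[Γ(X, U)] Γ(X, U) where
  toFun φ := (show homSections F (SheafOfModules.unit X.ringCatSheaf) U from φ).1 ⟨U, le_rfl⟩ m
  map_add' _ _ := rfl
  map_smul' r φ := by
    have h := rres_self (le_refl U) r
    exact congrArg (fun a : Γ(X, U) ↦ a * (show Γ(X, U) from
      (show homSections F (SheafOfModules.unit X.ringCatSheaf) U from φ).1 ⟨U, le_rfl⟩ m)) h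

lemma evalDual_mres {U V : X.Opens} (h : V ≤ U) (m : Γ(F, U)) (φ : Γ(dual F, U)) :
    evalDual (mres F h m) (mres (dual F) h φ) = rres h (evalDual m φ) :=
  ((show homSections F (SheafOfModules.unit X.ringCatSheaf) U from φ).2 ⟨U, le_rfl⟩ ⟨V, h⟩ h m).symm

lemma evalDual_zero_left {U : X.Opens} (φ : Γ(dual F, U)) : evalDual (0 : Γ(F, U)) φ = 0 :=
  map_zero ((show homSections F (SheafOfModules.unit X.ringCatSheaf) U from φ).1 ⟨U, le_rfl⟩)

/-- Contraction with a section. -/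
noncomputable def contractLin {U : X.Opens} (m : Γ(F, U)) :
    Γ(dual F, U) ⊗[Γ(X, U)] Γ(G, U) →ₗ[Γ(X, U)] Γ(G, U) :=
  TensorProduct.lift ((LinearMap.lsmul Γ(X, U) Γ(G, U)).comp (evalDual m))

/-- Contraction with a global section on the presheaf tensor product. -/
noncomputable def preContract (m : Γ(F, ⊤)) : (preTensor (dual F) G).presheaf ⟶ G.presheaf where
  app U := AddCommGrpCat.ofHom (contractLin (G := G) (glob m U.unop)).toAddMonoidHom
  naturality U V i := by
    let L := ((preTensor (dual F) G).presheaf.map i ≫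
      AddCommGrpCat.ofHom (contractLin (G := G) (glob m V.unop)).toAddMonoidHom).hom
    let R := (AddCommGrpCat.ofHom (contractLin (G := G) (glob m U.unop)).toAddMonoidHom ≫
      G.presheaf.map i).hom
    ext (z : Γ(dual F, U.unop) ⊗[Γ(X, U.unop)] Γ(G, U.unop))
    induction z with
    | zero => exact (map_zero L).trans (map_zero R).symm
    | add a b ha hb =>
      exact (map_add L a b).trans ((congrArg₂ (· + ·) ha hb).trans (map_add R a b).symm)
    | tmul φ g =>
      change evalDual (glob m V.unop) (mres (dual F) i.unop.le φ) • mres G i.unop.le g =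
        mres G i.unop.le (evalDual (glob m U.unop) φ • g)
      rw [mres_smul, ← evalDual_mres, mres_mres]

/-- Contraction with a global section. -/
noncomputable def contract (m : Γ(F, ⊤)) :
    tensorAb (dual F) G ⟶ (SheafOfModules.toSheaf X.ringCatSheaf).obj G where
  hom := CategoryTheory.sheafifyLift (Opens.grothendieckTopology X) (preContract m) G.isSheaf

lemma contract_tmulHom (m : Γ(F, ⊤)) {U : X.Opens} (φ : Γ(dual F, U)) (g : Γ(G, U)) :
    (contract (G := G) m).hom.app (op U) (tmulHom (dual F) G U (φ ⊗ₜ g)) =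
      evalDual (glob m U) φ • g := by
  have h := CategoryTheory.toSheafify_sheafifyLift (Opens.grothendieckTopology X)
    (preContract (G := G) m) G.isSheaf
  exact ConcreteCategory.congr_hom (congrArg
    (fun f : (preTensor (dual F) G).presheaf ⟶ G.presheaf ↦ f.app (op U)) h) (φ ⊗ₜ[Γ(X, U)] g)

variable {ι : Type*} [Fintype ι] {e : ι → Γ(F, ⊤)}

lemma evalDual_sum_smul {U : X.Opens} (c : ι → Γ(X, U)) (φ : Γ(dual F, U)) :
    evalDual (∑ i, c i • glob (e i) U) φ = ∑ i, c i * evalDual (glob (e i) U) φ := by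
  refine (homSections_sum_smul (show homSections F (SheafOfModules.unit X.ringCatSheaf) U from φ)
    le_rfl c).trans ?_
  exact Finset.sum_congr rfl fun i _ ↦ congrArg (c i * ·) (mres_self _ _ _)

/-- A linear function on the generators that respects the relations extends to the sheaf. -/
lemma exists_dual (hF : IsGeneratedBy F e) {W : X.Opens} (r : ι → Γ(X, W))
    (hr : ∀ (U : X.Opens) (h : U ≤ W) (c : ι → Γ(X, U)), ∑ i, c i • glob (e i) U = 0 →
      ∑ i, c i * rres h (r i) = 0) :
    ∃ φ : Γ(dual F, W), ∀ i, evalDual (glob (e i) W) φ = r i :=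
  exists_homSections (G := SheafOfModules.unit X.ringCatSheaf) hF r hr

lemma dual_eq_zero (hF : IsGeneratedBy F e) {W : X.Opens} {φ : Γ(dual F, W)}
    (h : ∀ i, evalDual (glob (e i) W) φ = 0) : φ = 0 :=
  homSections_eq_zero (G := SheafOfModules.unit X.ringCatSheaf) hF φ h

lemma IsFrame.eq_zero_of_smul {U : X.Opens} {q : Γ(G, U)} (hq : IsFrame q) {r : Γ(X, U)}
    (h : r • q = 0) : r = 0 := by
  refine (hq U le_rfl).1 ?_
  change r • _ = (0 : Γ(X, U)) • _
  rw [mres_self, h, zero_smul]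

end Contraction

/-! ### The dual bundle as the kernel of the transposed matrix. -/

section DualPresentation

attribute [local instance] Abelian.hasFiniteBiproducts

variable {A σ : Type u} [CommRing A] [SetLike σ A] [AddSubgroupClass σ A]
  {𝒜 : ℕ → σ} [GradedRing 𝒜] {s t : ℕ}
  {V : (Proj 𝒜).Modules} {e : Fin s → Γ(V, ⊤)} {B : Fin s → Fin t → 𝒜 1}

lemma IsPresentedBy.isGeneratedBy (hV : IsPresentedBy V e B) : IsGeneratedBy V e :=
  fun v _ hx ↦ hV.exists_local v hx

/-- The quotient f / ℓ of two elements of degree one is a regular function where ℓ is invertible. -/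
lemma exists_regVal_eq_mul {ℓ : A} (hℓ : ℓ ∈ 𝒜 1) {U : Opens (ProjectiveSpectrum 𝒜)}
    (hU : U ≤ ProjectiveSpectrum.basicOpen 𝒜 ℓ) (f : 𝒜 1) :
    ∃ r : Γ(Proj 𝒜, U), ∀ x, regVal r x = algebraMap A (LocAt 𝒜 x.1) f *
      ((locUnit ℓ x.1 (hU x.2) ^ (-1 : ℤ) : (LocAt 𝒜 x.1)ˣ) : LocAt 𝒜 x.1) := by
  obtain ⟨r, hr⟩ := exists_regVal_eq (twistProd (W := U) (k := 0) (d := 1) (e := -1) (by simp)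
    (twistConst (by simp) f U) (twistGen 𝒜 hℓ (-1) hU (by simp)))
  exact ⟨r, fun x ↦ congrFun hr x⟩

/-- The value of a regular function at a point. -/
noncomputable def regAt {U : Opens (ProjectiveSpectrum 𝒜)} (x : U) :
    Γ(Proj 𝒜, U) →+* LocAt 𝒜 x.1 :=
  (Pi.evalRingHom (fun x : U ↦ LocAt 𝒜 x.1) x).comp regVal

lemma regVal_sum_mul {U : Opens (ProjectiveSpectrum 𝒜)} (r r' : Fin s → Γ(Proj 𝒜, U)) (x : U) :
    regVal (∑ i, r i * r' i) x = ∑ i, regVal (r i) x * regVal (r' i) x :=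
  (map_sum (regAt x) _ _).trans (Finset.sum_congr rfl fun _ _ ↦ map_mul (regAt x) _ _)

/-- Column j of B divided by ℓ is a relation among the generators over D(ℓ), and φ must kill it. -/
lemma sum_mul_regVal_evalDual (hA : HasDegreeOneCover 𝒜) (hV : IsPresentedBy V e B)
    {U : (Proj 𝒜).Opens} (φ : Γ(dual V, U)) (j : Fin t) (x : (U : Opens (ProjectiveSpectrum 𝒜))) :
    ∑ i, algebraMap A (LocAt 𝒜 x.1) (B i j) * regVal (evalDual (glob (e i) U) φ) x = 0 := by
  obtain ⟨ℓ, hℓ, hxℓ⟩ := hA x.1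
  let W : (Proj 𝒜).Opens := U ⊓ ProjectiveSpectrum.basicOpen 𝒜 ℓ
  have hW : W ≤ ProjectiveSpectrum.basicOpen 𝒜 ℓ := inf_le_right
  choose r hr using fun i ↦ exists_regVal_eq_mul hℓ hW (B i j)
  have h0 : ∑ i, r i • glob (e i) W = 0 := (hV.sum_eq_zero_iff r).2
    ⟨Pi.single j (twistGen 𝒜 hℓ (-1) hW (by simp)), fun i y ↦ by
      rw [Finset.sum_eq_single j, Pi.single_eq_same]
      · exact hr i y
      · intro k _ hk
        rw [Pi.single_eq_of_ne hk]
        exact mul_zero _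
      · exact fun h ↦ (h (Finset.mem_univ _)).elim⟩
  have h1 := evalDual_sum_smul (e := e) r (mres (dual V) (inf_le_left : W ≤ U) φ)
  rw [h0, evalDual_zero_left] at h1
  have h2 := (regVal_sum_mul _ _ _).symm.trans
    (congrFun (congrArg regVal h1) (⟨x.1, x.2, hxℓ⟩ : (W : Opens (ProjectiveSpectrum 𝒜)))).symm
  have h3 (i : Fin s) : evalDual (glob (e i) W) (mres (dual V) (inf_le_left : W ≤ U) φ) =
      rres (inf_le_left : W ≤ U) (evalDual (glob (e i) U) φ) := by
    rw [← evalDual_mres, mres_mres]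
  simp only [h3] at h2
  refine (Units.mul_left_inj (locUnit ℓ x.1 hxℓ ^ (-1 : ℤ))).1 ?_
  rw [zero_mul, Finset.sum_mul]
  refine Eq.trans (Finset.sum_congr rfl fun i _ ↦ ?_) (h2.trans (map_zero (regAt _)))
  refine Eq.trans ?_ (congrArg (· * _) (hr i ⟨x.1, x.2, hxℓ⟩).symm)
  exact mul_right_comm _ _ _

/-- Every relation is a combination of the columns of B, so values killed by the transpose respect
all relations. -/
lemma exists_dual_of_presentation (hV : IsPresentedBy V e B) {W : (Proj 𝒜).Opens}
    (r : Fin s → Γ(Proj 𝒜, W)) (hr : ∀ (j : Fin t) (x : (W : Opens (ProjectiveSpectrum 𝒜))),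
      ∑ i, algebraMap A (LocAt 𝒜 x.1) (B i j) * regVal (r i) x = 0) :
    ∃ φ : Γ(dual V, W), ∀ i, evalDual (glob (e i) W) φ = r i := by
  refine exists_dual hV.isGeneratedBy r fun U hU c hc ↦ ?_
  obtain ⟨b, hb⟩ := (hV.sum_eq_zero_iff c).1 hc
  refine regVal_injective (funext fun x ↦ ?_)
  refine (regVal_sum_mul c (fun i ↦ rres hU (r i)) x).trans ?_
  refine Eq.trans ?_ (map_zero (regAt x)).symm
  have h1 (i : Fin s) : regVal (c i) x * regVal (rres hU (r i)) x =
      ∑ j, (b j).1 x * (algebraMap A (LocAt 𝒜 x.1) (B i j) * regVal (r i) ⟨x.1, hU x.2⟩) := by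
    refine (congrArg (· * _) (hb i x)).trans ?_
    rw [Finset.sum_mul]
    exact Finset.sum_congr rfl fun j _ ↦ (congrArg (· * _) (mul_comm _ _)).trans (mul_assoc _ _ _)
  refine (Finset.sum_congr rfl fun i _ ↦ h1 i).trans ?_
  rw [Finset.sum_comm]
  refine Finset.sum_eq_zero fun j _ ↦ ?_
  rw [← Finset.mul_sum]
  exact (congrArg _ (hr j ⟨x.1, hU x.2⟩)).trans (mul_zero _)

/-- Sections of `V^*(d)` are locally of the form `φ ⊗ q`. -/
lemma exists_tmulHom_dual (hA : HasDegreeOneCover 𝒜) {d : ℤ} {U : (Proj 𝒜).Opens}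
    (z : (tensorAb (dual V) (twistingSheaf 𝒜 d)).obj.obj (op U)) {x : Proj 𝒜} (hx : x ∈ U) :
    ∃ (W : (Proj 𝒜).Opens) (h : W ≤ U) (φ : Γ(dual V, W)) (q : twistSections 𝒜 d W), x ∈ W ∧
      IsFrame (G := twistingSheaf 𝒜 d) q ∧
      tmulHom (dual V) (twistingSheaf 𝒜 d) W (φ ⊗ₜ q) = res (tensorAb _ _) h z := by
  obtain ⟨ℓ, hℓ, hxℓ⟩ := hA x
  have hle : U ⊓ ProjectiveSpectrum.basicOpen 𝒜 ℓ ≤ ProjectiveSpectrum.basicOpen 𝒜 ℓ :=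
    inf_le_right
  have hq := isFrame_twistGen hℓ d hle (d := d) (by simp)
  obtain ⟨W, hW, φ, hxW, hφ⟩ := hq.exists_tmulHom (F := dual V)
    (res (tensorAb (dual V) (twistingSheaf 𝒜 d)) inf_le_left z) (x := x) ⟨hx, hxℓ⟩
  exact ⟨W, hW.trans inf_le_left, φ, _, hxW, hq.mres hW, hφ.trans (res_res _ _ _ _)⟩

lemma contract_mulTwist_sum (hA : HasDegreeOneCover 𝒜) (hV : IsPresentedBy V e B) {d d' : ℤ}
    (h : d' = d + 1) (j : Fin t) :
    ∑ i, contract (G := twistingSheaf 𝒜 d) (e i) ≫ mulTwist (B i j) h = 0 := by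
  refine Sheaf.hom_ext (NatTrans.ext (funext fun U ↦ ?_))
  ext z
  choose W hW φ q hxW hq hφ using fun x : U.unop ↦ exists_tmulHom_dual hA z x.2
  refine eq_of_res_eq (twistAb 𝒜 d') W (W := U.unop) hW
    (fun x hx ↦ Opens.mem_iSup.2 ⟨⟨x, hx⟩, hxW _⟩) _ _ fun x ↦ ?_
  refine (res_app _ _ _).trans (Eq.trans ?_ (map_zero _).symm)
  rw [← hφ]
  refine (DFunLike.congr_fun (map_sum (onSections (W x) (tensorAb (dual V) (twistingSheaf 𝒜 d))
        (twistAb 𝒜 d')) _ _) _).trans ((AddMonoidHom.finsetSum_apply _ _ _).trans ?_)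
  refine (Finset.sum_congr rfl fun i _ ↦ congrArg ((mulTwist (B i j) h).hom.app (op (W x)))
    (contract_tmulHom (G := twistingSheaf 𝒜 d) (e i) (φ x) (q x))).trans ?_
  refine Subtype.ext (funext fun y ↦ ?_)
  refine (sum_mulTwist_val h (U := W x) (fun i ↦ B i j) (fun i ↦
    (show twistSections 𝒜 d (W x) from (show Γ(twistingSheaf 𝒜 d, W x) from
      evalDual (glob (e i) (W x)) (φ x) • (show Γ(twistingSheaf 𝒜 d, W x) from q x)))) y).trans ?_
  refine Eq.trans (Finset.sum_congr rfl fun i _ ↦ (mul_assoc _ _ _).symm) ?_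
  rw [← Finset.sum_mul]
  exact (congrArg (· * _) (sum_mul_regVal_evalDual hA hV (φ x) j y)).trans (zero_mul _)

variable (V e B) in
/-- The complex `V^*(d) ⟶ 𝒪(d)^s ⟶ 𝒪(d + 1)^t`. -/
noncomputable def dualComplex (hA : HasDegreeOneCover 𝒜) (hV : IsPresentedBy V e B) {d d' : ℤ}
    (h : d' = d + 1) : ShortComplex (AbSheaf (Proj 𝒜).toTopCat) :=
  ShortComplex.mk (X₁ := tensorAb (dual V) (twistingSheaf 𝒜 d))
    (X₂ := ⨁ fun _ : Fin s ↦ twistAb 𝒜 d) (X₃ := ⨁ fun _ : Fin t ↦ twistAb 𝒜 d')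
    (biproduct.lift fun i ↦ contract (e i))
    (biproduct.matrix fun i j ↦ mulTwist (B i j) h) (by
      refine biproduct.hom_ext _ _ fun j ↦ ?_
      rw [Category.assoc, biproduct.matrix_π, biproduct.lift_desc, contract_mulTwist_sum hA hV h,
        zero_comp])

/-- Functionals on V are the tuples of values killed by Bᵀ, which gives exactness on the left and in
the middle. On the right, the transpose of a local left inverse of B is a local right inverse of Bᵀ.
-/
theorem dualComplex_shortExact (hA : HasDegreeOneCover 𝒜) (hV : IsPresentedBy V e B)
    (hB : ∀ x, ∃ W : Opens (ProjectiveSpectrum 𝒜), x ∈ W ∧ HasLeftInverse B W) {d d' : ℤ}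
    (h : d' = d + 1) : (dualComplex V e B hA hV h).ShortExact := by
  refine shortExact_of_local _ (fun U ↦ ?_) (fun U c hc x hx ↦ ?_) (fun U z x hx ↦ ?_)
  · refine (injective_iff_map_eq_zero
      (onSections U _ _ (dualComplex V e B hA hV h).f)).2 fun z hz ↦ ?_
    choose W hW φ q hxW hq hφ using fun x : U ↦ exists_tmulHom_dual hA z x.2
    refine eq_of_res_eq (tensorAb (dual V) (twistingSheaf 𝒜 d)) W hW
      (fun x hx ↦ Opens.mem_iSup.2 ⟨⟨x, hx⟩, hxW _⟩) _ _ fun x ↦ ?_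
    have h0 : φ x = 0 := dual_eq_zero hV.isGeneratedBy fun i ↦ (hq x).eq_zero_of_smul ?_
    · refine (hφ x).symm.trans (Eq.trans ?_ (map_zero _).symm)
      rw [h0]
      exact (congrArg _ (TensorProduct.zero_tmul _ _)).trans (map_zero _)
    · refine (contract_tmulHom (G := twistingSheaf 𝒜 d) (e i) (φ x) (q x)).symm.trans ?_
      rw [hφ]
      refine (res_app _ _ _).symm.trans ((congrArg _ ?_).trans (map_zero (res (twistAb 𝒜 d) (hW x))))
      have h1 := congrArg ((biproduct.π (fun _ : Fin s ↦ twistAb 𝒜 d) i).hom.app (op U)) hz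
      exact (π_lift_app _ _ _).symm.trans (h1.trans (map_zero _))
  · obtain ⟨ℓ, hℓ, hxℓ⟩ := hA x
    obtain ⟨c, rfl⟩ := exists_eq_biprodSection c
    let W : (Proj 𝒜).Opens := U ⊓ ProjectiveSpectrum.basicOpen 𝒜 ℓ
    have hW : W ≤ ProjectiveSpectrum.basicOpen 𝒜 ℓ := inf_le_right
    have h0 := sum_eq_of_biprodSection_mulTwist h B (b := c) (c := 0)
      (hc.trans biprodSection_zero.symm)
    choose r hr using fun i ↦ exists_ofCoord_eq hℓ d hW (tres inf_le_left (c i))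
    obtain ⟨φ, hφ⟩ := exists_dual_of_presentation hV r fun j x ↦ by
      refine (Units.mul_left_inj (locUnit ℓ x.1 (hW x.2) ^ d)).1 ?_
      rw [zero_mul, Finset.sum_mul]
      refine Eq.trans (Finset.sum_congr rfl fun i _ ↦ ?_) (h0 j ⟨x.1, x.2.1⟩).symm
      rw [mul_assoc]
      exact congrArg _ (congrFun (congrArg Subtype.val (hr i)) x)
    refine ⟨W, inf_le_left, tmulHom (dual V) (twistingSheaf 𝒜 d) W
      (φ ⊗ₜ twistGen 𝒜 hℓ d hW (by simp)), ⟨hx, hxℓ⟩, ?_⟩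
    refine Eq.trans ?_ (res_biprodSection (A := fun _ : Fin s ↦ twistAb 𝒜 d)
      (inf_le_left : W ≤ U) c).symm
    refine biprodSection_ext fun i ↦ ?_
    refine (π_lift_app _ _ _).trans (Eq.trans ?_
      (π_biprodSection (A := fun _ : Fin s ↦ twistAb 𝒜 d) (U := W) _ i).symm)
    refine (contract_tmulHom (e i) φ _).trans ?_
    rw [hφ]
    exact hr i
  · obtain ⟨W₀, hxW₀, ρ, hρ⟩ := hB x
    obtain ⟨w, rfl⟩ := exists_eq_biprodSection z
    let W : (Proj 𝒜).Opens := U ⊓ W₀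
    let c (i : Fin s) : twistSections 𝒜 d W :=
      ∑ j, twistProd (by lia) (tres inf_le_left (w j)) (tres inf_le_right (ρ j i))
    have hc (i : Fin s) (x : (W : Opens (ProjectiveSpectrum 𝒜))) :
        (c i).1 x = ∑ j, (w j).1 ⟨x.1, x.2.1⟩ * (ρ j i).1 ⟨x.1, x.2.2⟩ :=
      map_sum (evalAt d x) _ _
    refine ⟨W, inf_le_left, biprodSection _ c, ⟨hx, hxW₀⟩, ?_⟩
    refine (biprodSection_mulTwist_ext h B fun k x ↦ ?_).trans
      (res_biprodSection (A := fun _ : Fin t ↦ twistAb 𝒜 d') (inf_le_left : W ≤ U) w).symm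
    refine Eq.trans ?_ (Finset.sum_congr rfl fun i _ ↦
      (congrArg _ (hc i x)).trans (Finset.mul_sum _ _ _)).symm
    rw [Finset.sum_comm]
    have h1 (j : Fin t) : ∑ i, algebraMap A (LocAt 𝒜 x.1) (B i k) *
        ((w j).1 ⟨x.1, x.2.1⟩ * (ρ j i).1 ⟨x.1, x.2.2⟩) =
        (w j).1 ⟨x.1, x.2.1⟩ * if j = k then 1 else 0 := by
      rw [← hρ ⟨x.1, x.2.2⟩, Finset.mul_sum]
      exact Finset.sum_congr rfl fun i _ ↦ by
        rw [mul_left_comm]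
        exact congrArg _ (mul_comm _ _)
    refine Eq.trans ?_ (Finset.sum_congr rfl fun j _ ↦ (h1 j).symm)
    simp only [mul_ite, mul_one, mul_zero, Finset.sum_ite_eq', Finset.mem_univ, if_true]
    rfl

end DualPresentation

/-! ### A local basis from an invertible maximal minor. -/

section DualBasis

variable {X : Scheme.{u}} {V : X.Modules} {s t r : ℕ} {e : Fin s → Γ(V, ⊤)} {W : X.Opens}

/-- The value of a linear function on a section over a smaller open set. -/
noncomputable def applyDual (φ : Γ(dual V, W)) {U : X.Opens} (h : U ≤ W) : Γ(V, U) →ₗ[Γ(X, U)] Γ(X, U) :=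
  (show homSections V (SheafOfModules.unit X.ringCatSheaf) W from φ).1 ⟨U, h⟩

lemma rres_applyDual (φ : Γ(dual V, W)) {U U' : X.Opens} (h : U ≤ W) (h' : U' ≤ U) (v : Γ(V, U)) :
    rres h' (applyDual φ h v) = applyDual φ (h'.trans h) (mres V h' v) :=
  (show homSections V (SheafOfModules.unit X.ringCatSheaf) W from φ).2 ⟨U, h⟩ ⟨U', h'.trans h⟩ h' v

lemma applyDual_glob (φ : Γ(dual V, W)) {U : X.Opens} (h : U ≤ W) (m : Γ(V, ⊤)) :
    applyDual φ h (glob m U) = rres h (evalDual (glob m W) φ) := by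
  refine Eq.trans ?_ (rres_applyDual φ le_rfl h _).symm
  rw [mres_mres]

/-- A complement of the image of an injective map. -/
lemma exists_complement (hs : s = t + r) {f : Fin t → Fin s} (hf : Function.Injective f) :
    ∃ I : Fin r → Fin s, Function.Injective I ∧ (∀ a k, I a ≠ f k) ∧
      ∀ i, (∃ k, f k = i) ∨ ∃ a, I a = i := by
  classical
  have hc : Fintype.card {i // i ∉ Set.range f} = r := by
    rw [Fintype.card_subtype_compl, Fintype.card_fin]
    have : Fintype.card {i // i ∈ Set.range f} = t :=
      (Fintype.card_congr (Equiv.ofInjective f hf)).symm.trans (Fintype.card_fin t)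
    rw [this]
    lia
  let E := (Fintype.equivFinOfCardEq hc).symm
  refine ⟨fun a ↦ (E a).1, Subtype.val_injective.comp E.injective, fun a k h ↦ (E a).2 ⟨k, h.symm⟩,
    fun i ↦ ?_⟩
  by_cases hi : i ∈ Set.range f
  · exact Or.inl hi
  · exact Or.inr ⟨E.symm ⟨i, hi⟩, by simp⟩

/-- Apply the inverse of the minor to the rows selected by f. Then bρ is the projection onto the
image of b along the coordinates not in the range of f. -/
lemma exists_projection {R : Type*} [CommRing R] {b : Matrix (Fin s) (Fin t) R} {f : Fin t → Fin s}
    (hdet : IsUnit (b.submatrix f id).det) : ∃ ρ : Matrix (Fin t) (Fin s) R,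
      ρ * b = 1 ∧ (∀ k i, (b * ρ) (f k) i = if f k = i then 1 else 0) ∧
        ∀ j i, (∀ k, f k ≠ i) → ρ j i = 0 := by
  let N := (b.submatrix f id)⁻¹
  let E : Matrix (Fin t) (Fin s) R := .of fun k i ↦ if f k = i then 1 else 0
  have hE : E * b = b.submatrix f id := by
    ext k j
    simp [E, Matrix.mul_apply]
  refine ⟨N * E, ?_, fun k i ↦ ?_, fun j i h ↦ ?_⟩
  · rw [Matrix.mul_assoc, hE, Matrix.nonsing_inv_mul _ hdet]
  · have h1 : (b * (N * E)) (f k) i = (b.submatrix f id * (N * E)) k i := rfl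
    rw [h1, ← Matrix.mul_assoc, Matrix.mul_nonsing_inv _ hdet, Matrix.one_mul]
    rfl
  · simp [Matrix.mul_apply, E, h]

/-- A presentation of a sheaf of modules by a matrix of functions with an invertible maximal minor
gives a basis. -/
lemma exists_dual_basis (hV : IsGeneratedBy V e) (b : Matrix (Fin s) (Fin t) Γ(X, W))
    (hb : ∀ (U : X.Opens) (h : U ≤ W) (c : Fin s → Γ(X, U)), ∑ i, c i • glob (e i) U = 0 ↔
      ∃ b' : Fin t → Γ(X, U), ∀ i, c i = ∑ j, rres h (b i j) * b' j)
    (hs : s = t + r) {f : Fin t → Fin s} (hf : Function.Injective f)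
    (hdet : IsUnit (b.submatrix f id).det) :
    ∃ (I : Fin r → Fin s) (ψ : Fin r → Γ(dual V, W)),
      (∀ a a', evalDual (glob (e (I a)) W) (ψ a') = if a = a' then 1 else 0) ∧
      ∀ (U : X.Opens) (h : U ≤ W) (v : Γ(V, U)),
        ∑ a, applyDual (ψ a) h v • glob (e (I a)) U = v := by
  obtain ⟨ρ, hρ1, hρ2, hρ3⟩ := exists_projection hdet
  obtain ⟨I, hI1, hI2, hI3⟩ := exists_complement hs hf
  -- P is the complementary projection: it annihilates the image of b, and its image is spanned by
  -- the coordinate vectors indexed by I.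
  obtain ⟨P, hP⟩ : ∃ P : Matrix (Fin s) (Fin s) Γ(X, W), P = 1 - b * ρ := ⟨_, rfl⟩
  have hPb : P * b = 0 := by
    rw [hP, Matrix.sub_mul, Matrix.mul_assoc, hρ1, Matrix.mul_one, Matrix.one_mul, sub_self]
  -- Since P b = 0, each row of P kills the relations and defines a functional; the rows with index
  -- in I form the dual basis.
  have hex (i : Fin s) : ∃ φ : Γ(dual V, W), ∀ i', evalDual (glob (e i') W) φ = P i i' := by
    refine exists_dual hV (fun i' ↦ P i i') fun U h c hc ↦ ?_
    obtain ⟨b', hb'⟩ := (hb U h c).1 hc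
    have h1 (j : Fin t) : ∑ i', rres h (b i' j) * rres h (P i i') = 0 := by
      have := congrArg (rres h) (congrFun (congrFun hPb i) j)
      rw [Matrix.mul_apply, map_sum, Matrix.zero_apply, map_zero] at this
      rw [← this]
      exact Finset.sum_congr rfl fun i' _ ↦ by rw [map_mul, mul_comm]
    simp only [hb', Finset.sum_mul]
    rw [Finset.sum_comm]
    refine Finset.sum_eq_zero fun j _ ↦ ?_
    rw [← mul_zero (b' j), ← h1 j, Finset.mul_sum]
    exact Finset.sum_congr rfl fun i' _ ↦ by ring
  choose φ hφ using hex
  have hPf (k i) : P (f k) i = 0 := by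
    rw [hP, Matrix.sub_apply, hρ2, Matrix.one_apply, sub_self]
  have hPI (a i) : P i (I a) = if i = I a then 1 else 0 := by
    rw [hP, Matrix.sub_apply, Matrix.mul_apply, Finset.sum_eq_zero fun j _ ↦ by
      rw [hρ3 j (I a) fun k ↦ (hI2 a k).symm, mul_zero], sub_zero, Matrix.one_apply]
  refine ⟨I, fun a ↦ φ (I a), fun a a' ↦ ?_, fun U h v ↦ ?_⟩
  · rw [hφ, hPI]
    exact if_congr ⟨fun h ↦ (hI1 h).symm, fun h ↦ congrArg I h.symm⟩ rfl rfl
  · have hsum {M : Type u} [AddCommGroup M] (m : Fin s → M) (hm : ∀ k, m (f k) = 0) :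
        ∑ a, m (I a) = ∑ i, m i := by
      rw [← Finset.sum_image (s := Finset.univ) (g := I) (f := m) hI1.injOn]
      refine Finset.sum_subset (Finset.subset_univ _) fun i _ hi ↦ ?_
      obtain ⟨k, rfl⟩ | ⟨a, rfl⟩ := hI3 i
      · exact hm k
      · exact (hi (Finset.mem_image_of_mem _ (Finset.mem_univ a))).elim
    choose W' hW' c hxW' hc using fun x : U ↦ hV v x.2
    refine eq_of_res_eq ((SheafOfModules.toSheaf X.ringCatSheaf).obj V) W' hW'
      (fun x hx ↦ Opens.mem_iSup.2 ⟨⟨x, hx⟩, hxW' _⟩) _ _ fun x ↦ ?_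
    refine (mres_sum_smul_glob (V := V) (e := fun a ↦ e (I a)) (hW' x) _).trans ?_
    have hW'' : W' x ≤ W := (hW' x).trans h
    have h2 (i : Fin s) : applyDual (φ i) hW'' (mres V (hW' x) v) =
        ∑ i', c x i' * rres hW'' (P i i') := by
      rw [← hc, map_sum]
      exact Finset.sum_congr rfl fun i' _ ↦ by rw [map_smul, applyDual_glob, hφ]; rfl
    -- Each column of bρ is a relation, so P acts as the identity on the generators.
    have h3 (i' : Fin s) : ∑ i, rres hW'' (P i i') • glob (e i) (W' x) = glob (e i') (W' x) := by
      have h4 := (hb (W' x) hW'' (fun i ↦ rres hW'' ((b * ρ) i i'))).2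
        ⟨fun j ↦ rres hW'' (ρ j i'), fun i ↦ by rw [Matrix.mul_apply, map_sum]; simp only [map_mul]⟩
      simp only [hP, Matrix.sub_apply, map_sub, sub_smul, Finset.sum_sub_distrib, h4, sub_zero]
      rw [Finset.sum_eq_single i', Matrix.one_apply_eq, map_one, one_smul]
      · intro i _ hi
        rw [Matrix.one_apply_ne hi, map_zero, zero_smul]
      · exact fun h ↦ (h (Finset.mem_univ _)).elim
    have h5 : mres V (hW' x) v = ∑ i, (∑ i', c x i' * rres hW'' (P i i')) • glob (e i) (W' x) := by
      rw [← hc]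
      simp only [Finset.sum_smul, mul_smul]
      rw [Finset.sum_comm]
      exact Finset.sum_congr rfl fun i' _ ↦ by rw [← Finset.smul_sum, h3]
    refine Eq.trans ?_ h5.symm
    rw [← hsum]
    · exact Finset.sum_congr rfl fun a _ ↦ by rw [rres_applyDual, h2]
    · intro k
      rw [Finset.sum_eq_zero fun i' _ ↦ by rw [hPf, map_zero, mul_zero], zero_smul]

end DualBasis

/-! ### Freeness from a basis and a dual basis. -/

section FreeIso

variable {C : Type*} [Category C] {J : GrothendieckTopology C} {R : Sheaf J RingCat.{u}}
  [HasWeakSheafify J AddCommGrpCat.{u}] [J.WEqualsLocallyBijective AddCommGrpCat.{u}]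

/-- A sheaf of modules with a basis and a dual basis is free. -/
lemma nonempty_iso_free {N : SheafOfModules.{u} R} {I : Type u} [Fintype I] [DecidableEq I]
    (σ : I → (SheafOfModules.unit R ⟶ N)) (π : I → (N ⟶ SheafOfModules.unit R))
    (h : ∀ a b, σ a ≫ π b = if a = b then 𝟙 _ else 0) (h' : ∑ a, π a ≫ σ a = 𝟙 N) :
    Nonempty (N ≅ SheafOfModules.free I) := by
  let D : SheafOfModules.free I ⟶ N :=
    Cofan.IsColimit.desc (SheafOfModules.isColimitFreeCofan I) σ
  have hD (a : I) : SheafOfModules.ιFree a ≫ D = σ a :=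
    Cofan.IsColimit.fac (SheafOfModules.isColimitFreeCofan I) σ a
  refine ⟨⟨∑ a, π a ≫ SheafOfModules.ιFree a, D, ?_, ?_⟩⟩
  · rw [Preadditive.sum_comp, ← h']
    exact Finset.sum_congr rfl fun a _ ↦ by rw [Category.assoc, hD]
  · refine Cofan.IsColimit.hom_ext (SheafOfModules.isColimitFreeCofan I) _ _ fun a ↦ ?_
    change SheafOfModules.ιFree a ≫ D ≫ _ = SheafOfModules.ιFree a ≫ _
    rw [← Category.assoc, hD, Preadditive.comp_sum, Finset.sum_eq_single a, ← Category.assoc, h,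
      if_pos rfl, Category.id_comp, Category.comp_id]
    · intro b _ hb
      rw [← Category.assoc, h, if_neg hb.symm, zero_comp]
    · exact fun h ↦ (h (Finset.mem_univ _)).elim

end FreeIso

/-! ### Trivialization of the restriction to an open subscheme. -/

section Trivialization

variable {X : Scheme.{u}} {V : X.Modules} {W : X.Opens}

lemma image_ι_le (U : W.toScheme.Opens) : W.ι ''ᵁ U ≤ W := by
  rintro _ ⟨x, _, rfl⟩
  exact x.2

/-- Scalars act on the restriction through `appIso`, which is the identity for the inclusion of an
open set. -/
lemma restrict_smul {U : W.toScheme.Opens} (r : Γ(X, W.ι ''ᵁ U)) (v : Γ(V, W.ι ''ᵁ U)) :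
    (show Γ(V.restrict W.ι, U) from (show Γ(W.toScheme, U) from r) •
      (show Γ(V.restrict W.ι, U) from v)) = (show Γ(V.restrict W.ι, U) from r • v) := by
  have h : (W.ι.appIso U).inv r = r := by
    rw [Scheme.Opens.ι_appIso]
    rfl
  exact congrArg (fun a : Γ(X, W.ι ''ᵁ U) ↦ a • v) h

/-- Multiplication by a global section, on an open subscheme. -/
noncomputable def unitToRestrict (m : Γ(V, ⊤)) (W : X.Opens) :
    SheafOfModules.unit W.toScheme.ringCatSheaf ⟶ V.restrict W.ι where
  val := PresheafOfModules.homMk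
    { app := fun U ↦ AddCommGrpCat.ofHom
        (LinearMap.toSpanSingleton Γ(X, W.ι ''ᵁ U.unop) Γ(V, W.ι ''ᵁ U.unop)
          (glob m (W.ι ''ᵁ U.unop))).toAddMonoidHom
      naturality := fun U U' i ↦ by
        ext (r : Γ(X, W.ι ''ᵁ U.unop))
        have h : W.ι ''ᵁ U'.unop ≤ W.ι ''ᵁ U.unop := Scheme.Hom.image_mono _ i.unop.le
        change rres h r • glob m (W.ι ''ᵁ U'.unop) = mres V h (r • glob m (W.ι ''ᵁ U.unop))
        rw [mres_smul]
        exact congrArg (rres h r • ·) (mres_mres _ _ _ _).symm }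
    fun U (r : Γ(X, W.ι ''ᵁ U.unop)) (r' : Γ(X, W.ι ''ᵁ U.unop)) ↦
      (mul_smul r r' (glob m (W.ι ''ᵁ U.unop))).trans
        (restrict_smul (V := V) r (r' • glob m (W.ι ''ᵁ U.unop))).symm

/-- A local section of the dual sheaf, as a morphism. -/
noncomputable def restrictToUnit (φ : Γ(dual V, W)) :
    V.restrict W.ι ⟶ SheafOfModules.unit W.toScheme.ringCatSheaf where
  val := PresheafOfModules.homMk
    { app := fun U ↦ AddCommGrpCat.ofHom
        (applyDual φ (image_ι_le U.unop)).toAddMonoidHom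
      naturality := fun U U' i ↦ by
        ext (r : Γ(V, W.ι ''ᵁ U.unop))
        have h : W.ι ''ᵁ U'.unop ≤ W.ι ''ᵁ U.unop := Scheme.Hom.image_mono _ i.unop.le
        exact (rres_applyDual φ _ h r).symm }
    fun U (r : Γ(X, W.ι ''ᵁ U.unop)) (v : Γ(V, W.ι ''ᵁ U.unop)) ↦
      (congrArg (applyDual φ (image_ι_le U.unop)) (restrict_smul r v)).trans
        (map_smul (applyDual φ (image_ι_le U.unop)) r v)

lemma nonempty_restrict_iso_free {r : ℕ} (m : Fin r → Γ(V, ⊤)) (ψ : Fin r → Γ(dual V, W))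
    (h : ∀ a b, evalDual (glob (m a) W) (ψ b) = if a = b then 1 else 0)
    (h' : ∀ (U : X.Opens) (hU : U ≤ W) (v : Γ(V, U)),
      ∑ a, applyDual (ψ a) hU v • glob (m a) U = v) :
    Nonempty (V.restrict W.ι ≅
      SheafOfModules.free (R := W.toScheme.ringCatSheaf) (ULift.{u} (Fin r))) := by
  refine nonempty_iso_free (N := V.restrict W.ι) (fun a ↦ unitToRestrict (m a.down) W)
    (fun a ↦ restrictToUnit (ψ a.down)) (fun a b ↦ ?_) ?_
  · refine Scheme.Modules.hom_ext (M := SheafOfModules.unit W.toScheme.ringCatSheaf)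
      (N := SheafOfModules.unit W.toScheme.ringCatSheaf) _ _ fun U ↦ ?_
    ext (x : Γ(X, W.ι ''ᵁ U))
    have h1 : applyDual (ψ b.down) (image_ι_le U) (x • glob (m a.down) (W.ι ''ᵁ U)) =
        x * (if a = b then 1 else 0) := by
      rw [map_smul, applyDual_glob, h]
      simp only [ULift.ext_iff]
      split_ifs
      · rw [map_one, smul_eq_mul]
      · rw [map_zero, smul_zero, mul_zero]
    refine Eq.trans h1 ?_
    split_ifs
    · exact mul_one x
    · exact mul_zero x
  · refine Scheme.Modules.hom_ext (M := V.restrict W.ι) (N := V.restrict W.ι) _ _ fun U ↦ ?_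
    ext (v : Γ(V, W.ι ''ᵁ U))
    let E : (V.restrict W.ι ⟶ V.restrict W.ι) →+ Γ(V, W.ι ''ᵁ U) :=
      { toFun := fun f ↦ f.app U v
        map_zero' := rfl
        map_add' := fun _ _ ↦ rfl }
    refine Eq.trans (map_sum E _ _) (Eq.trans ?_ (h' _ (image_ι_le U) v))
    exact Equiv.sum_comp Equiv.ulift
      fun a ↦ applyDual (ψ a) (image_ι_le U) v • glob (m a) (W.ι ''ᵁ U)

end Trivialization

/-! ### Nonvanishing minors give local left inverses and local freeness. -/

section MinorTrivialization

attribute [local instance] Abelian.hasFiniteBiproducts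

variable {A σ : Type u} [CommRing A] [SetLike σ A] [AddSubgroupClass σ A]
  {𝒜 : ℕ → σ} [GradedRing 𝒜] {s t : ℕ} {B : Fin s → Fin t → 𝒜 1}

/-- A maximal minor of a matrix of elements of degree `1`. -/
def minor (B : Fin s → Fin t → 𝒜 1) (f : Fin t → Fin s) : A := Matrix.det (.of fun a b ↦ (B (f a) b : A))

lemma minor_mem_graded (f : Fin t → Fin s) : minor B f ∈ 𝒜 t := by
  rw [minor, Matrix.det_apply]
  refine sum_mem fun p _ ↦ ?_
  rw [Units.smul_def]
  refine zsmul_mem ?_ _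
  have h := SetLike.prod_mem_graded 𝒜 (fun _ : Fin t ↦ 1) (fun i ↦ (B (f (p i)) i : A))
    (F := Finset.univ) fun i _ ↦ (B (f (p i)) i).2
  simpa using h

lemma injective_of_minor_ne_zero {A σ : Type u} [CommRing A] [SetLike σ A] {𝒜 : ℕ → σ}
    {B : Fin s → Fin t → 𝒜 1} {f : Fin t → Fin s} (h : minor B f ≠ 0) : Function.Injective f := by
  intro a a' haa
  by_contra hne
  exact h (Matrix.det_zero_of_row_eq hne (funext fun b ↦ by simp [haa]))

omit [AddSubgroupClass σ A] [GradedRing 𝒜] in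
lemma map_minor {R : Type*} [CommRing R] (φ : A →+* R) (f : Fin t → Fin s) (u : R)
    (C : Matrix (Fin t) (Fin t) R) (hC : ∀ a c, C a c = φ (B (f a) c) * u) :
    C.det = φ (minor B f) * u ^ t := by
  have h := Matrix.det_smul (φ.mapMatrix (.of fun a b ↦ (B (f a) b : A))) u
  rw [Fintype.card_fin, ← RingHom.map_det, mul_comm] at h
  refine Eq.trans ?_ h
  congr 1
  ext a c
  exact (hC a c).trans (mul_comm _ _)

lemma units_mul_cancel {R : Type*} [CommRing R] (u v : Rˣ) (t : ℕ) :
    (v : R) * ((u ^ (-1 : ℤ) : Rˣ) : R) ^ t * ((u : R) ^ t * ((v ^ (-1 : ℤ) : Rˣ) : R)) = 1 := by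
  rw [← Units.val_pow_eq_pow_val, ← Units.val_pow_eq_pow_val, ← Units.val_mul, ← Units.val_mul,
    ← Units.val_mul, ← Units.val_one (α := R)]
  refine congrArg Units.val ?_
  rw [zpow_neg_one, zpow_neg_one, inv_pow, mul_assoc, inv_mul_cancel_left, mul_inv_cancel]

/-- Where a degree one element and a maximal minor do not vanish, the matrix of linear forms becomes
a matrix of functions with an invertible minor. -/
lemma exists_isUnit_det {ℓ : A} (hℓ : ℓ ∈ 𝒜 1) {W : Opens (ProjectiveSpectrum 𝒜)}
    (hW : W ≤ ProjectiveSpectrum.basicOpen 𝒜 ℓ) {f : Fin t → Fin s}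
    (hWf : W ≤ ProjectiveSpectrum.basicOpen 𝒜 (minor B f)) :
    ∃ b : Matrix (Fin s) (Fin t) Γ(Proj 𝒜, W),
      (∀ i j x, regVal (b i j) x = algebraMap A (LocAt 𝒜 x.1) (B i j) *
        ((locUnit ℓ x.1 (hW x.2) ^ (-1 : ℤ) : (LocAt 𝒜 x.1)ˣ) : LocAt 𝒜 x.1)) ∧
      IsUnit (b.submatrix f id).det := by
  choose b hb using fun i j ↦ exists_regVal_eq_mul hℓ hW (B i j)
  -- The determinant of the matrix divided by ℓ is minor / ℓ^t; its inverse ℓ^t / minor is again a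
  -- regular function.
  obtain ⟨r, hr⟩ := exists_regVal_eq (twistProd (W := W) (k := 0) (d := t) (e := -t) (by simp)
    (twistConst rfl ⟨ℓ ^ t, by simpa using SetLike.pow_mem_graded t hℓ⟩ W)
    (twistGen 𝒜 (minor_mem_graded f) (-1) hWf (by simp)))
  refine ⟨b, hb, IsUnit.of_mul_eq_one r (regVal_injective (funext fun x ↦ ?_))⟩
  have h1 : regAt x (Matrix.det ((Matrix.of b).submatrix f id)) =
      algebraMap A (LocAt 𝒜 x.1) (minor B f) *
      ((locUnit ℓ x.1 (hW x.2) ^ (-1 : ℤ) : (LocAt 𝒜 x.1)ˣ) : LocAt 𝒜 x.1) ^ t :=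
    (RingHom.map_det (regAt x) _).trans (map_minor _ f _ _ fun a c ↦ hb (f a) c x)
  refine (map_mul (regAt x) _ _).trans (Eq.trans ?_ (map_one (regAt x)).symm)
  have h3 : regAt x r = algebraMap A (LocAt 𝒜 x.1) ℓ ^ t *
      ((locUnit (minor B f) x.1 (hWf x.2) ^ (-1 : ℤ) :
        (LocAt 𝒜 x.1)ˣ) : LocAt 𝒜 x.1) :=
    (congrFun hr x).trans (congrArg (· * _) (map_pow (algebraMap A (LocAt 𝒜 x.1)) ℓ t))
  exact (congrArg₂ (· * ·) h1 h3).trans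
    (units_mul_cancel (locUnit ℓ x.1 (hW x.2)) (locUnit (minor B f) x.1 (hWf x.2)) t)

/-- Divided by ℓ, the matrix has an invertible minor and so a left inverse made of functions;
multiplying that by ℓ⁻¹ gives one in degree -1. -/
lemma exists_hasLeftInverse (hA : HasDegreeOneCover 𝒜) {f : Fin t → Fin s}
    {x : ProjectiveSpectrum 𝒜}
    (hx : minor B f ∉ x.asHomogeneousIdeal.toIdeal) :
    ∃ W : Opens (ProjectiveSpectrum 𝒜), x ∈ W ∧ HasLeftInverse B W := by
  obtain ⟨ℓ, hℓ, hxℓ⟩ := hA x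
  let W : Opens (ProjectiveSpectrum 𝒜) := ProjectiveSpectrum.basicOpen 𝒜 ℓ ⊓
    ProjectiveSpectrum.basicOpen 𝒜 (minor B f)
  have hW : W ≤ ProjectiveSpectrum.basicOpen 𝒜 ℓ := inf_le_left
  obtain ⟨b, hb, hdet⟩ := exists_isUnit_det (f := f) hℓ hW inf_le_right
  obtain ⟨ρ, hρ, -⟩ := exists_projection hdet
  refine ⟨W, ⟨hxℓ, hx⟩, fun j i ↦ ofCoord hℓ (-1) hW (ρ j i), fun y j k ↦ ?_⟩
  have h1 := congrArg (regAt y) (congrFun (congrFun hρ j) k)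
  rw [Matrix.mul_apply, Matrix.one_apply] at h1
  refine Eq.trans ?_ ((regVal_sum_mul _ _ _).symm.trans (h1.trans ?_))
  · refine Finset.sum_congr rfl fun i _ ↦ ?_
    refine Eq.trans ?_ (congrArg _ (hb i k y)).symm
    rw [ofCoord_val]
    exact (mul_assoc _ _ _).trans (congrArg _ (mul_comm _ _))
  · split_ifs
    · exact map_one _
    · exact map_zero _

lemma regVal_sum_rres_mul {ℓ : A} (hℓ : ℓ ∈ 𝒜 1) {W : Opens (ProjectiveSpectrum 𝒜)}
    (hW : W ≤ ProjectiveSpectrum.basicOpen 𝒜 ℓ) {b : Fin t → Γ(Proj 𝒜, W)} {a : Fin t → 𝒜 1}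
    (hb : ∀ j x, regVal (b j) x = algebraMap A (LocAt 𝒜 x.1) (a j) *
        ((locUnit ℓ x.1 (hW x.2) ^ (-1 : ℤ) : (LocAt 𝒜 x.1)ˣ) : LocAt 𝒜 x.1))
    {U : Opens (ProjectiveSpectrum 𝒜)} (hU : U ≤ W) (b' : Fin t → Γ(Proj 𝒜, U)) (y : U) :
    regVal (∑ j, rres (X := Proj 𝒜) hU (b j) * b' j) y =
        ∑ j, algebraMap A (LocAt 𝒜 y.1) (a j) * (ofCoord hℓ (-1) (hU.trans hW) (b' j)).1 y := by
  refine (regVal_sum_mul _ _ _).trans (Finset.sum_congr rfl fun j _ ↦ ?_)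
  refine (congrArg (· * _) (hb j ⟨y.1, hU y.2⟩)).trans ?_
  rw [ofCoord_val]
  exact (mul_assoc _ _ _).trans (congrArg _ (mul_comm _ _))

lemma IsPresentedBy.sum_eq_zero_iff_coord {V : (Proj 𝒜).Modules} {e : Fin s → Γ(V, ⊤)}
    (hV : IsPresentedBy V e B) {ℓ : A} (hℓ : ℓ ∈ 𝒜 1) {W : (Proj 𝒜).Opens}
    (hW : W ≤ ProjectiveSpectrum.basicOpen 𝒜 ℓ) {b : Matrix (Fin s) (Fin t) Γ(Proj 𝒜, W)}
    (hb : ∀ i j (x : (W : Opens (ProjectiveSpectrum 𝒜))),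
      regVal (b i j) x = algebraMap A (LocAt 𝒜 x.1) (B i j) *
        ((locUnit ℓ x.1 (hW x.2) ^ (-1 : ℤ) : (LocAt 𝒜 x.1)ˣ) : LocAt 𝒜 x.1))
    (U : (Proj 𝒜).Opens) (hU : U ≤ W) (c : Fin s → Γ(Proj 𝒜, U)) :
    ∑ i, c i • glob (e i) U = 0 ↔
      ∃ b' : Fin t → Γ(Proj 𝒜, U), ∀ i, c i = ∑ j, rres hU (b i j) * b' j := by
  refine (hV.sum_eq_zero_iff c).trans ⟨?_, ?_⟩
  · rintro ⟨b', hb'⟩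
    choose b'' hb'' using fun j ↦ exists_ofCoord_eq hℓ (-1) (hU.trans hW) (b' j)
    obtain rfl := funext hb''
    exact ⟨b'', fun i ↦ regVal_injective (funext fun y ↦
      (hb' i y).trans (regVal_sum_rres_mul hℓ hW (hb i) hU b'' y).symm)⟩
  · rintro ⟨b', hb'⟩
    exact ⟨fun j ↦ ofCoord hℓ (-1) (hU.trans hW) (b' j), fun i y ↦
      (congrFun (congrArg regVal (hb' i)) y).trans (regVal_sum_rres_mul hℓ hW (hb i) hU b' y)⟩

/-- Near a point where the minor with rows f is nonzero, the generators whose index is outside the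
range of f form a basis. -/
theorem isVectorBundle_of_minors (hA : HasDegreeOneCover 𝒜) {V : (Proj 𝒜).Modules}
    {e : Fin s → Γ(V, ⊤)} (hV : IsPresentedBy V e B) {r : ℕ} (hs : s = t + r)
    (hB : ∀ x : ProjectiveSpectrum 𝒜, ∃ f : Fin t → Fin s,
      minor B f ∉ x.asHomogeneousIdeal.toIdeal) :
    IsVectorBundle V r := by
  intro x
  obtain ⟨f, hf⟩ := hB x
  obtain ⟨ℓ, hℓ, hxℓ⟩ := hA x
  let W : (Proj 𝒜).Opens := ProjectiveSpectrum.basicOpen 𝒜 ℓ ⊓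
    ProjectiveSpectrum.basicOpen 𝒜 (minor B f)
  have hW : W ≤ ProjectiveSpectrum.basicOpen 𝒜 ℓ := inf_le_left
  obtain ⟨b, hb, hdet⟩ := exists_isUnit_det (f := f) hℓ hW inf_le_right
  have hfi : Function.Injective f :=
    injective_of_minor_ne_zero (B := B) fun h ↦ hf (h ▸ zero_mem _)
  obtain ⟨I, ψ, h1, h2⟩ := exists_dual_basis (W := W) hV.isGeneratedBy b
    (hV.sum_eq_zero_iff_coord hℓ hW hb) hs hfi hdet
  exact ⟨W, ⟨hxℓ, hf⟩, nonempty_restrict_iso_free _ ψ h1 h2⟩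

end MinorTrivialization

/-! ### Sections of direct sums and cokernels of sheaves of modules. -/

section ModuleBiproducts

attribute [local instance] Abelian.hasFiniteBiproducts

variable {X : Scheme.{u}}

/-- The action of morphisms of sheaves of modules on sections. -/
noncomputable def moduleSections (U : X.Opens) (F G : X.Modules) :
    (F ⟶ G) →+ (Γ(F, U) →+ Γ(G, U)) where
  toFun f := (f.app U).hom
  map_zero' := rfl
  map_add' _ _ := rfl

/-- A monomorphism is the kernel of its cokernel, and taking sections is left exact. -/
lemma exists_of_cokernel_π_app_eq_zero {F G : X.Modules} (f : F ⟶ G) [hf : Mono f] {U : X.Opens}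
    {s : Γ(G, U)} (hs : (cokernel.π f).app U s = 0) : ∃ r : Γ(F, U), f.app U r = s := by
  let E : X.Modules ⥤ AddCommGrpCat.{u} :=
    Scheme.Modules.toPresheaf X ⋙ (evaluation _ _).obj (op U)
  have : E.PreservesZeroMorphisms := ⟨fun _ _ ↦ rfl⟩
  have h1 : PreservesFiniteLimits (Scheme.Modules.toPresheaf X) :=
    PreservesLimits.preservesFiniteLimits _
  have h3 : PreservesLimits ((evaluation X.Opensᵒᵖ AddCommGrpCat.{u}).obj (op U)) :=
    ⟨⟨inferInstance⟩⟩
  have h4 : PreservesFiniteLimits ((evaluation X.Opensᵒᵖ AddCommGrpCat.{u}).obj (op U)) :=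
    PreservesLimits.preservesFiniteLimits _
  have h2 : PreservesFiniteLimits E := comp_preservesFiniteLimits _ _
  have h := (ShortComplex.exact_cokernel f).map_of_mono_of_preservesKernel E hf inferInstance
  exact (ShortComplex.ab_exact_iff _).1 h s hs

lemma mono_of_module_app_injective {F G : X.Modules} (f : F ⟶ G)
    (h : ∀ U : X.Opens, Function.Injective (f.app U)) : Mono f := by
  have h1 : Mono ((Scheme.Modules.toPresheaf X).map f) :=
    (NatTrans.mono_iff_mono_app _).2 fun U ↦ (AddCommGrpCat.mono_iff_injective _).2 (h U.unop)
  exact (Scheme.Modules.toPresheaf X).mono_of_mono_map h1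

variable {m : ℕ} {A : Fin m → X.Modules} {U : X.Opens}

variable (A) in
/-- A section of a direct sum of sheaves of modules, given by its components. -/
noncomputable def modSection (a : ∀ i, Γ(A i, U)) : Γ(⨁ A, U) := ∑ i, (biproduct.ι A i).app U (a i)

lemma app_modSection {G : X.Modules} (φ : ⨁ A ⟶ G) (a : ∀ i, Γ(A i, U)) :
    φ.app U (modSection A a) = ∑ i, (biproduct.ι A i ≫ φ).app U (a i) :=
  map_sum (moduleSections U _ _ φ) _ _

lemma π_modSection (a : ∀ i, Γ(A i, U)) (i : Fin m) :
    (biproduct.π A i).app U (modSection A a) = a i := by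
  rw [app_modSection, Finset.sum_eq_single i]
  · rw [biproduct.ι_π_self]
    rfl
  · intro j _ hj
    rw [biproduct.ι_π_ne A hj]
    rfl
  · exact fun h ↦ (h (Finset.mem_univ _)).elim

lemma modSection_π (s : Γ(⨁ A, U)) : modSection A (fun i ↦ (biproduct.π A i).app U s) = s := by
  have h := congrArg (moduleSections U _ _) (biproduct.total (f := A))
  rw [map_sum] at h
  have h' := DFunLike.congr_fun h s
  rw [AddMonoidHom.finsetSum_apply] at h'
  exact h'

lemma modSection_ext {s s' : Γ(⨁ A, U)}
    (h : ∀ i, (biproduct.π A i).app U s = (biproduct.π A i).app U s') : s = s' := by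
  rw [← modSection_π s, ← modSection_π s']
  exact congrArg _ (funext h)

lemma π_matrix_modSection {k : ℕ} {B : Fin k → X.Modules} (φ : ∀ i j, A i ⟶ B j)
    (a : ∀ i, Γ(A i, U)) (j : Fin k) :
    (biproduct.π B j).app U ((biproduct.matrix φ).app U (modSection A a)) =
      ∑ i, (φ i j).app U (a i) := by
  have h := app_modSection (biproduct.matrix φ ≫ biproduct.π B j) a
  simp only [biproduct.matrix_π, biproduct.ι_desc] at h
  rw [← h, ← biproduct.matrix_π]
  rfl

end ModuleBiproducts

/-! ### The cokernel of the matrix is presented by it. -/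

section CokernelPresentation

attribute [local instance] Abelian.hasFiniteBiproducts

variable {A σ : Type u} [CommRing A] [SetLike σ A] [AddSubgroupClass σ A]
  {𝒜 : ℕ → σ} [GradedRing 𝒜] {s t : ℕ}

/-- The section `1` of `𝒪`. -/
def twistOne (U : Opens (ProjectiveSpectrum 𝒜)) : twistSections 𝒜 0 U :=
  ⟨1, by
    have h := isTwistSection_const (𝒜 := 𝒜) SetLike.GradedOne.one_mem U
    simp only [map_one] at h
    exact h⟩

/-- A regular function as a section of `𝒪`. -/
noncomputable def twistFun {U : Opens (ProjectiveSpectrum 𝒜)} (r : Γ(Proj 𝒜, U)) :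
    twistSections 𝒜 0 U := r • twistOne U

lemma exists_twistFun {U : Opens (ProjectiveSpectrum 𝒜)} (f : twistSections 𝒜 0 U) :
    ∃ r : Γ(Proj 𝒜, U), twistFun r = f := by
  obtain ⟨r, hr⟩ := exists_regVal_eq f
  exact ⟨r, Subtype.ext ((mul_one (regVal r)).trans hr)⟩

/-- The map `𝒪(-1)^t ⟶ 𝒪^s` given by a matrix of elements of degree `1`. -/
noncomputable def matrixMap (B : Fin s → Fin t → 𝒜 1) :
    (⨁ fun _ : Fin t ↦ twistingSheaf 𝒜 (-1)) ⟶ (⨁ fun _ : Fin s ↦ twistingSheaf 𝒜 0) :=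
  biproduct.matrix fun j i ↦ twistMul (B i j) (by simp)

variable {B : Fin s → Fin t → 𝒜 1}

lemma π_matrixMap_val {U : Opens (ProjectiveSpectrum 𝒜)} (b : Fin t → twistSections 𝒜 (-1) U)
    (i : Fin s) (x : U) :
    ((biproduct.π (fun _ : Fin s ↦ twistingSheaf 𝒜 0) i).app U ((matrixMap B).app U
      (modSection (fun _ : Fin t ↦ twistingSheaf 𝒜 (-1)) b)) : twistSections 𝒜 0 U).1 x =
      ∑ j, algebraMap A (LocAt 𝒜 x.1) (B i j) * (b j).1 x :=
  (congrArg (evalAt 0 x) (π_matrix_modSection _ _ _)).trans (map_sum (evalAt 0 x) _ _)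

lemma mono_matrixMap
    (hB : ∀ x, ∃ W : Opens (ProjectiveSpectrum 𝒜), x ∈ W ∧ HasLeftInverse B W) :
    Mono (matrixMap B) := by
  refine mono_of_module_app_injective _ fun U ↦ ?_
  refine (injective_iff_map_eq_zero (moduleSections U _ _ (matrixMap B))).2 fun b hb ↦ ?_
  have hb' := modSection_π b
  generalize hβ : (fun i ↦ (biproduct.π (fun _ : Fin t ↦ twistingSheaf 𝒜 (-1)) i).app U b) = β at hb'
  have hβ0 : β = 0 := by
    refine funext fun j ↦ Subtype.ext (funext fun x ↦ ?_)
    obtain ⟨W, hxW, hW⟩ := hB x.1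
    refine congrFun (hW.eq_zero (x := ⟨x.1, hxW⟩)
      (b := fun j ↦ (β j : twistSections 𝒜 (-1) U).1 x) fun i ↦ ?_) j
    refine (π_matrixMap_val β i x).symm.trans ?_
    rw [hb']
    exact congrArg (evalAt 0 x) ((congrArg ((biproduct.π
      (fun _ : Fin s ↦ twistingSheaf 𝒜 0) i).app U) hb).trans (map_zero (moduleSections U _ _
        (biproduct.π (fun _ : Fin s ↦ twistingSheaf 𝒜 0) i))))
  rw [← hb', hβ0]
  exact Finset.sum_eq_zero fun _ _ ↦ map_zero _

/-- The generators of the cokernel. -/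
noncomputable def cokerGen (B : Fin s → Fin t → 𝒜 1) (i : Fin s) : Γ(cokernel (matrixMap B), ⊤) :=
  (biproduct.ι (fun _ : Fin s ↦ twistingSheaf 𝒜 0) i ≫ cokernel.π (matrixMap B)).app ⊤
    (twistOne (𝒜 := 𝒜) ⊤)

lemma sum_smul_cokerGen {U : (Proj 𝒜).Opens} (c : Fin s → Γ(Proj 𝒜, U)) :
    ∑ i, c i • glob (cokerGen B i) U = (cokernel.π (matrixMap B)).app U
      (modSection (fun _ : Fin s ↦ twistingSheaf 𝒜 0)
        fun i ↦ twistFun (c i)) := by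
  refine Eq.trans ?_ (app_modSection (cokernel.π (matrixMap B)) _).symm
  refine Finset.sum_congr rfl fun i _ ↦ ?_
  refine Eq.trans ?_ (Scheme.Modules.Hom.app_smul _ (c i) _).symm
  exact congrArg (c i • ·) (mres_app _ le_top _)

/-- The projection onto the cokernel is locally surjective. A combination of generators that
vanishes comes from a section of 𝒪(-1)^t over the same open set, because the matrix is a
monomorphism. -/
theorem isPresentedBy_cokernel
    (hB : ∀ x, ∃ W : Opens (ProjectiveSpectrum 𝒜), x ∈ W ∧ HasLeftInverse B W) :
    IsPresentedBy (cokernel (matrixMap B)) (cokerGen B) B where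
  exists_local {U} v x hx := by
    obtain ⟨W, h, r, hxW, hr⟩ := exists_local_lift_of_epi (cokernel.π (matrixMap B)) v hx
    choose c hc using fun i ↦ exists_twistFun (U := W)
      ((biproduct.π (fun _ : Fin s ↦ twistingSheaf 𝒜 0) i).app W r)
    refine ⟨W, h, c, hxW, (sum_smul_cokerGen c).trans (Eq.trans ?_ hr)⟩
    exact congrArg _ ((congrArg _ (funext hc)).trans (modSection_π r))
  sum_eq_zero_iff {U} c := by
    have := mono_matrixMap hB
    rw [sum_smul_cokerGen]
    constructor
    · intro h
      obtain ⟨r, hr⟩ := exists_of_cokernel_π_app_eq_zero _ h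
      refine ⟨fun j ↦ (biproduct.π (fun _ : Fin t ↦ twistingSheaf 𝒜 (-1)) j).app U r, fun i x ↦ ?_⟩
      refine Eq.trans ?_ (π_matrixMap_val _ i x)
      have h1 := (congrArg ((biproduct.π (fun _ : Fin s ↦ twistingSheaf 𝒜 0) i).app U)
        ((congrArg _ (modSection_π r)).trans hr)).trans (π_modSection _ i)
      exact ((congrArg (fun z : twistSections 𝒜 0 U ↦ z.1 x) h1).trans (mul_one _)).symm
    · rintro ⟨b, hb⟩
      have h1 : modSection (fun _ : Fin s ↦ twistingSheaf 𝒜 0)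
          (fun i ↦ twistFun (c i)) =
          (matrixMap B).app U (modSection (fun _ : Fin t ↦ twistingSheaf 𝒜 (-1)) b) := by
        refine modSection_ext fun i ↦ (π_modSection _ i).trans ?_
        refine Subtype.ext (funext fun x ↦ ?_)
        exact ((mul_one _).trans (hb i x)).trans (π_matrixMap_val b i x).symm
      rw [h1]
      exact ConcreteCategory.congr_hom (congrArg (fun φ ↦ φ.app U) (cokernel.condition (matrixMap B))) _

end CokernelPresentation

/-! ### Ext vanishing from long exact sequences, and matrices acting on Ext. -/

section ExtMatrices

open Abelian

variable {C : Type*} [Category C] [Abelian C] [HasExt C] {X : C} {S : ShortComplex C}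

attribute [local instance] Abelian.hasFiniteBiproducts

lemma ext_eq_zero_of_iso {Y F : C} (α : X ≅ Y) {i : ℕ} (h : ∀ x : Ext X F i, x = 0)
    (y : Ext Y F i) : y = 0 := by
  have h1 := congrArg (fun x ↦ (Ext.mk₀ α.inv).comp x (zero_add i))
    (h ((Ext.mk₀ α.hom).comp y (zero_add i)))
  rwa [← Ext.comp_assoc_of_second_deg_zero, Ext.mk₀_comp_mk₀, Iso.inv_hom_id, Ext.mk₀_id_comp,
    Ext.comp_zero] at h1

/-- Injectivity in degree i + 1 makes the connecting map zero, so `z` comes from the middle term;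
surjectivity in degree i makes the image of the middle term zero. -/
lemma ext_eq_zero_third (hS : S.ShortExact) {i : ℕ}
    (h₁ : ∀ y : Ext X S.X₂ i, ∃ x : Ext X S.X₁ i, x.comp (Ext.mk₀ S.f) (add_zero i) = y)
    (h₂ : ∀ x : Ext X S.X₁ (i + 1), x.comp (Ext.mk₀ S.f) (add_zero (i + 1)) = 0 → x = 0)
    (z : Ext X S.X₃ i) : z = 0 := by
  obtain ⟨y, rfl⟩ := Ext.covariant_sequence_exact₃ _ hS z rfl (h₂ _ (by
    rw [Ext.comp_assoc_of_third_deg_zero, hS.extClass_comp, Ext.comp_zero]))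
  obtain ⟨x, rfl⟩ := h₁ y
  rw [Ext.comp_assoc_of_third_deg_zero, Ext.mk₀_comp_mk₀, S.zero, Ext.mk₀_zero, Ext.comp_zero]

/-- Injectivity on the middle term makes `x` a connecting image, and surjectivity one degree lower
makes the connecting map zero. -/
lemma ext_eq_zero_first (hS : S.ShortExact) {i : ℕ}
    (h₁ : ∀ z : Ext X S.X₃ i, ∃ y : Ext X S.X₂ i, y.comp (Ext.mk₀ S.g) (add_zero i) = z)
    (h₂ : ∀ y : Ext X S.X₂ (i + 1), y.comp (Ext.mk₀ S.g) (add_zero (i + 1)) = 0 → y = 0)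
    (x : Ext X S.X₁ (i + 1)) : x = 0 := by
  obtain ⟨z, rfl⟩ := Ext.covariant_sequence_exact₁ _ hS x (h₂ _ (by
    rw [Ext.comp_assoc_of_third_deg_zero, Ext.mk₀_comp_mk₀, S.zero, Ext.mk₀_zero, Ext.comp_zero]))
    rfl
  obtain ⟨y, rfl⟩ := h₁ z
  rw [Ext.comp_assoc _ _ _ (add_zero i) (zero_add 1) (by lia), hS.comp_extClass, Ext.comp_zero]

lemma ext_eq_zero_first_zero (hS : S.ShortExact)
    (h : ∀ y : Ext X S.X₂ 0, y.comp (Ext.mk₀ S.g) (add_zero 0) = 0 → y = 0)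
    (x : Ext X S.X₁ 0) : x = 0 := by
  have h0 := h (x.comp (Ext.mk₀ S.f) (add_zero 0)) (by
    rw [Ext.comp_assoc_of_third_deg_zero, Ext.mk₀_comp_mk₀, S.zero, Ext.mk₀_zero, Ext.comp_zero])
  obtain ⟨f, rfl⟩ := (Ext.mk₀_bijective _ _).surjective x
  rw [Ext.mk₀_comp_mk₀] at h0
  have := hS.mono_f
  have h1 : f ≫ S.f = 0 ≫ S.f := by
    rw [zero_comp]
    exact (Ext.mk₀_bijective _ _).injective (h0.trans (Ext.mk₀_zero _ _).symm)
  rw [(cancel_mono S.f).1 h1, Ext.mk₀_zero]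

variable {p q : ℕ} {A : Fin q → C} {B : Fin p → C} {i : ℕ}

lemma ext_biproduct_ext {z z' : Ext X (⨁ A) i} (h : ∀ j, z.comp (Ext.mk₀ (biproduct.π A j)) (add_zero i) =
    z'.comp (Ext.mk₀ (biproduct.π A j)) (add_zero i)) : z = z' :=
  (Ext.addEquivBiproduct X (biproduct.isBilimit A) i).injective (funext h)

lemma exists_ext_biproduct (x : ∀ j, Ext X (A j) i) :
    ∃ z : Ext X (⨁ A) i, ∀ j, z.comp (Ext.mk₀ (biproduct.π A j)) (add_zero i) = x j := by
  obtain ⟨z, hz⟩ := (Ext.addEquivBiproduct X (biproduct.isBilimit A) i).surjective x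
  exact ⟨z, congrFun hz⟩

lemma ext_comp_matrix (φ : ∀ j k, A j ⟶ B k) (z : Ext X (⨁ A) i) (k : Fin p) :
    (z.comp (Ext.mk₀ (biproduct.matrix φ)) (add_zero i)).comp (Ext.mk₀ (biproduct.π B k)) (add_zero i) =
      ∑ j, (z.comp (Ext.mk₀ (biproduct.π A j)) (add_zero i)).comp (Ext.mk₀ (φ j k)) (add_zero i) := by
  simp only [Ext.comp_assoc_of_third_deg_zero, Ext.mk₀_comp_mk₀, ← Ext.comp_sum, ← Ext.mk₀_sum]
  rw [biproduct.matrix_π, biproduct.desc_eq]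

lemma ext_matrix_injective {φ : ∀ j k, A j ⟶ B k}
    (h : ∀ x : ∀ j, Ext X (A j) i, (∀ k, ∑ j, (x j).comp (Ext.mk₀ (φ j k)) (add_zero i) = 0) → x = 0)
    (z : Ext X (⨁ A) i) (hz : z.comp (Ext.mk₀ (biproduct.matrix φ)) (add_zero i) = 0) : z = 0 := by
  refine ext_biproduct_ext fun j ↦ ?_
  rw [Ext.zero_comp]
  refine congrFun (h (fun j ↦ z.comp (Ext.mk₀ (biproduct.π A j)) (add_zero i)) fun k ↦ ?_) j
  rw [← ext_comp_matrix, hz, Ext.zero_comp]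

lemma ext_matrix_surjective {φ : ∀ j k, A j ⟶ B k}
    (h : ∀ y : ∀ k, Ext X (B k) i, ∃ x : ∀ j, Ext X (A j) i,
      ∀ k, ∑ j, (x j).comp (Ext.mk₀ (φ j k)) (add_zero i) = y k)
    (w : Ext X (⨁ B) i) : ∃ z : Ext X (⨁ A) i, z.comp (Ext.mk₀ (biproduct.matrix φ)) (add_zero i) = w := by
  obtain ⟨x, hx⟩ := h fun k ↦ w.comp (Ext.mk₀ (biproduct.π B k)) (add_zero i)
  obtain ⟨z, hz⟩ := exists_ext_biproduct x
  refine ⟨z, ext_biproduct_ext fun k ↦ ?_⟩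
  rw [ext_comp_matrix, ← hx]
  simp only [hz]

end ExtMatrices

/-! ### Kernels and cokernels of matrices on the cohomology of 𝒪(d). -/

section MatrixCohomology

attribute [local instance] MvPolynomial.gradedAlgebra Abelian.hasFiniteBiproducts

open Abelian MvPolynomial

variable {K : Type u} [Field K] {n p q : ℕ}

/-- The matrix `C` of linear forms is injective on `H^i(𝒪(d))`. -/
def CohInjective (C : Fin p → Fin q → polyGrading K n 1) (d : ℤ) (i : ℕ) : Prop :=
  ∀ x : Fin q → PClass K n (lineAb K n d) i,
    (∀ a, ∑ b, (x b).comp (Ext.mk₀ (mulAb (C a b) (rfl : d + 1 = d + 1))) (add_zero i) = 0) → x = 0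

/-- The matrix `C` of linear forms is surjective on `H^i(𝒪(d))`. -/
def CohSurjective (C : Fin p → Fin q → polyGrading K n 1) (d : ℤ) (i : ℕ) : Prop :=
  ∀ y : Fin p → PClass K n (lineAb K n (d + 1)) i, ∃ x : Fin q → PClass K n (lineAb K n d) i,
    ∀ a, ∑ b, (x b).comp (Ext.mk₀ (mulAb (C a b) (rfl : d + 1 = d + 1))) (add_zero i) = y a

variable {C : Fin p → Fin q → polyGrading K n 1} {d : ℤ} {i : ℕ}

lemma CohInjective.of_eq_zero (h : ∀ x : PClass K n (lineAb K n d) i, x = 0) : CohInjective C d i :=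
  fun x _ ↦ funext fun b ↦ h (x b)

lemma CohSurjective.of_eq_zero (h : ∀ x : PClass K n (lineAb K n (d + 1)) i, x = 0) :
    CohSurjective C d i :=
  fun y ↦ ⟨0, fun a ↦ by rw [h (y a)]; exact Finset.sum_eq_zero fun b _ ↦ Ext.zero_comp ..⟩

lemma cohInjective_of_ne (h0 : i ≠ 0) (hn : i ≠ n) : CohInjective C d i :=
  .of_eq_zero fun x ↦ eq_zero_of_ne x h0 hn

lemma cohSurjective_of_ne (h0 : i ≠ 0) (hn : i ≠ n) : CohSurjective C d i :=
  .of_eq_zero fun x ↦ eq_zero_of_ne x h0 hn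

variable (hn : 1 ≤ n)

include hn

lemma cohInjective_of_pos (h0 : i ≠ 0) (hd : 0 < d + (n + 1)) : CohInjective C d i := by
  obtain rfl | h := eq_or_ne i n
  · exact .of_eq_zero fun x ↦ eq_zero_of_top h0 hd x
  · exact cohInjective_of_ne h0 h

/-- Surjectivity only concerns the target 𝒪(d + 1), so the bound is weaker by one than the one for
injectivity. -/
lemma cohSurjective_of_nonneg (h0 : i ≠ 0) (hd : 0 ≤ d + (n + 1)) : CohSurjective C d i := by
  obtain rfl | h := eq_or_ne i n
  · exact .of_eq_zero fun x ↦ eq_zero_of_top h0 (by lia) x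
  · exact cohSurjective_of_ne h0 h

lemma cohInjective_zero_of_neg (hd : d < 0) : CohInjective C d 0 :=
  .of_eq_zero fun x ↦ eq_zero_of_neg (by lia) hd x

lemma cohSurjective_of_lt (hi : i ≠ n) (hd : d < -1) : CohSurjective C d i := by
  obtain rfl | h := eq_or_ne i 0
  · exact .of_eq_zero fun x ↦ eq_zero_of_neg (by lia) (by lia) x
  · exact cohSurjective_of_ne h hi

end MatrixCohomology

/-! ### Natural cohomology from maximal rank. -/

section NaturalCohomology

attribute [local instance] MvPolynomial.gradedAlgebra Abelian.hasFiniteBiproducts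

open Abelian MvPolynomial

variable {K : Type u} [Field K] {n s t : ℕ}

lemma subsingleton_coh {F : AbSheaf (projSpace K n).toTopCat} {i : ℕ}
    (h : ∀ x : PClass K n F i, x = 0) : Subsingleton (Sheaf.H F i : Type u) := by
  refine subsingleton_of_forall_eq 0 fun x ↦ ?_
  exact ext_eq_zero_of_iso freeOpenTopIso h x

lemma hasNaturalCoh_of_exists {V : (projSpace K n).Modules}
    (h : ∀ a : ℤ, ∃ i₀ : ℕ, ∀ i ≠ i₀, ∀ x : PClass K n
      (tensorAb V (twistingSheaf (polyGrading K n) a)) i, x = 0) :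
    HasNaturalCoh (lineBundle K n) V := by
  intro a i j hi hj
  obtain ⟨i₀, h0⟩ := h a
  have key (l : ℕ) (hl : Nontrivial (coh (tensor V (lineBundle K n a)) l)) : l = i₀ := by
    by_contra hne
    have : Subsingleton (coh (tensor V (lineBundle K n a)) l) := subsingleton_coh (h0 l hne)
    exact not_subsingleton (coh (tensor V (lineBundle K n a)) l) this
  exact (key i hi).trans (key j hj).symm

lemma hasDegreeOneCover_polyGrading : HasDegreeOneCover (polyGrading K n) := by
  intro x
  have hx : x ∈ (⊤ : Opens (projSpace K n).toTopCat) := trivial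
  rw [← unionOpen_varOpen, unionOpen, Finset.sup_eq_iSup] at hx
  obtain ⟨i, hx⟩ := Opens.mem_iSup.1 hx
  obtain ⟨-, hx⟩ := Opens.mem_iSup.1 hx
  exact ⟨X i, isHomogeneous_X K i, mem_varOpen.1 hx i (by simp)⟩

variable {V : (Proj (polyGrading K n)).Modules} {e : Fin s → Γ(V, ⊤)}
  {B : Fin s → Fin t → polyGrading K n 1}

lemma eq_zero_of_presentation (hV : IsPresentedBy V e B)
    (hB : ∀ x, ∃ W : Opens (ProjectiveSpectrum (polyGrading K n)), x ∈ W ∧ HasLeftInverse B W)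
    {d : ℤ} {i : ℕ} (h₁ : CohSurjective B d i) (h₂ : CohInjective B d (i + 1))
    (x : PClass K n (tensorAb V (twistingSheaf (polyGrading K n) (d + 1))) i) : x = 0 :=
  ext_eq_zero_third (presentationComplex_shortExact hasDegreeOneCover_polyGrading hV hB rfl)
    (ext_matrix_surjective h₁) (ext_matrix_injective h₂) x

lemma eq_zero_of_dual_presentation (hV : IsPresentedBy V e B)
    (hB : ∀ x, ∃ W : Opens (ProjectiveSpectrum (polyGrading K n)), x ∈ W ∧ HasLeftInverse B W)
    {d : ℤ} {i : ℕ} (h₁ : CohSurjective (fun j k ↦ B k j) d i)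
    (h₂ : CohInjective (fun j k ↦ B k j) d (i + 1))
    (x : PClass K n (tensorAb (dual V) (twistingSheaf (polyGrading K n) d)) (i + 1)) : x = 0 :=
  ext_eq_zero_first (dualComplex_shortExact hasDegreeOneCover_polyGrading hV hB rfl)
    (ext_matrix_surjective h₁) (ext_matrix_injective h₂) x

lemma eq_zero_of_dual_presentation_zero (hV : IsPresentedBy V e B)
    (hB : ∀ x, ∃ W : Opens (ProjectiveSpectrum (polyGrading K n)), x ∈ W ∧ HasLeftInverse B W)
    {d : ℤ} (h : CohInjective (fun j k ↦ B k j) d 0)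
    (x : PClass K n (tensorAb (dual V) (twistingSheaf (polyGrading K n) d)) 0) : x = 0 :=
  ext_eq_zero_first_zero (dualComplex_shortExact hasDegreeOneCover_polyGrading hV hB rfl)
    (ext_matrix_injective h) x

/-- The transpose of the matrix `B` of linear forms has maximal rank in every degree, and is
surjective in large degrees. -/
structure HasMaximalRank (B : Fin s → Fin t → polyGrading K n 1) : Prop where
  injective_or_surjective : ∀ d, TransInjective B d ∨ TransSurjective B d
  exists_surjective : ∃ d, TransSurjective B d

variable (hn : 1 ≤ n) (hr : HasMaximalRank B)

include hn hr

/-- On Hⁿ the matrix is dual to its transpose on forms of degree m = -d - n - 2, which exchanges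
injectivity and surjectivity. In the boundary case d = -n - 1 the target has no Hⁿ. -/
lemma HasMaximalRank.cohInjective_or_cohSurjective {d : ℤ} (hd : d + (n + 1) ≤ 0) :
    CohInjective B d n ∨ CohSurjective B d n := by
  obtain h0 | h0 := hd.eq_or_lt
  · exact .inr (cohSurjective_of_nonneg hn (by lia) h0.ge)
  · obtain ⟨m, hm⟩ : ∃ m : ℕ, d + (m + 1) + (n + 1) = 0 := ⟨(-(d + (n + 1)) - 1).toNat, by lia⟩
    obtain h | h := hr.injective_or_surjective m
    · exact .inr (top_surjective (by lia) B rfl hm h)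
    · exact .inl (top_injective (by lia) B rfl hm h)

/-- Dual to the injectivity of B on polynomials, which follows from surjectivity of the transpose in
a single degree. -/
lemma HasMaximalRank.cohSurjective_transpose {d : ℤ} (hd : d + (n + 1) ≤ 0) :
    CohSurjective (fun j k ↦ B k j) d n := by
  obtain ⟨m, h⟩ := hr.exists_surjective
  obtain h0 | h0 := hd.eq_or_lt
  · exact cohSurjective_of_nonneg hn (by lia) h0.ge
  · obtain ⟨m, hm⟩ : ∃ m : ℕ, d + (m + 1) + (n + 1) = 0 := ⟨(-(d + (n + 1)) - 1).toNat, by lia⟩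
    exact top_surjective (by lia) (fun j k ↦ B k j) rfl hm fun u _ hu ↦ h.eq_zero hu

lemma HasMaximalRank.cohInjective_or_cohSurjective_transpose (d : ℤ) :
    CohInjective (fun j k ↦ B k j) d 0 ∨ CohSurjective (fun j k ↦ B k j) d 0 := by
  obtain hd | hd := lt_or_ge d 0
  · exact .inl (cohInjective_zero_of_neg hn hd)
  · obtain ⟨d, rfl⟩ := Int.eq_ofNat_of_zero_le hd
    obtain h | h := hr.injective_or_surjective d
    · exact .inl (global_injective (by lia) (fun j k ↦ B k j) rfl h)
    · exact .inr (global_surjective (by lia) (fun j k ↦ B k j) rfl h)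

/-- For d > -n - 1 the sums of line bundles have no cohomology in degree n, which leaves only H⁰.
For d ≤ -n - 1 there is no H⁰ either; only the kernel and the cokernel of B on Hⁿ matter, and they
contribute to degrees n - 1 and n respectively. Maximal rank kills one of them. -/
theorem hasNaturalCoh_of_presentation (hV : IsPresentedBy V e B)
    (hB : ∀ x, ∃ W : Opens (ProjectiveSpectrum (polyGrading K n)), x ∈ W ∧ HasLeftInverse B W) :
    HasNaturalCoh (lineBundle K n) V := by
  refine hasNaturalCoh_of_exists fun a ↦ ?_
  obtain ⟨d, rfl⟩ : ∃ d, a = d + 1 := ⟨a - 1, by lia⟩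
  obtain hd | hd := lt_or_ge 0 (d + (n + 1))
  · exact ⟨0, fun i hi ↦ eq_zero_of_presentation hV hB (cohSurjective_of_nonneg hn hi hd.le)
      (cohInjective_of_pos hn (by lia) hd)⟩
  · obtain h | h := hr.cohInjective_or_cohSurjective hn hd
    · refine ⟨n, fun i hi ↦ eq_zero_of_presentation hV hB (cohSurjective_of_lt hn hi (by lia)) ?_⟩
      obtain rfl | hi' := eq_or_ne n (i + 1)
      · exact h
      · exact cohInjective_of_ne (by lia) hi'.symm
    · refine ⟨n - 1, fun i hi ↦ eq_zero_of_presentation hV hB ?_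
        (cohInjective_of_ne (by lia) (by lia))⟩
      obtain rfl | hi' := eq_or_ne i n
      · exact h
      · exact cohSurjective_of_lt hn hi' (by lia)

/-- For d > -n - 1 only the kernel and the cokernel of the transpose on forms of degree d matter;
they contribute to degrees 0 and 1, and one of them vanishes. For d ≤ -n - 1 the transpose is onto
on Hⁿ, which leaves only degree n. -/
theorem hasNaturalCoh_dual_of_presentation (hV : IsPresentedBy V e B)
    (hB : ∀ x, ∃ W : Opens (ProjectiveSpectrum (polyGrading K n)), x ∈ W ∧ HasLeftInverse B W) :
    HasNaturalCoh (lineBundle K n) (dual (X := projSpace K n) V) := by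
  refine hasNaturalCoh_of_exists fun d ↦ ?_
  obtain hd | hd := lt_or_ge 0 (d + (n + 1))
  · have h2 (i : ℕ) : CohInjective (fun j k ↦ B k j) d (i + 1) := cohInjective_of_pos hn (by lia) hd
    obtain h | h := hr.cohInjective_or_cohSurjective_transpose hn d
    · refine ⟨1, fun i hi ↦ ?_⟩
      obtain _ | i := i
      · exact eq_zero_of_dual_presentation_zero hV hB h
      · exact eq_zero_of_dual_presentation hV hB (cohSurjective_of_nonneg hn (by lia) hd.le) (h2 i)
    · refine ⟨0, fun i hi ↦ ?_⟩
      obtain _ | _ | i := i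
      · exact (hi rfl).elim
      · exact eq_zero_of_dual_presentation hV hB h (h2 0)
      · exact eq_zero_of_dual_presentation hV hB (cohSurjective_of_nonneg hn (by lia) hd.le)
          (h2 (i + 1))
  · refine ⟨n, fun i hi ↦ ?_⟩
    obtain _ | i := i
    · exact eq_zero_of_dual_presentation_zero hV hB (cohInjective_zero_of_neg hn (by lia))
    · refine eq_zero_of_dual_presentation hV hB ?_ (cohInjective_of_ne (by lia) hi)
      obtain rfl | hi' := eq_or_ne i n
      · exact hr.cohSurjective_transpose hn hd
      · exact cohSurjective_of_lt hn hi' (by lia)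

end NaturalCohomology

/-! ### Maximal rank implies all the assertions about Steiner bundles. -/

section SteinerBundles

attribute [local instance] MvPolynomial.gradedAlgebra Abelian.hasFiniteBiproducts

variable {K : Type u} [Field K] {n s t r : ℕ}

lemma HasMaximalRank.exists_minor {B : Fin s → Fin t → polyGrading K n 1} (hr : HasMaximalRank B)
    (x : ProjectiveSpectrum (polyGrading K n)) :
    ∃ f : Fin t → Fin s, minor B f ∉ x.asHomogeneousIdeal.toIdeal :=
  hr.exists_surjective.elim fun _ hd ↦ hd.exists_minor x

lemma HasMaximalRank.exists_hasLeftInverse {B : Fin s → Fin t → polyGrading K n 1}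
    (hr : HasMaximalRank B) (x : ProjectiveSpectrum (polyGrading K n)) :
    ∃ W : Opens (ProjectiveSpectrum (polyGrading K n)), x ∈ W ∧ HasLeftInverse B W :=
  (hr.exists_minor x).elim fun _ hf ↦
    Steiner.exists_hasLeftInverse hasDegreeOneCover_polyGrading hf

theorem HasMaximalRank.isSteinerPresentation {M : Fin (t + r) × Fin t × Fin (n + 1) → K}
    (hr : HasMaximalRank (formMatrix M)) : IsSteinerPresentation M :=
  ⟨mono_matrixMap hr.exists_hasLeftInverse, isVectorBundle_of_minors hasDegreeOneCover_polyGrading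
    (isPresentedBy_cokernel hr.exists_hasLeftInverse) rfl hr.exists_minor⟩

theorem HasMaximalRank.hasNaturalCoh {M : Fin s × Fin t × Fin (n + 1) → K}
    (hr : HasMaximalRank (formMatrix M)) (hn : 1 ≤ n) :
    HasNaturalCoh (lineBundle K n) (steinerCoker M) :=
  hasNaturalCoh_of_presentation hn hr (isPresentedBy_cokernel hr.exists_hasLeftInverse)
    hr.exists_hasLeftInverse

theorem HasMaximalRank.hasNaturalCoh_dual {M : Fin s × Fin t × Fin (n + 1) → K}
    (hr : HasMaximalRank (formMatrix M)) (hn : 1 ≤ n) :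
    HasNaturalCoh (lineBundle K n) (dual (steinerCoker M)) :=
  hasNaturalCoh_dual_of_presentation hn hr (isPresentedBy_cokernel hr.exists_hasLeftInverse)
    hr.exists_hasLeftInverse

end SteinerBundles

end Steiner

theorem corollary4p3 {K : Type u} [Field K] [IsAlgClosed K] (n k t : ℕ) (hn : 1 ≤ n) (hk : 1 ≤ k) :
    Steiner.ForGeneral fun M : Fin (t + k * n) × Fin t × Fin (n + 1) → K ↦
      Steiner.IsSteinerPresentation M ∧
      Steiner.HasNaturalCoh (Steiner.lineBundle K n) (Steiner.steinerCoker M) ∧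
      Steiner.HasNaturalCoh (Steiner.lineBundle K n) (Steiner.dual (Steiner.steinerCoker M)) := by
  obtain ⟨F, hF, h⟩ := Steiner.exists_polynomial_maximal_rank K n t hk
  refine ⟨F, hF, fun M hM ↦ ?_⟩
  have hr : Steiner.HasMaximalRank (Steiner.formMatrix M) :=
    ⟨fun d ↦ (le_total (k * (d + 1)) t).imp (h M hM d).1 (h M hM d).2,
      -- Degree t is large enough for surjectivity, since t ≤ k(t + 1).
      t, (h M hM t).2 (by nlinarith)⟩
  exact ⟨hr.isSteinerPresentation, hr.hasNaturalCoh hn, hr.hasNaturalCoh_dual hn⟩
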